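/- **Setting.** Let $\mathrm{NesCob}$ be the symmetric strict monoidal category whose objects are finite collections of disjoint circles in the plane (up to isotopy, i.e. finite sets of circles with the relation "lies inside"), and whose morphisms are generated by permutations respecting nesting, births, deaths, ordinary merges and splits (of circles lying side by side) and nested merges and splits (of a circle and a circle lying immediately inside it), subject to: the interchange and permutation relations, commutativity and cocommutativity, the unit and counit relations and their nested versions, all ordinary and nested versions of associativity, coassociativity and the Frobenius relation (the two orders of performing surgery along two disjoint planar arcs), and the torus relation (ordinary handle $=$ nested handle). A $\mathbb Z_2$-extension of $\mathrm{NesCob}$ assigns a sign to every relation such that the 2-morphisms $\pm\mathrm{id}$ generated by the sign-modified relations give every 1-morphism only the trivial automorphism; it is strict if the interchange law holds with sign $+1$. Let $A=\mathbb Z\langle 1,X\rangle$, $\deg 1=1$, $\deg X=-1$. A strict EQFT based on the extension is a strict symmetric monoidal functor sending $a$ circles to $A^{\otimes a}$, permutations to the permutations of tensor factors, and satisfying all sign-modified relations; write $m_0,\Delta_0$ for the values of the ordinary and $m_1,\Delta_1$ for the values of the nested merge and split (the first factor belonging to the inner circle). We consider strict EQFTs that preserve degree (a cobordism having its Euler characteristic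 as degree) and whose generator values are congruent modulo 2 to those of Khovanov's TQFT, given by $A=\mathbb Z[X]/X^2$, $\Delta(1)=X\otimes1+1\otimes X$, $\Delta(X)=X\otimes X$, unit $1$, and counit $\epsilon(1)=0$, $\epsilon(X)=1$. **Theorem.** (a) The quadruples $(m_0,m_1,\Delta_0,\Delta_1)$ that arise from such EQFTs (over all strict $\mathbb Z_2$-extensions) are exactly the following: $$m_0:\ 1\otimes1\mapsto e_1 1,\ 1\otimes X,\,X\otimes 1\mapsto e_2X,\ X\otimes X\mapsto0;\qquad m_1:\ 1\otimes1\mapsto e_51,\ 1\otimes X\mapsto e_6X,\ X\otimes1\mapsto e_7X,\ X\otimes X\mapsto0;$$ $$\Delta_0:\ 1\mapsto e_3(X\otimes1+1\otimes X),\ X\mapsto e_4X\otimes X;\qquad \Delta_1:\ 1\mapsto e_8X\otimes1+e_9\,1\otimes X,\ X\mapsto e_{10}X\otimes X,$$ where $e_i\in\{1,-1\}$, $e_1=e_2$, $e_3=e_4$, $e_5=e_6$, $e_8=e_{10}$, $e_7e_8=e_5e_9$. There are exactly $32$ of them. (b) Let $F$ be any such EQFT and $D$ any oriented link diagram in the plane.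 Apply $F$ to the saddles of the cube of resolutions of $D$. Every two-dimensional face becomes commutative or anticommutative. There is a sign assignment: signs on the edges whose product is $-1$ around each commutative and $1$ around each anticommutative face. For every sign assignment, the signed sum of the edge maps squares to zero, the resulting bigraded complex is isomorphic to the Khovanov complex of $D$, and hence its homology is isomorphic to the Khovanov homology of $D$ in every bidegree. In particular, for two diagrams (of possibly different sizes) with isomorphic Khovanov homology, e.g. two diagrams of the same oriented link, the homologies obtained from $F$ are isomorphic for all choices of sign assignments. -/

import Mathlib

namespace NestedKh

/-! ## The rank two module of a circle

The module of a circle is free over `ℤ` on `1` and `X`; the module `A^{⊗C}` of a finite family `C`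
of circles is free on the labelings `C → Lab` (pure tensors of basis vectors) and is represented by
its coordinates `(C → Lab) → ℤ`. -/

/-- The two basis vectors `1` and `X` of `A`. -/
inductive Lab : Type
  | one
  | X
  deriving DecidableEq

instance : Fintype Lab := ⟨{.one, .X}, by intro x; cases x <;> simp⟩

/-- `deg 1 = 1`, `deg X = -1`. -/
def Lab.deg : Lab → ℤ
  | .one => 1
  | .X => -1

/-- The linear map `ℤ^α → ℤ^β` that sends the basis vector `x` to `∑ y, k x y • y`. -/
def linOf {α β : Type} [Fintype α] (k : α → β → ℤ) : (α → ℤ) →ₗ[ℤ] (β → ℤ) where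
  toFun f := fun y => ∑ x, f x * k x y
  map_add' f g := by
    funext y
    simp [add_mul, Finset.sum_add_distrib]
  map_smul' c f := by
    funext y
    simp [mul_assoc, Finset.mul_sum]

/-! ## Objects and generating morphisms of `NesCob` -/

/-- A finite collection of disjoint circles in the plane, recorded by the relation
`inside a b` ("`a` lies inside `b`"): a finite strict partial order in which the circles
around a given one form a chain.  The circles are named instead of numbered. -/
structure Config where
  Circ : Type
  finite : Finite Circ
  inside : Circ → Circ → Prop
  irrefl : ∀ a, ¬ inside a a
  trans : ∀ a b c, inside a b → inside b c → inside a c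
  chain : ∀ a b c, inside a b → inside a c → b = c ∨ inside b c ∨ inside c b

attribute [instance] Config.finite

noncomputable instance (C : Config) : Fintype (C.Circ → Lab) := Fintype.ofFinite _

/-- The kinds of generating cobordisms.  The flag of a merge or split is `true` for the nested
one (an annulus and a disc) and `false` for the ordinary one; `iso` is a permutation (renaming)
of circles that respects nesting. -/
inductive Kind : Type
  | iso
  | merge (nested : Bool)
  | split (nested : Bool)
  | birth
  | death
  deriving DecidableEq

/-- The circles `a`, `b` of `C` can be joined by a planar arc that meets no other circle, and the
surgery along it replaces them by the circle `c` of `D`; `same x y` says that the circle `x` of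
`C`, not involved, is the circle `y` of `D`.
Ordinary case: `a` and `b` lie next to each other.  Nested case: `a` lies immediately inside `b`;
the circles that were inside `a` are outside of `c` afterwards. -/
def Pants (nested : Bool) (C D : Config) (a b : C.Circ) (c : D.Circ)
    (same : C.Circ → D.Circ → Prop) : Prop :=
  a ≠ b ∧
  (match nested with
    | true => C.inside a b ∧ ∀ x, ¬ (C.inside a x ∧ C.inside x b)
    | false => ¬ C.inside a b ∧ ¬ C.inside b a ∧ ∀ x, C.inside a x ↔ C.inside b x) ∧
  ∀ x y, same x y →
    (D.inside y c ↔ Xor (C.inside x a) (C.inside x b)) ∧ (D.inside c y ↔ C.inside b x)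

/-- A generating cobordism, placed among identity cylinders over the circles that are not
involved.  `inp` and `out` are its incoming and outgoing circles; for the nested merge and the
nested split the inner circle is listed first.  `rest` matches the remaining circles. -/
structure Gen (C D : Config) where
  kind : Kind
  inp : List C.Circ
  out : List D.Circ
  rest : {x : C.Circ // x ∉ inp} ≃ {y : D.Circ // y ∉ out}
  rest_inside : ∀ x y, D.inside (rest x) (rest y) ↔ C.inside x y
  shape : match kind with
    | .iso => inp = [] ∧ out = []
    | .birth => inp = [] ∧ ∃ c, out = [c] ∧ ∀ y, ¬ D.inside y c
    | .death => out = [] ∧ ∃ c, inp = [c] ∧ ∀ x, ¬ C.inside x c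
    | .merge n => ∃ a b c, inp = [a, b] ∧ out = [c] ∧
        Pants n C D a b c (fun x y => ∃ h, (rest ⟨x, h⟩ : D.Circ) = y)
    | .split n => ∃ a b c, inp = [c] ∧ out = [a, b] ∧
        Pants n D C a b c (fun y x => ∃ h, (rest ⟨x, h⟩ : D.Circ) = y)

/-- The circle `x` is not involved and continues as `y`. -/
def Gen.same {C D : Config} (g : Gen C D) (x : C.Circ) (y : D.Circ) : Prop :=
  ∃ h, (g.rest ⟨x, h⟩ : D.Circ) = y

/-- `x` continues as `z` through `g` followed by `h`. -/
def same₂ {C D E : Config} (g : Gen C D) (h : Gen D E) (x : C.Circ) (z : E.Circ) : Prop :=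
  ∃ y, g.same x y ∧ h.same y z

/-- `g` merges `a` and `b` (in either order, nested or not) into `c`. -/
def Gen.Merges {C D : Config} (g : Gen C D) (a b : C.Circ) (c : D.Circ) : Prop :=
  (∃ n, g.kind = .merge n) ∧ (g.inp = [a, b] ∨ g.inp = [b, a]) ∧ g.out = [c]

/-- `g` splits `c` into `a` and `b` (in either order, nested or not). -/
def Gen.Splits {C D : Config} (g : Gen C D) (c : C.Circ) (a b : D.Circ) : Prop :=
  (∃ n, g.kind = .split n) ∧ g.inp = [c] ∧ (g.out = [a, b] ∨ g.out = [b, a])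

/-- The 1-morphisms: formal composites of generators. -/
inductive Word : Config → Config → Type 1
  | nil (C : Config) : Word C C
  | cons {C D E : Config} (g : Gen C D) (w : Word D E) : Word C E

/-- Composition, in the order of the arrows. -/
def Word.comp {C D E : Config} : Word C D → Word D E → Word C E
  | .nil _, w => w
  | .cons g u, w => .cons g (u.comp w)

def Gen.word {C D : Config} (g : Gen C D) : Word C D := .cons g (.nil D)

def word₂ {C D E : Config} (g : Gen C D) (h : Gen D E) : Word C E := .cons g (.cons h (.nil E))

/-! ## The relations of `NesCob`

In the relations with two saddles the nestedness of each saddle is dictated by the position of the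
circles, so that each of them comprises all nested and ordinary versions. -/

/-- Interchange: two generators, other than permutations, on disjoint sets of circles commute. -/
inductive Interchange : ∀ {C D : Config}, Word C D → Word C D → Prop
  | mk {C D D' E : Config} (g : Gen C D) (h : Gen D E) (h' : Gen C D') (g' : Gen D' E)
      (ng : g.kind ≠ .iso) (nh : h.kind ≠ .iso) (kg : g'.kind = g.kind) (kh : h'.kind = h.kind)
      (gi : List.Forall₂ h'.same g.inp g'.inp) (go : List.Forall₂ h.same g.out g'.out)
      (hi : List.Forall₂ g.same h'.inp h.inp) (ho : List.Forall₂ g'.same h'.out h.out)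
      (hs : ∀ x z, same₂ g h x z ↔ same₂ h' g' x z) :
      Interchange (word₂ g h) (word₂ h' g')

/-- The defining relations of `NesCob`. -/
inductive Rel : ∀ {C D : Config}, Word C D → Word C D → Prop
  | interchange {C D : Config} {f g : Word C D} (h : Interchange f g) : Rel f g
  /-- Permutations: the identity permutation. -/
  | iso_id {C : Config} (i : Gen C C) (hi : i.kind = .iso) (h : ∀ x y, i.same x y ↔ x = y) :
      Rel i.word (.nil C)
  /-- Permutations: composition of permutations. -/
  | iso_comp {C D E : Config} (i : Gen C D) (j : Gen D E) (k : Gen C E)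
      (hi : i.kind = .iso) (hj : j.kind = .iso) (hk : k.kind = .iso)
      (h : ∀ x z, k.same x z ↔ same₂ i j x z) :
      Rel (word₂ i j) k.word
  /-- A permutation slides through a generator (unit-, counit-, merge- and split-permutation). -/
  | iso_natural {C C' D D' : Config} (i : Gen C C') (g : Gen C' D') (g' : Gen C D) (j : Gen D D')
      (hi : i.kind = .iso) (hj : j.kind = .iso) (k : g'.kind = g.kind)
      (gi : List.Forall₂ i.same g'.inp g.inp) (go : List.Forall₂ j.same g'.out g.out)
      (hs : ∀ x z, same₂ i g x z ↔ same₂ g' j x z) :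
      Rel (word₂ i g) (word₂ g' j)
  /-- Commutativity. -/
  | comm {C D : Config} (g h : Gen C D) (a b : C.Circ) (c : D.Circ)
      (hg : g.Merges a b c) (hh : h.Merges b a c) (hs : ∀ x y, g.same x y ↔ h.same x y) :
      Rel g.word h.word
  /-- Cocommutativity. -/
  | cocomm {C D : Config} (g h : Gen C D) (c : C.Circ) (a b : D.Circ)
      (hg : g.Splits c a b) (hh : h.Splits c b a) (hs : ∀ x y, g.same x y ↔ h.same x y) :
      Rel g.word h.word
  /-- Associativity type: arcs from `a` to `b` and from `b` to `c`. -/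
  | assoc {C D D' E : Config} (g : Gen C D) (h : Gen D E) (h' : Gen C D') (g' : Gen D' E)
      (a b c : C.Circ) (x c' : D.Circ) (y a' : D'.Circ) (d : E.Circ)
      (h1 : g.Merges a b x) (h2 : g.same c c') (h3 : h.Merges x c' d)
      (h4 : h'.Merges b c y) (h5 : h'.same a a') (h6 : g'.Merges a' y d)
      (hs : ∀ x z, same₂ g h x z ↔ same₂ h' g' x z) :
      Rel (word₂ g h) (word₂ h' g')
  /-- Coassociativity type. -/
  | coassoc {C D D' E : Config} (g : Gen C D) (h : Gen D E) (h' : Gen C D') (g' : Gen D' E)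
      (d : C.Circ) (x c' : D.Circ) (y a' : D'.Circ) (a b c : E.Circ)
      (h1 : g.Splits d x c') (h2 : h.Splits x a b) (h3 : h.same c' c)
      (h4 : h'.Splits d a' y) (h5 : g'.Splits y b c) (h6 : g'.same a' a)
      (hs : ∀ x z, same₂ g h x z ↔ same₂ h' g' x z) :
      Rel (word₂ g h) (word₂ h' g')
  /-- Frobenius type: an arc from `a` to `b` and an arc from `b` to itself. -/
  | frob {C D D' E : Config} (g : Gen C D) (h : Gen D E) (h' : Gen C D') (g' : Gen D' E)
      (a b : C.Circ) (x : D.Circ) (a' b' v' : D'.Circ) (u v : E.Circ)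
      (h1 : g.Merges a b x) (h2 : h.Splits x u v)
      (h3 : h'.Splits b b' v') (h4 : h'.same a a') (h5 : g'.Merges a' b' u) (h6 : g'.same v' v)
      (hs : ∀ x z, same₂ g h x z ↔ same₂ h' g' x z) :
      Rel (word₂ g h) (word₂ h' g')
  /-- Torus: the ordinary handle and the nested handle. -/
  | torus {C D D' E : Config} (g : Gen C D) (h : Gen D E) (h' : Gen C D') (g' : Gen D' E)
      (p : C.Circ) (u v : D.Circ) (u' v' : D'.Circ) (q : E.Circ)
      (h1 : g.Splits p u v) (h2 : h.Merges u v q)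
      (h3 : h'.Splits p u' v') (h4 : g'.Merges u' v' q)
      (hs : ∀ x z, same₂ g h x z ↔ same₂ h' g' x z) :
      Rel (word₂ g h) (word₂ h' g')
  /-- Unit and nested unit: a new circle is merged into `a`. -/
  | unit {C D E : Config} (g : Gen C D) (h : Gen D E) (i : Gen C E)
      (a : C.Circ) (c a' : D.Circ) (d : E.Circ)
      (h1 : g.kind = .birth) (h2 : g.out = [c]) (h3 : g.same a a') (h4 : h.Merges c a' d)
      (hi : i.kind = .iso) (h5 : i.same a d)
      (hs : ∀ x z, x ≠ a → (same₂ g h x z ↔ i.same x z)) :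
      Rel (word₂ g h) i.word
  /-- Counit and nested counit: a circle is split off from `d` and dies. -/
  | counit {C D E : Config} (g : Gen C D) (h : Gen D E) (i : Gen C E)
      (d : C.Circ) (c a' : D.Circ) (a : E.Circ)
      (h1 : g.Splits d c a') (h2 : h.kind = .death) (h3 : h.inp = [c]) (h4 : h.same a' a)
      (hi : i.kind = .iso) (h5 : i.same d a)
      (hs : ∀ x z, x ≠ d → (same₂ g h x z ↔ i.same x z)) :
      Rel (word₂ g h) i.word

/-! ## `ℤ₂`-extensions -/

/-- The 2-morphisms generated by the sign-modified relations `f = σ C D f g • g`: `TwoCell σ s f g`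
says that there is a 2-morphism from `f` to `g` that is `s` times the identity. -/
inductive TwoCell (σ : ∀ C D : Config, Word C D → Word C D → ℤˣ) :
    ∀ {C D : Config}, ℤˣ → Word C D → Word C D → Prop
  | refl {C D : Config} (f : Word C D) : TwoCell σ 1 f f
  | rel {C D : Config} {f g : Word C D} (h : Rel f g) : TwoCell σ (σ C D f g) f g
  | symm {C D : Config} {s : ℤˣ} {f g : Word C D} (h : TwoCell σ s f g) : TwoCell σ s⁻¹ g f
  | trans {C D : Config} {s t : ℤˣ} {f g k : Word C D}
      (h : TwoCell σ s f g) (h' : TwoCell σ t g k) : TwoCell σ (s * t) f k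
  | whisker {B C D E : Config} {s : ℤˣ} {f g : Word C D} (u : Word B C) (w : Word D E)
      (h : TwoCell σ s f g) : TwoCell σ s (u.comp (f.comp w)) (u.comp (g.comp w))

/-- A `ℤ₂`-extension of `NesCob`: a sign for every relation such that every 1-morphism has only
the trivial automorphism. -/
structure Z2Extension where
  sign : ∀ C D : Config, Word C D → Word C D → ℤˣ
  cocycle : ∀ {C D : Config} (f : Word C D) (s : ℤˣ), TwoCell sign s f f → s = 1

/-- The extension is strict: the interchange law holds on the nose. -/
def Z2Extension.IsStrict (E : Z2Extension) : Prop :=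
  ∀ {C D : Config} (f g : Word C D), Interchange f g → E.sign C D f g = 1

/-! ## Extended quantum field theories -/

/-- Linear maps for the generators, by their matrices in the bases `1`, `X`:
`mul n a b c` is the coefficient of `c` in `m_n (a ⊗ b)`, `comul n a b c` the coefficient of
`b ⊗ c` in `Δ_n a`, where `n` is `true` for the nested generator (inner factor first). -/
structure GenValues where
  mul : Bool → Lab → Lab → Lab → ℤ
  comul : Bool → Lab → Lab → Lab → ℤ
  unit : Lab → ℤ
  counit : Lab → ℤ

/-- The matrix of a generating cobordism. -/
def GenValues.coeff (F : GenValues) : Kind → List Lab → List Lab → ℤ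
  | .iso, [], [] => 1
  | .merge n, [a, b], [c] => F.mul n a b c
  | .split n, [a], [b, c] => F.comul n a b c
  | .birth, [], [a] => F.unit a
  | .death, [a], [] => F.counit a
  | _, _, _ => 0

open scoped Classical in
/-- The matrix of a generator tensored with the identity of the circles that are not involved. -/
noncomputable def GenValues.extend (F : GenValues) {α β : Type} (k : Kind) (inp : List α)
    (out : List β) (same : α → β → Prop) (s : α → Lab) (s' : β → Lab) : ℤ :=
  if ∀ x y, same x y → s x = s' y then F.coeff k (inp.map s) (out.map s') else 0

/-- The functor on 1-morphisms. -/
noncomputable def GenValues.map (F : GenValues) {C D : Config} :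
    Word C D → (((C.Circ → Lab) → ℤ) →ₗ[ℤ] ((D.Circ → Lab) → ℤ))
  | .nil _ => LinearMap.id
  | .cons g w => F.map w ∘ₗ linOf (F.extend g.kind g.inp g.out g.same)

/-- An EQFT on the extension `E` which sends a circle to the module with basis `1`, `X`: each
2-morphism becomes an equality up to the sign given by `E`. -/
structure EQFT (E : Z2Extension) where
  val : GenValues
  map_rel : ∀ {C D : Config} (f g : Word C D), Rel f g →
    val.map f = (E.sign C D f g : ℤ) • val.map g

/-- The maps preserve degrees, a cobordism having its Euler characteristic as degree. -/
def GenValues.Graded (F : GenValues) : Prop :=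
  (∀ n a b c, F.mul n a b c ≠ 0 → c.deg = a.deg + b.deg - 1) ∧
  (∀ n a b c, F.comul n a b c ≠ 0 → b.deg + c.deg = a.deg - 1) ∧
  (∀ a, F.unit a ≠ 0 → a.deg = 1) ∧
  (∀ a, F.counit a ≠ 0 → 0 = a.deg + 1)

/-- `1⊗1 ↦ p 1`, `1⊗X ↦ q X`, `X⊗1 ↦ r X`, `X⊗X ↦ 0`. -/
def signedMul (p q r : ℤˣ) : Lab → Lab → Lab → ℤ
  | .one, .one, .one => p
  | .one, .X, .X => q
  | .X, .one, .X => r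
  | _, _, _ => 0

/-- `1 ↦ p X⊗1 + q 1⊗X`, `X ↦ r X⊗X`. -/
def signedComul (p q r : ℤˣ) : Lab → Lab → Lab → ℤ
  | .one, .X, .one => p
  | .one, .one, .X => q
  | .X, .X, .X => r
  | _, _, _ => 0

/-- Khovanov's TQFT, given by the Frobenius algebra `ℤ[X]/X²`; it does not see nesting. -/
def khovanov : GenValues where
  mul _ := signedMul 1 1 1
  comul _ := signedComul 1 1 1
  unit
    | .one => 1
    | .X => 0
  counit
    | .one => 0
    | .X => 1

/-- Equality of all matrices of generators modulo 2. -/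
def GenValues.ModTwoEq (F G : GenValues) : Prop :=
  (∀ n a b c, F.mul n a b c ≡ G.mul n a b c [ZMOD 2]) ∧
  (∀ n a b c, F.comul n a b c ≡ G.comul n a b c [ZMOD 2]) ∧
  (∀ a, F.unit a ≡ G.unit a [ZMOD 2]) ∧
  (∀ a, F.counit a ≡ G.counit a [ZMOD 2])

/-! ## Oriented link diagrams in the plane

Diagrams are drawn as link mosaics: on an `n × n` board of unit squares, each carrying one of the
eleven standard tiles, such that strands of neighbouring tiles match.  Every link diagram in the
plane is planar isotopic to a mosaic. -/

inductive Side : Type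
  | N
  | E
  | S
  | W
  deriving DecidableEq

/-- The eleven tiles.  Lower case letters name the sides that are joined; `nesw` has the two arcs
`NE` and `SW`, `nwse` the arcs `NW` and `SE`.  In `crossV` the vertical strand is the
over-strand, in `crossH` the horizontal one. -/
inductive Tile : Type
  | blank
  | ne
  | nw
  | se
  | sw
  | ns
  | ew
  | nesw
  | nwse
  | crossV
  | crossH
  deriving DecidableEq

def Tile.strands : Tile → List (Side × Side)
  | .blank => []
  | .ne => [(.N, .E)]
  | .nw => [(.N, .W)]
  | .se => [(.S, .E)]
  | .sw => [(.S, .W)]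
  | .ns => [(.N, .S)]
  | .ew => [(.E, .W)]
  | .nesw => [(.N, .E), (.S, .W)]
  | .nwse => [(.N, .W), (.S, .E)]
  | .crossV => [(.N, .S), (.E, .W)]
  | .crossH => [(.N, .S), (.E, .W)]

/-- A strand of the tile ends at the midpoint of the side `s`. -/
def Tile.Has (T : Tile) (s : Side) : Prop := ∃ p ∈ T.strands, p.1 = s ∨ p.2 = s

def Tile.IsCrossing (T : Tile) : Prop := T = .crossV ∨ T = .crossH

/-- The `0`-smoothing (`false`) and `1`-smoothing (`true`) of a crossing: the `0`-smoothing joins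
the two regions swept out by turning the over-strand counterclockwise. -/
def Tile.smooth : Tile → Bool → Tile
  | .crossV, false => .nesw
  | .crossV, true => .nwse
  | .crossH, false => .nwse
  | .crossH, true => .nesw
  | T, _ => T

/-- Midpoints of the edges of the board: `inl (i, j)` is the point on the horizontal edge in
column `i` at height `j`, `inr (i, j)` the point on the vertical edge in row `j` at abscissa `i`. -/
abbrev Pt (n : ℕ) : Type := (Fin n × Fin (n + 1)) ⊕ (Fin (n + 1) × Fin n)

/-- The midpoint of a side of the tile in column `t.1` and row `t.2` (rows counted upwards). -/
def pt {n : ℕ} (t : Fin n × Fin n) : Side → Pt n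
  | .N => .inl (t.1, t.2.succ)
  | .S => .inl (t.1, t.2.castSucc)
  | .E => .inr (t.1.succ, t.2)
  | .W => .inr (t.1.castSucc, t.2)

/-- With `dir p = true` for "up" or "right": the strand at the side `s` leaves the tile `t`. -/
def leaves {n : ℕ} (dir : Pt n → Bool) (t : Fin n × Fin n) : Side → Bool
  | .N => dir (pt t .N)
  | .E => dir (pt t .E)
  | .S => !dir (pt t .S)
  | .W => !dir (pt t .W)

/-- An oriented link diagram in the plane. -/
structure Diagram (n : ℕ) where
  tile : Fin n × Fin n → Tile
  /-- Strands continue in the neighbouring tile; none ends at the boundary of the board. -/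
  connected : ∀ t s, (tile t).Has s → ∃ t' s', t' ≠ t ∧ pt t' s' = pt t s ∧ (tile t').Has s'
  /-- The orientation: the direction of travel at each point of the link. -/
  dir : Pt n → Bool
  oriented : ∀ t, ∀ p ∈ (tile t).strands, leaves dir t p.1 ≠ leaves dir t p.2

namespace Diagram

variable {n : ℕ} (D : Diagram n)

abbrev Crossing : Type := {t : Fin n × Fin n // (D.tile t).IsCrossing}

noncomputable instance : Fintype D.Crossing := Fintype.ofFinite _

noncomputable instance : DecidableEq D.Crossing := Classical.decEq _

/-- A crossing is positive if (over-strand, under-strand) is a positively oriented frame. -/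
def IsPositive (x : D.Crossing) : Prop :=
  (D.tile x.1 = .crossV ∧ D.dir (pt x.1 .N) ≠ D.dir (pt x.1 .E)) ∨
  (D.tile x.1 = .crossH ∧ D.dir (pt x.1 .N) = D.dir (pt x.1 .E))

noncomputable def numPos : ℕ := Nat.card {x : D.Crossing // D.IsPositive x}

noncomputable def numNeg : ℕ := Nat.card {x : D.Crossing // ¬ D.IsPositive x}

/-- Vertices of the cube of resolutions: the set of crossings that get the `1`-smoothing. -/
abbrev Vertex : Type := Finset D.Crossing

open scoped Classical in
/-- The tile `t` in the resolution `v`. -/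
noncomputable def resolved (v : D.Vertex) (t : Fin n × Fin n) : Tile :=
  (D.tile t).smooth (decide (∃ x ∈ v, x.1 = t))

/-- Two points are joined by a strand inside some tile of the resolution `v`. -/
def Linked (v : D.Vertex) (p q : Pt n) : Prop :=
  ∃ t, ∃ a ∈ (D.resolved v t).strands, pt t a.1 = p ∧ pt t a.2 = q

/-- The points on the same circle of the resolution `v` as `p`. -/
def circleSet (v : D.Vertex) (p : Pt n) : Set (Pt n) :=
  {q | Relation.EqvGen (D.Linked v) p q}

/-- The circles of the resolution `v`, each given by the set of points through which it passes. -/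
def Circle (v : D.Vertex) : Type :=
  {c : Set (Pt n) // ∃ t s, (D.tile t).Has s ∧ D.circleSet v (pt t s) = c}

instance (v : D.Vertex) : Finite (D.Circle v) :=
  inferInstanceAs (Finite {c : Set (Pt n) // _})

noncomputable instance (v : D.Vertex) : Fintype (D.Circle v) := Fintype.ofFinite _

noncomputable instance (v : D.Vertex) : DecidableEq (D.Circle v) := Classical.decEq _

noncomputable instance (v : D.Vertex) : Fintype (D.Circle v → Lab) := Fintype.ofFinite _

theorem crossing_has (x : D.Crossing) (s : Side) : (D.tile x.1).Has s := by
  rcases x.2 with h | h <;> rw [h] <;> cases s <;> simp [Tile.Has, Tile.strands]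

/-- The circle of the resolution `v` that passes through the side `s` of the crossing `x`. -/
def circleAt (v : D.Vertex) (x : D.Crossing) (s : Side) : D.Circle v :=
  ⟨D.circleSet v (pt x.1 s), x.1, s, D.crossing_has x s, rfl⟩

/-- The circle `c` lies inside the circle `d` (even-odd rule): the ray to the right from a point
of `c` on a horizontal edge crosses `d` an odd number of times. -/
def Inside {v : D.Vertex} (c d : D.Circle v) : Prop :=
  c ≠ d ∧ ∃ i j, Sum.inl (i, j) ∈ c.1 ∧ Odd (Set.ncard {i' | i < i' ∧ Sum.inl (i', j) ∈ d.1})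

open scoped Classical in
/-- The matrix of the saddle at the crossing `x` from the resolution `v` to the resolution
`v' = v ∪ {x}`.  In each resolution the two arcs near the crossing pass through its northern and
its southern side.  The other circles are the same in both resolutions. -/
noncomputable def edge (F : GenValues) (v v' : D.Vertex) (x : D.Crossing) :
    (D.Circle v → Lab) → (D.Circle v' → Lab) → ℤ :=
  let a := D.circleAt v x .N
  let b := D.circleAt v x .S
  let a' := D.circleAt v' x .N
  let b' := D.circleAt v' x .S
  let same : D.Circle v → D.Circle v' → Prop := fun c c' => c.1 = c'.1
  if a ≠ b then
    if D.Inside a b then F.extend (.merge true) [a, b] [a'] same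
    else if D.Inside b a then F.extend (.merge true) [b, a] [a'] same
    else F.extend (.merge false) [a, b] [a'] same
  else
    if D.Inside a' b' then F.extend (.split true) [a] [a', b'] same
    else if D.Inside b' a' then F.extend (.split true) [a] [b', a'] same
    else F.extend (.split false) [a] [a', b'] same

/-- The composite of the saddle at `x` and the saddle at `y`, from `v` to `w = v ∪ {x, y}`. -/
noncomputable def facePath (F : GenValues) (v w : D.Vertex) (x y : D.Crossing)
    (s : D.Circle v → Lab) (s' : D.Circle w → Lab) : ℤ :=
  ∑ r : D.Circle (insert x v) → Lab,
    D.edge F v (insert x v) x s r * D.edge F (insert x v) w y r s'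

/-- The two ways around the face of the cube at `v` spanned by `x` and `y` agree. -/
def FaceCommutes (F : GenValues) (v : D.Vertex) (x y : D.Crossing) : Prop :=
  ∀ s s', D.facePath F v (v ∪ {x, y}) x y s s' = D.facePath F v (v ∪ {x, y}) y x s s'

/-- The two ways around the face of the cube at `v` spanned by `x` and `y` differ by the sign. -/
def FaceAnticommutes (F : GenValues) (v : D.Vertex) (x y : D.Crossing) : Prop :=
  ∀ s s', D.facePath F v (v ∪ {x, y}) x y s s' = - D.facePath F v (v ∪ {x, y}) y x s s'

/-- `sgn v x` is the sign on the edge from `v` to `v ∪ {x}`.  A sign assignment has product `-1`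
around each commutative face and product `1` around each anticommutative face. -/
def IsSignAssignment (F : GenValues) (sgn : D.Vertex → D.Crossing → ℤˣ) : Prop :=
  ∀ (v : D.Vertex) (x y : D.Crossing), x ∉ v → y ∉ v → x ≠ y →
    (D.FaceCommutes F v x y →
      sgn v x * sgn (insert x v) y * sgn v y * sgn (insert y v) x = -1) ∧
    (D.FaceAnticommutes F v x y →
      sgn v x * sgn (insert x v) y * sgn v y * sgn (insert y v) x = 1)

open scoped Classical in
/-- Khovanov's signs: `-1` to the number of crossings before `x` with a `1`-smoothing, where the
crossings are numbered row by row. -/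
noncomputable def stdSign (v : D.Vertex) (x : D.Crossing) : ℤˣ :=
  (-1) ^ (v.filter fun y =>
    y.1.2 < x.1.2 ∨ (y.1.2 = x.1.2 ∧ y.1.1 < x.1.1)).card

/-- The standard generators of the cube complex: a resolution with labeled circles. -/
abbrev EState : Type := Σ v : D.Vertex, (D.Circle v → Lab)

/-- Homological degree: the height in the cube minus the number of negative crossings. -/
noncomputable def hdeg (z : D.EState) : ℤ := (z.1.card : ℤ) - D.numNeg

/-- Quantum degree. -/
noncomputable def qdeg (z : D.EState) : ℤ :=
  (∑ c, (z.2 c).deg) + z.1.card + D.numPos - 2 * D.numNeg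

/-- Generators of bidegree `(r, q)`. -/
abbrev Basis (r q : ℤ) : Type := {z : D.EState // D.hdeg z = r ∧ D.qdeg z = q}

noncomputable instance (r q : ℤ) : Fintype (D.Basis r q) :=
  have : Finite D.EState := inferInstanceAs (Finite (Σ v : D.Vertex, (D.Circle v → Lab)))
  Fintype.ofFinite _

/-- The chain group of bidegree `(r, q)`. -/
abbrev Chain (r q : ℤ) : Type := D.Basis r q → ℤ

open scoped Classical in
/-- The differential from homological degree `r` to `r'` (it vanishes unless `r' = r + 1`): the
sum of the signed saddle maps along the edges of the cube. -/
noncomputable def d (F : GenValues) (sgn : D.Vertex → D.Crossing → ℤˣ) (r r' q : ℤ) :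
    D.Chain r q →ₗ[ℤ] D.Chain r' q :=
  linOf fun z w => ∑ x : D.Crossing,
    if x ∉ z.1.1 ∧ w.1.1 = insert x z.1.1 then
      (sgn z.1.1 x : ℤ) * D.edge F z.1.1 w.1.1 x z.1.2 w.1.2
    else 0

/-- The homology in bidegree `(r, q)`: kernel modulo image. -/
abbrev Homology (F : GenValues) (sgn : D.Vertex → D.Crossing → ℤˣ) (r q : ℤ) : Type :=
  LinearMap.ker (D.d F sgn r (r + 1) q) ⧸
    (LinearMap.range (D.d F sgn (r - 1) r q)).comap (LinearMap.ker (D.d F sgn r (r + 1) q)).subtype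

/-- Khovanov homology. -/
abbrev Kh (r q : ℤ) : Type := D.Homology khovanov D.stdSign r q

end Diagram

/-- `F` is the list of generator values of a degree preserving strict EQFT, based on some
`ℤ₂`-extension of `NesCob`, that agrees with Khovanov's TQFT modulo 2. -/
def IsKhovanovLike (F : GenValues) : Prop :=
  ∃ E : Z2Extension, E.IsStrict ∧ (∃ T : EQFT E, T.val = F) ∧
    F.Graded ∧ F.ModTwoEq khovanov

end NestedKh

open NestedKh

namespace NestedKh

section Linear

variable {α β γ : Type} [Fintype α]

theorem linOf_apply (k : α → β → ℤ) (f : α → ℤ) (y : β) : linOf k f y = ∑ x, f x * k x y := rfl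

open scoped Classical in
theorem linOf_single (k : α → β → ℤ) (x : α) (y : β) : linOf k (Pi.single x 1) y = k x y := by
  simp [linOf_apply, Pi.single_apply]

theorem linOf_injective : Function.Injective (linOf : (α → β → ℤ) → _) := by
  classical
  intro k k' h
  funext x y
  rw [← linOf_single k, ← linOf_single k', h]

theorem linOf_comp [Fintype β] (k : α → β → ℤ) (k' : β → γ → ℤ) :
    linOf k' ∘ₗ linOf k = linOf fun x z => ∑ y, k x y * k' y z := by
  refine LinearMap.ext fun f => funext fun z => ?_
  simp only [LinearMap.comp_apply, linOf_apply, Finset.sum_mul, Finset.mul_sum, mul_assoc]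
  exact Finset.sum_comm

open scoped Classical in
theorem linOf_id : linOf (fun x y : α => if x = y then 1 else 0) = LinearMap.id := by
  refine LinearMap.ext fun f => funext fun z => ?_
  simp [linOf_apply]

theorem linOf_smul (c : ℤ) (k : α → β → ℤ) : linOf (fun x y => c * k x y) = c • linOf k := by
  refine LinearMap.ext fun f => funext fun z => ?_
  simp only [LinearMap.smul_apply, Pi.smul_apply, linOf_apply, smul_eq_mul, Finset.mul_sum]
  exact Finset.sum_congr rfl fun x _ => by ring

end Linear

/-- `same` is a bijection between the complement of `inp` and the complement of `out`. -/
structure Matching {α β : Type} (inp : List α) (out : List β) (same : α → β → Prop) : Prop where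
  nodup_inp : inp.Nodup
  nodup_out : out.Nodup
  not_mem_inp : ∀ {x y}, same x y → x ∉ inp
  not_mem_out : ∀ {x y}, same x y → y ∉ out
  exists_right : ∀ {x}, x ∉ inp → ∃ y, same x y
  exists_left : ∀ {y}, y ∉ out → ∃ x, same x y
  right_unique : ∀ {x y y'}, same x y → same x y' → y = y'
  left_unique : ∀ {x x' y}, same x y → same x' y → x = x'

theorem Matching.of_equiv {α β : Type} {inp : List α} {out : List β} (hi : inp.Nodup)
    (ho : out.Nodup) (e : {x // x ∉ inp} ≃ {y // y ∉ out}) :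
    Matching inp out fun x y => ∃ h, (e ⟨x, h⟩ : β) = y where
  nodup_inp := hi
  nodup_out := ho
  not_mem_inp h := h.1
  not_mem_out := by
    rintro x y ⟨h, rfl⟩
    exact (e ⟨x, h⟩).2
  exists_right h := ⟨_, h, rfl⟩
  exists_left {y} h := ⟨e.symm ⟨y, h⟩, (e.symm ⟨y, h⟩).2, by simp⟩
  right_unique := by
    rintro x y y' ⟨h, rfl⟩ ⟨_, rfl⟩
    rfl
  left_unique := by
    rintro x x' y ⟨h, rfl⟩ ⟨h', h''⟩
    have := e.injective (Subtype.ext h'')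
    exact (congrArg Subtype.val this).symm

namespace Matching

variable {α β γ : Type} {inp : List α} {out : List β} {same : α → β → Prop}

theorem symm (H : Matching inp out same) : Matching out inp fun y x => same x y where
  nodup_inp := H.nodup_out
  nodup_out := H.nodup_inp
  not_mem_inp := H.not_mem_out
  not_mem_out := H.not_mem_inp
  exists_right := H.exists_left
  exists_left := H.exists_right
  right_unique := H.left_unique
  left_unique := H.right_unique

@[to_additive]
theorem prod_eq {M : Type*} [CommMonoid M] [Fintype α] [Fintype β] (H : Matching inp out same)
    (f : α → M) (g : β → M) (h : ∀ x y, same x y → f x = g y) :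
    (∏ x, f x) * (out.map g).prod = (∏ y, g y) * (inp.map f).prod := by
  classical
  rw [← Finset.prod_mul_prod_compl inp.toFinset f, ← Finset.prod_mul_prod_compl out.toFinset g,
    List.prod_toFinset _ H.nodup_inp, List.prod_toFinset _ H.nodup_out]
  have key : ∏ x ∈ inp.toFinsetᶜ, f x = ∏ y ∈ out.toFinsetᶜ, g y := by
    have h1 : ∀ x ∈ inp.toFinsetᶜ, ∃ y, same x y := fun x hx => H.exists_right (by simpa using hx)
    choose i hi using h1
    refine Finset.prod_bij i (fun x hx => ?_) (fun x hx x' hx' e => ?_) (fun y hy => ?_)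
      fun x hx => h _ _ (hi x hx)
    · simpa using H.not_mem_out (hi x hx)
    · exact H.left_unique (hi x hx) (e ▸ hi x' hx')
    · obtain ⟨x, hx⟩ := H.exists_left (y := y) (by simpa using hy)
      have hx' : x ∈ inp.toFinsetᶜ := by simpa using H.not_mem_inp hx
      exact ⟨x, hx', H.right_unique (hi x hx') hx⟩
  rw [key]
  ac_rfl

end Matching

/-- Labelings that agree along `same`. -/
def Compat {α β : Type} (same : α → β → Prop) (s : α → Lab) (s' : β → Lab) : Prop :=
  ∀ x y, same x y → s x = s' y

open scoped Classical in
theorem extend_eq (F : GenValues) {α β : Type} (k : Kind) (inp : List α) (out : List β)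
    (same : α → β → Prop) (s : α → Lab) (s' : β → Lab) :
    F.extend k inp out same s s' =
      if Compat same s s' then F.coeff k (inp.map s) (out.map s') else 0 := rfl

section TwoStep

variable {α β γ : Type} {gi : List α} {go : List β} {gs : α → β → Prop} {hi : List β}
  {ho : List γ} {hs : β → γ → Prop}

/-- Composition of relations. -/
def relComp (gs : α → β → Prop) (hs : β → γ → Prop) (x : α) (z : γ) : Prop :=
  ∃ y, gs x y ∧ hs y z

theorem exists_middle (Hg : Matching gi go gs) (Hh : Matching hi ho hs) {s : α → Lab}
    {z : γ → Lab} (h : Compat (relComp gs hs) s z) :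
    ∃ r : β → Lab, Compat gs s r ∧ Compat hs r z := by
  classical
  refine ⟨fun y => if h : ∃ x, gs x y then s h.choose else
    if h : ∃ w, hs y w then z h.choose else .one, fun x y hxy => ?_, fun y w hyw => ?_⟩
  · have h1 : ∃ x, gs x y := ⟨x, hxy⟩
    simp only [h1, dite_true]
    rw [Hg.left_unique hxy h1.choose_spec]
  · by_cases h1 : ∃ x, gs x y
    · simp only [h1, dite_true]
      exact h _ _ ⟨y, h1.choose_spec, hyw⟩
    · have h2 : ∃ w, hs y w := ⟨w, hyw⟩
      simp only [h1, h2, dite_true, dite_false]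
      rw [Hh.right_unique hyw h2.choose_spec]

variable [Fintype (β → Lab)] (F : GenValues) (k k' : Kind)

theorem two_step_zero {s : α → Lab} {z : γ → Lab} (h : ¬ Compat (relComp gs hs) s z) :
    ∑ r, F.extend k gi go gs s r * F.extend k' hi ho hs r z = 0 := by
  classical
  refine Finset.sum_eq_zero fun r _ => ?_
  simp only [extend_eq]
  split_ifs with h1 h2
  · refine absurd (fun x w ⟨y, hxy, hyw⟩ => ?_) h
    rw [h1 _ _ hxy, h2 _ _ hyw]
  all_goals simp

open scoped Classical in
theorem two_step_aux (Hg : Matching gi go gs) (Hh : Matching hi ho hs) {s : α → Lab}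
    {r₀ : β → Lab} {z : γ → Lab} (h1 : Compat gs s r₀) (h2 : Compat hs r₀ z) :
    ∑ r, F.extend k gi go gs s r * F.extend k' hi ho hs r z =
      ∑ r with ∀ y, (y ∈ go → y ∉ hi) → r y = r₀ y,
        F.coeff k (gi.map s) (go.map r) * F.coeff k' (hi.map r) (ho.map z) := by
  rw [Finset.sum_filter]
  refine Finset.sum_congr rfl fun r _ => ?_
  simp only [extend_eq]
  have key : (∀ y, (y ∈ go → y ∉ hi) → r y = r₀ y) ↔ Compat gs s r ∧ Compat hs r z := by
    constructor
    · intro h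
      refine ⟨fun x y hxy => ?_, fun y w hyw => ?_⟩
      · rw [h y fun hy => absurd hy (Hg.not_mem_out hxy), h1 _ _ hxy]
      · rw [h y fun _ => Hh.not_mem_inp hyw, h2 _ _ hyw]
    · rintro ⟨h3, h4⟩ y hy
      by_cases hy' : y ∈ go
      · obtain ⟨w, hw⟩ := Hh.exists_right (hy hy')
        rw [h4 _ _ hw, h2 _ _ hw]
      · obtain ⟨x, hx⟩ := Hg.exists_left hy'
        rw [← h3 _ _ hx, ← h1 _ _ hx]
  rw [if_congr key rfl rfl]
  split_ifs <;> simp_all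

theorem two_step_none (Hg : Matching gi go gs) (Hh : Matching hi ho hs) {s : α → Lab}
    {r₀ : β → Lab} {z : γ → Lab} (h1 : Compat gs s r₀) (h2 : Compat hs r₀ z)
    (hm : ∀ y ∈ go, y ∉ hi) :
    ∑ r, F.extend k gi go gs s r * F.extend k' hi ho hs r z =
      F.coeff k (gi.map s) (go.map r₀) * F.coeff k' (hi.map r₀) (ho.map z) := by
  classical
  rw [two_step_aux F k k' Hg Hh h1 h2, Finset.sum_eq_single r₀]
  · intro r hr hne
    exact absurd (funext fun y => (Finset.mem_filter.1 hr).2 y (hm y)) hne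
  · simp

open scoped Classical in
theorem two_step_one (Hg : Matching gi go gs) (Hh : Matching hi ho hs) {s : α → Lab}
    {r₀ : β → Lab} {z : γ → Lab} (h1 : Compat gs s r₀) (h2 : Compat hs r₀ z) (u : β)
    (hu : u ∈ go) (hu' : u ∈ hi) (hm : ∀ y ∈ go, y ∈ hi → y = u) :
    ∑ r, F.extend k gi go gs s r * F.extend k' hi ho hs r z =
      ∑ l, F.coeff k (gi.map s) (go.map (Function.update r₀ u l)) *
        F.coeff k' (hi.map (Function.update r₀ u l)) (ho.map z) := by
  rw [two_step_aux F k k' Hg Hh h1 h2]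
  symm
  refine Finset.sum_nbij' (fun l => Function.update r₀ u l) (fun r => r u) ?_ ?_ ?_ ?_ ?_
  · intro l _
    refine Finset.mem_filter.2 ⟨Finset.mem_univ _, fun y hy => Function.update_of_ne ?_ _ _⟩
    rintro rfl
    exact hy hu hu'
  · simp
  · simp
  · intro r hr
    funext y
    by_cases hy : y = u
    · subst hy; simp
    · rw [Function.update_of_ne hy]
      exact ((Finset.mem_filter.1 hr).2 y fun h h' => hy (hm y h h')).symm
  · simp

open scoped Classical in
theorem two_step_two (Hg : Matching gi go gs) (Hh : Matching hi ho hs) {s : α → Lab}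
    {r₀ : β → Lab} {z : γ → Lab} (h1 : Compat gs s r₀) (h2 : Compat hs r₀ z) (u v : β)
    (huv : u ≠ v) (hu : u ∈ go) (hu' : u ∈ hi) (hv : v ∈ go) (hv' : v ∈ hi)
    (hm : ∀ y ∈ go, y ∈ hi → y = u ∨ y = v) :
    ∑ r, F.extend k gi go gs s r * F.extend k' hi ho hs r z =
      ∑ l, ∑ l', F.coeff k (gi.map s) (go.map (Function.update (Function.update r₀ u l) v l')) *
        F.coeff k' (hi.map (Function.update (Function.update r₀ u l) v l')) (ho.map z) := by
  rw [two_step_aux F k k' Hg Hh h1 h2]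
  symm
  rw [← Finset.sum_product']
  refine Finset.sum_nbij' (fun p => Function.update (Function.update r₀ u p.1) v p.2)
    (fun r => (r u, r v)) ?_ ?_ ?_ ?_ ?_
  · intro l _
    refine Finset.mem_filter.2 ⟨Finset.mem_univ _, fun y hy => ?_⟩
    rw [Function.update_of_ne, Function.update_of_ne]
    · rintro rfl
      exact hy hu hu'
    · rintro rfl
      exact hy hv hv'
  · simp
  · simp [huv]
  · intro r hr
    funext y
    by_cases hy : y = v
    · subst hy; simp
    by_cases hy' : y = u
    · subst hy'; simp [hy]
    rw [Function.update_of_ne hy, Function.update_of_ne hy']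
    refine ((Finset.mem_filter.1 hr).2 y fun h h' => ?_).symm
    rcases hm y h h' with h | h <;> contradiction
  · simp

end TwoStep

theorem Gen.nodup {C D : Config} (g : Gen C D) : g.inp.Nodup ∧ g.out.Nodup := by
  obtain ⟨kind, inp, out, rest, -, shape⟩ := g
  cases kind with
  | iso => obtain ⟨rfl, rfl⟩ := shape; simp
  | birth => obtain ⟨rfl, c, rfl, -⟩ := shape; simp
  | death => obtain ⟨rfl, c, rfl, -⟩ := shape; simp
  | merge n => obtain ⟨a, b, c, rfl, rfl, h, -⟩ := shape; simpa using h
  | split n => obtain ⟨a, b, c, rfl, rfl, h, -⟩ := shape; simpa using h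

theorem Gen.matching {C D : Config} (g : Gen C D) : Matching g.inp g.out g.same :=
  .of_equiv g.nodup.1 g.nodup.2 g.rest

/-- The matrix of a generator in its place. -/
noncomputable def GenValues.mat (F : GenValues) {C D : Config} (g : Gen C D) :
    (C.Circ → Lab) → (D.Circ → Lab) → ℤ :=
  F.extend g.kind g.inp g.out g.same

/-- The matrix of a composite of two generators. -/
noncomputable def GenValues.mat₂ (F : GenValues) {C D E : Config} (g : Gen C D) (h : Gen D E)
    (s : C.Circ → Lab) (z : E.Circ → Lab) : ℤ :=
  ∑ r, F.mat g s r * F.mat h r z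

theorem map_word (F : GenValues) {C D : Config} (g : Gen C D) :
    F.map g.word = linOf (F.mat g) := rfl

theorem map_word₂ (F : GenValues) {C D E : Config} (g : Gen C D) (h : Gen D E) :
    F.map (word₂ g h) = linOf (F.mat₂ g h) := linOf_comp _ _

/-- The structure constants of `ℤ[X]/X²`. -/
abbrev kmul : Lab → Lab → Lab → ℤ := signedMul 1 1 1

/-- The coefficients of Khovanov's comultiplication. -/
abbrev kcomul : Lab → Lab → Lab → ℤ := signedComul 1 1 1

theorem kmul_comm (a b c : Lab) : kmul a b c = kmul b a c := by
  cases a <;> cases b <;> cases c <;> rfl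

theorem kcomul_comm (a b c : Lab) : kcomul a b c = kcomul a c b := by
  cases a <;> cases b <;> cases c <;> rfl

theorem sum_lab (f : Lab → ℤ) : ∑ l, f l = f .one + f .X :=
  Finset.sum_pair (by simp)

theorem Gen.Merges.coeff {C D : Config} {g : Gen C D} {a b : C.Circ} {c : D.Circ}
    (h : g.Merges a b c) (s : C.Circ → Lab) (r : D.Circ → Lab) :
    khovanov.coeff g.kind (g.inp.map s) (g.out.map r) = kmul (s a) (s b) (r c) := by
  obtain ⟨⟨n, hn⟩, hi, ho⟩ := h
  rw [hn, ho]
  rcases hi with hi | hi <;> rw [hi]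
  · rfl
  · exact kmul_comm _ _ _

theorem Gen.Splits.coeff {C D : Config} {g : Gen C D} {c : C.Circ} {a b : D.Circ}
    (h : g.Splits c a b) (s : C.Circ → Lab) (r : D.Circ → Lab) :
    khovanov.coeff g.kind (g.inp.map s) (g.out.map r) = kcomul (s c) (r a) (r b) := by
  obtain ⟨⟨n, hn⟩, hi, ho⟩ := h
  rw [hn, hi]
  rcases ho with ho | ho <;> rw [ho]
  · rfl
  · exact kcomul_comm _ _ _

theorem Gen.Merges.mem_inp {C D : Config} {g : Gen C D} {a b : C.Circ} {c : D.Circ}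
    (h : g.Merges a b c) {x : C.Circ} : x ∈ g.inp ↔ x = a ∨ x = b := by
  rcases h.2.1 with h | h <;> simp [h, or_comm]

theorem Gen.Merges.mem_out {C D : Config} {g : Gen C D} {a b : C.Circ} {c : D.Circ}
    (h : g.Merges a b c) {x : D.Circ} : x ∈ g.out ↔ x = c := by
  simp [h.2.2]

theorem Gen.Splits.mem_inp {C D : Config} {g : Gen C D} {c : C.Circ} {a b : D.Circ}
    (h : g.Splits c a b) {x : C.Circ} : x ∈ g.inp ↔ x = c := by
  simp [h.2.1]

theorem Gen.Splits.mem_out {C D : Config} {g : Gen C D} {c : C.Circ} {a b : D.Circ}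
    (h : g.Splits c a b) {x : D.Circ} : x ∈ g.out ↔ x = a ∨ x = b := by
  rcases h.2.2 with h | h <;> simp [h, or_comm]

theorem Gen.Splits.ne {C D : Config} {g : Gen C D} {c : C.Circ} {a b : D.Circ}
    (h : g.Splits c a b) : a ≠ b := by
  have := g.nodup.2
  rcases h.2.2 with h | h <;> simp [h] at this
  · exact this
  · exact fun e => this e.symm

theorem Gen.not_mem_inp {C D : Config} {g : Gen C D} {x y} (h : g.same x y) : x ∉ g.inp :=
  g.matching.not_mem_inp h

theorem Gen.not_mem_out {C D : Config} {g : Gen C D} {x y} (h : g.same x y) : y ∉ g.out :=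
  g.matching.not_mem_out h

theorem Gen.iso_lists {C D : Config} {g : Gen C D} (h : g.kind = .iso) :
    g.inp = [] ∧ g.out = [] := by
  have := g.shape
  rw [h] at this
  exact this

open scoped Classical in
theorem Gen.iso_mat (F : GenValues) {C D : Config} {g : Gen C D} (h : g.kind = .iso)
    (s : C.Circ → Lab) (z : D.Circ → Lab) :
    F.mat g s z = if Compat g.same s z then 1 else 0 := by
  rw [GenValues.mat, extend_eq, h, (iso_lists h).1, (iso_lists h).2]
  rfl

open scoped Classical in
theorem mat₂_one (F : GenValues) {C D E : Config} {g : Gen C D} {h : Gen D E} {s : C.Circ → Lab}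
    {z : E.Circ → Lab} {r₀ : D.Circ → Lab} (h1 : Compat g.same s r₀) (h2 : Compat h.same r₀ z)
    (u : D.Circ) (hm : ∀ y, y ∈ g.out ∧ y ∈ h.inp ↔ y = u) :
    F.mat₂ g h s z =
      ∑ l, F.coeff g.kind (g.inp.map s) (g.out.map (Function.update r₀ u l)) *
        F.coeff h.kind (h.inp.map (Function.update r₀ u l)) (h.out.map z) :=
  two_step_one F _ _ g.matching h.matching h1 h2 u ((hm u).2 rfl).1 ((hm u).2 rfl).2
    fun y hy hy' => (hm y).1 ⟨hy, hy'⟩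

theorem mat₂_none (F : GenValues) {C D E : Config} {g : Gen C D} {h : Gen D E} {s : C.Circ → Lab}
    {z : E.Circ → Lab} {r₀ : D.Circ → Lab} (h1 : Compat g.same s r₀) (h2 : Compat h.same r₀ z)
    (hm : ∀ y ∈ g.out, y ∉ h.inp) :
    F.mat₂ g h s z = F.coeff g.kind (g.inp.map s) (g.out.map r₀) *
      F.coeff h.kind (h.inp.map r₀) (h.out.map z) :=
  two_step_none F _ _ g.matching h.matching h1 h2 hm

theorem mat₂_zero (F : GenValues) {C D E : Config} {g : Gen C D} {h : Gen D E} {s : C.Circ → Lab}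
    {z : E.Circ → Lab} (hc : ¬ Compat (same₂ g h) s z) : F.mat₂ g h s z = 0 :=
  two_step_zero F _ _ hc

theorem exists_mid {C D E : Config} {g : Gen C D} {h : Gen D E} {s : C.Circ → Lab}
    {z : E.Circ → Lab} (hc : Compat (same₂ g h) s z) :
    ∃ r, Compat g.same s r ∧ Compat h.same r z :=
  exists_middle g.matching h.matching hc

/-- Two composites agree if they agree on compatible labelings. -/
theorem map_word₂_eq (F : GenValues) {C D D' E : Config} {g : Gen C D} {h : Gen D E}
    {h' : Gen C D'} {g' : Gen D' E} (hs : ∀ x z, same₂ g h x z ↔ same₂ h' g' x z)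
    (H : ∀ s z, ∀ r r', Compat g.same s r → Compat h.same r z → Compat h'.same s r' →
      Compat g'.same r' z → F.mat₂ g h s z = F.mat₂ h' g' s z) :
    F.map (word₂ g h) = F.map (word₂ h' g') := by
  rw [map_word₂, map_word₂]
  congr 1
  funext s z
  by_cases hc : Compat (same₂ g h) s z
  · have hc' : Compat (same₂ h' g') s z := fun x z hx => hc _ _ ((hs _ _).2 hx)
    obtain ⟨r, h1, h2⟩ := exists_mid hc
    obtain ⟨r', h3, h4⟩ := exists_mid hc'
    exact H s z r r' h1 h2 h3 h4
  · have hc' : ¬ Compat (same₂ h' g') s z := fun h => hc fun x z hx => h _ _ ((hs _ _).1 hx)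
    rw [mat₂_zero F hc, mat₂_zero F hc']

theorem map_eq_of_forall₂ {α β : Type} {R : α → β → Prop} {s : α → Lab} {r : β → Lab}
    (hc : Compat R s r) {l : List α} {l' : List β} (h : List.Forall₂ R l l') :
    l.map s = l'.map r := by
  induction h with
  | nil => rfl
  | cons h _ ih => simp [hc _ _ h, ih]

theorem exists_right_of_forall₂ {α β : Type} {R : α → β → Prop} {l : List α} {l' : List β}
    (h : List.Forall₂ R l l') {x : α} (hx : x ∈ l) : ∃ y ∈ l', R x y := by
  induction h with
  | nil => simp at hx
  | cons h _ ih =>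
    rcases List.mem_cons.1 hx with rfl | hx
    · exact ⟨_, by simp, h⟩
    · obtain ⟨y, hy, hR⟩ := ih hx
      exact ⟨y, by simp [hy], hR⟩

theorem Interchange.map_eq (F : GenValues) {C D : Config} {f g : Word C D}
    (h : Interchange f g) : F.map f = F.map g := by
  obtain ⟨g, h, h', g', -, -, kg, kh, gi, go, hi, ho, hs⟩ := h
  refine map_word₂_eq F hs fun s z r r' h1 h2 h3 h4 => ?_
  have e1 : ∀ y ∈ g.out, y ∉ h.inp := fun y hy => by
    obtain ⟨w, -, hw⟩ := exists_right_of_forall₂ go hy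
    exact Gen.not_mem_inp hw
  have e2 : ∀ y ∈ h'.out, y ∉ g'.inp := fun y hy => by
    obtain ⟨w, -, hw⟩ := exists_right_of_forall₂ ho hy
    exact Gen.not_mem_inp hw
  rw [mat₂_none F h1 h2 e1, mat₂_none F h3 h4 e2, kg, kh, map_eq_of_forall₂ h3 gi,
    map_eq_of_forall₂ h2 go, map_eq_of_forall₂ h1 hi, map_eq_of_forall₂ h4 ho, mul_comm]

theorem map_iso_natural (F : GenValues) {C C' D D' : Config} (i : Gen C C') (g : Gen C' D')
    (g' : Gen C D) (j : Gen D D') (hi : i.kind = .iso) (hj : j.kind = .iso)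
    (k : g'.kind = g.kind) (gi : List.Forall₂ i.same g'.inp g.inp)
    (go : List.Forall₂ j.same g'.out g.out)
    (hs : ∀ x z, same₂ i g x z ↔ same₂ g' j x z) : F.map (word₂ i g) = F.map (word₂ g' j) := by
  refine map_word₂_eq F hs fun s z r r' h1 h2 h3 h4 => ?_
  obtain ⟨i1, i2⟩ := Gen.iso_lists hi
  obtain ⟨j1, j2⟩ := Gen.iso_lists hj
  rw [mat₂_none F h1 h2 (by simp [i2]), mat₂_none F h3 h4 (by simp [j1]), k,
    map_eq_of_forall₂ h1 gi, map_eq_of_forall₂ h4 go, i1, i2, j1, j2, hi, hj, mul_comm]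
  rfl

theorem map_iso_id (F : GenValues) {C : Config} (i : Gen C C) (hi : i.kind = .iso)
    (h : ∀ x y, i.same x y ↔ x = y) : F.map i.word = F.map (.nil C) := by
  classical
  rw [map_word, GenValues.map, ← linOf_id]
  congr 1
  funext s z
  rw [Gen.iso_mat F hi]
  congr 1
  refine propext ⟨fun hc => funext fun x => hc x x ((h x x).2 rfl), ?_⟩
  rintro rfl x y hxy
  rw [(h x y).1 hxy]

theorem map_iso_comp (F : GenValues) {C D E : Config} (i : Gen C D) (j : Gen D E) (k : Gen C E)
    (hi : i.kind = .iso) (hj : j.kind = .iso) (hk : k.kind = .iso)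
    (h : ∀ x z, k.same x z ↔ same₂ i j x z) : F.map (word₂ i j) = F.map k.word := by
  classical
  rw [map_word, map_word₂]
  congr 1
  funext s z
  rw [Gen.iso_mat F hk]
  have hk' : Compat k.same s z ↔ Compat (same₂ i j) s z := by simp [Compat, h]
  rw [if_congr hk' rfl rfl]
  split_ifs with hc
  · obtain ⟨r, h1, h2⟩ := exists_mid hc
    obtain ⟨i1, i2⟩ := Gen.iso_lists hi
    obtain ⟨j1, j2⟩ := Gen.iso_lists hj
    rw [mat₂_none F h1 h2 (by simp [i2]), i1, i2, j1, j2, hi, hj]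
    rfl
  · exact mat₂_zero F hc

/-- A word of two generators that continues every circle is a permutation of circles, if its
matrix is the identity on the circles it acts on. -/
theorem map_word₂_eq_iso (F : GenValues) {C D E : Config} {g : Gen C D} {h : Gen D E}
    {i : Gen C E} (hi : i.kind = .iso) {a : C.Circ} {d : E.Circ} (h5 : i.same a d)
    (hs : ∀ x z, x ≠ a → (same₂ g h x z ↔ i.same x z)) (ha : ∀ z, ¬ same₂ g h a z)
    (H : ∀ s z r, Compat g.same s r → Compat h.same r z →
      F.mat₂ g h s z = if s a = z d then 1 else 0) :
    F.map (word₂ g h) = F.map i.word := by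
  classical
  rw [map_word, map_word₂]
  congr 1
  funext s z
  rw [Gen.iso_mat F hi]
  have hk : Compat i.same s z ↔ Compat (same₂ g h) s z ∧ s a = z d := by
    constructor
    · refine fun hc => ⟨fun x w hx => ?_, hc _ _ h5⟩
      by_cases hxa : x = a
      · subst hxa
        exact absurd hx (ha _)
      · exact hc _ _ ((hs x w hxa).1 hx)
    · rintro ⟨hc, had⟩ x w hx
      by_cases hxa : x = a
      · subst hxa
        rw [i.matching.right_unique hx h5, had]
      · exact hc _ _ ((hs x w hxa).2 hx)
  rw [if_congr hk rfl rfl]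
  by_cases hc : Compat (same₂ g h) s z
  · obtain ⟨r, h1, h2⟩ := exists_mid hc
    simp [H s z r h1 h2, hc]
  · simp [mat₂_zero F hc, hc]

theorem Rel.khovanov_map_eq {C D : Config} {f g : Word C D} (h : Rel f g) :
    khovanov.map f = khovanov.map g := by
  classical
  cases h with
  | interchange h => exact h.map_eq _
  | iso_id i hi h => exact map_iso_id _ i hi h
  | iso_comp i j k hi hj hk h => exact map_iso_comp _ i j k hi hj hk h
  | iso_natural i g g' j hi hj k gi go hs => exact map_iso_natural _ i g g' j hi hj k gi go hs
  | comm g h a b c hg hh hs =>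
    rw [map_word, map_word]
    congr 1
    funext s z
    have : g.same = h.same := funext fun x => funext fun y => propext (hs x y)
    rw [GenValues.mat, GenValues.mat, extend_eq, extend_eq, hg.coeff, hh.coeff, this, kmul_comm]
  | cocomm g h c a b hg hh hs =>
    rw [map_word, map_word]
    congr 1
    funext s z
    have : g.same = h.same := funext fun x => funext fun y => propext (hs x y)
    rw [GenValues.mat, GenValues.mat, extend_eq, extend_eq, hg.coeff, hh.coeff, this, kcomul_comm]
  | assoc g h h' g' a b c x c' y a' d h1 h2 h3 h4 h5 h6 hs =>
    refine map_word₂_eq _ hs fun s z r r' c1 c2 c3 c4 => ?_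
    have n1 : c' ≠ x := fun e => Gen.not_mem_out h2 (h1.mem_out.2 e)
    have n2 : a' ≠ y := fun e => Gen.not_mem_out h5 (h4.mem_out.2 e)
    rw [mat₂_one _ c1 c2 x fun w => by rw [h1.mem_out, h3.mem_inp]; tauto,
      mat₂_one _ c3 c4 y fun w => by rw [h4.mem_out, h6.mem_inp]; tauto]
    simp only [h1.coeff, h3.coeff, h4.coeff, h6.coeff, Function.update_self,
      Function.update_of_ne n1, Function.update_of_ne n2, ← c1 _ _ h2, ← c3 _ _ h5]
    generalize s a = i, s b = j, s c = k, z d = l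
    revert i j k l
    decide
  | coassoc g h h' g' d x c' y a' a b c h1 h2 h3 h4 h5 h6 hs =>
    refine map_word₂_eq _ hs fun s z r r' c1 c2 c3 c4 => ?_
    have n1 : c' ≠ x := fun e => Gen.not_mem_inp h3 (h2.mem_inp.2 e)
    have n2 : a' ≠ y := fun e => Gen.not_mem_inp h6 (h5.mem_inp.2 e)
    rw [mat₂_one _ c1 c2 x fun w => by rw [h1.mem_out, h2.mem_inp]; tauto,
      mat₂_one _ c3 c4 y fun w => by rw [h4.mem_out, h5.mem_inp]; tauto]
    simp only [h1.coeff, h2.coeff, h4.coeff, h5.coeff, Function.update_self,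
      Function.update_of_ne n1, Function.update_of_ne n2, c2 _ _ h3, c4 _ _ h6]
    generalize z a = i, z b = j, z c = k, s d = l
    revert i j k l
    decide
  | frob g h h' g' a b x a' b' v' u v h1 h2 h3 h4 h5 h6 hs =>
    refine map_word₂_eq _ hs fun s z r r' c1 c2 c3 c4 => ?_
    have n1 : v' ≠ b' := h3.ne.symm
    have n2 : a' ≠ b' := fun e => Gen.not_mem_out h4 (h3.mem_out.2 (.inl e))
    have n3 : v' ≠ a' := fun e => Gen.not_mem_inp h6 (h5.mem_inp.2 (.inl e))
    rw [mat₂_one _ c1 c2 x fun w => by rw [h1.mem_out, h2.mem_inp]; tauto,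
      mat₂_one _ c3 c4 b' fun w => by
        rw [h3.mem_out, h5.mem_inp]
        constructor
        · rintro ⟨p | p, q⟩
          · exact p
          · exact q.resolve_left fun q => n3 (p.symm.trans q)
        · tauto]
    simp only [h1.coeff, h2.coeff, h3.coeff, h5.coeff, Function.update_self,
      Function.update_of_ne n1, Function.update_of_ne n2, ← c3 _ _ h4, c4 _ _ h6]
    generalize z u = i, z v = j, s a = k, s b = l
    revert i j k l
    decide
  | torus g h h' g' p u v u' v' q h1 h2 h3 h4 hs =>
    refine map_word₂_eq _ hs fun s z r r' c1 c2 c3 c4 => ?_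
    rw [GenValues.mat₂, GenValues.mat₂, GenValues.mat, GenValues.mat, GenValues.mat, GenValues.mat,
      two_step_two _ _ _ g.matching h.matching c1 c2 u v h1.ne (h1.mem_out.2 (.inl rfl))
        (h2.mem_inp.2 (.inl rfl)) (h1.mem_out.2 (.inr rfl)) (h2.mem_inp.2 (.inr rfl))
        fun y hy _ => h1.mem_out.1 hy,
      two_step_two _ _ _ h'.matching g'.matching c3 c4 u' v' h3.ne (h3.mem_out.2 (.inl rfl))
        (h4.mem_inp.2 (.inl rfl)) (h3.mem_out.2 (.inr rfl)) (h4.mem_inp.2 (.inr rfl))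
        fun y hy _ => h3.mem_out.1 hy]
    simp only [h1.coeff, h2.coeff, h3.coeff, h4.coeff, Function.update_self,
      Function.update_of_ne h1.ne, Function.update_of_ne h3.ne]
  | unit g h i a c a' d h1 h2 h3 h4 hi h5 hs =>
    have n1 : a' ≠ c := fun e => Gen.not_mem_out h3 (by simp [h2, e])
    have gi : g.inp = [] := by
      have := g.shape
      rw [h1] at this
      exact this.1
    refine map_word₂_eq_iso _ hi h5 hs ?_ fun s z r c1 c2 => ?_
    · rintro z ⟨y, hy, hyz⟩
      rw [g.matching.right_unique hy h3] at hyz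
      exact Gen.not_mem_inp hyz (h4.mem_inp.2 (.inr rfl))
    · rw [mat₂_one _ c1 c2 c fun w => by
        rw [h2, h4.mem_inp, List.mem_singleton]; tauto]
      simp only [h1, gi, h2, h4.coeff, Function.update_self, List.map_cons, List.map_nil,
        Function.update_of_ne n1, ← c1 _ _ h3]
      generalize s a = i, z d = j
      revert i j
      decide
  | counit g h i d c a' a h1 h2 h3 h4 hi h5 hs =>
    have n1 : a' ≠ c := fun e => Gen.not_mem_inp h4 (by simp [h3, e])
    have gi : h.out = [] := by
      have := h.shape
      rw [h2] at this
      exact this.1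
    refine map_word₂_eq_iso _ hi h5 hs ?_ fun s z r c1 c2 => ?_
    · rintro z ⟨y, hy, hyz⟩
      exact Gen.not_mem_inp hy (h1.mem_inp.2 rfl)
    · rw [mat₂_one _ c1 c2 c fun w => by
        rw [h3, h1.mem_out, List.mem_singleton]; tauto]
      simp only [h2, gi, h3, h1.coeff, Function.update_self, List.map_cons, List.map_nil,
        Function.update_of_ne n1, c2 _ _ h4]
      generalize s d = i, z a = j
      revert i j
      decide

/-! ### Gauge transformations of Khovanov's TQFT -/

/-- The five signs on which the solutions depend. -/
structure Params where
  mul₀ : ℤˣ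
  comul₀ : ℤˣ
  mul₁ : ℤˣ
  comul₁ : ℤˣ
  twist : ℤˣ

/-- The sign of a label on a circle at depth `p`, for the twist `t`. -/
def twistWeight (t : ℤˣ) : ZMod 2 → Lab → ℤˣ
  | p, .X => if p = 1 then t else 1
  | _, .one => 1

def Params.weight (P : Params) : ZMod 2 → Lab → ℤˣ := twistWeight P.twist

/-- `P.twist ^ p`. -/
def Params.twistPow (P : Params) (p : ZMod 2) : ℤˣ := P.weight p .X

/-- The sign by which a generator differs from Khovanov's, in terms of the depths of its
incoming circles. -/
def Params.genSign (P : Params) : Kind → List (ZMod 2) → ℤˣ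
  | .merge false, _ => P.mul₀
  | .merge true, _ => P.mul₁
  | .split false, [p] => P.comul₀ * P.twistPow p
  | .split true, [p] => P.comul₁ * P.twistPow (p + 1)
  | .death, [p] => P.twistPow p
  | _, _ => 1

/-- The depths of the incoming and outgoing circles of a generator fit. -/
def Levels : Kind → List (ZMod 2) → List (ZMod 2) → Prop
  | .merge n, i, o => ∃ p, i = [if n then p + 1 else p, p] ∧ o = [p]
  | .split n, i, o => ∃ p, i = [p] ∧ o = [if n then p + 1 else p, p]
  | .birth, i, o => ∃ p, i = [] ∧ o = [p]
  | .death, i, o => ∃ p, i = [p] ∧ o = []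
  | .iso, i, o => i = [] ∧ o = []

/-- Both operations are given by the five signs. -/
structure Params.Gives (P : Params) (F : GenValues) : Prop where
  mul_false : F.mul false = signedMul P.mul₀ P.mul₀ P.mul₀
  mul_true : F.mul true = signedMul P.mul₁ P.mul₁ (P.mul₁ * P.twist)
  comul_false : F.comul false = signedComul P.comul₀ P.comul₀ P.comul₀
  comul_true : F.comul true = signedComul P.comul₁ (P.comul₁ * P.twist) P.comul₁

/-- Unit and counit are Khovanov's. -/
def StdUnits (F : GenValues) : Prop := F.unit = khovanov.unit ∧ F.counit = khovanov.counit

def Kind.IsSaddle : Kind → Prop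
  | .merge _ => True
  | .split _ => True
  | _ => False

/-- The sign of a labeling of circles at given depths. -/
def Params.stateSign (P : Params) {α : Type} [Fintype α] (p : α → ZMod 2) (s : α → Lab) : ℤˣ :=
  ∏ x, P.weight (p x) (s x)

theorem Params.signedMul_false (P : Params) (p : ZMod 2) (a b c : Lab) :
    signedMul P.mul₀ P.mul₀ P.mul₀ a b c =
      (P.mul₀ * [P.weight p a, P.weight p b].prod * [P.weight p c].prod : ℤˣ) *
        signedMul 1 1 1 a b c := by
  simp only [weight]
  generalize P.mul₀ = e, P.twist = t
  revert p a b c e t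
  decide

theorem Params.signedMul_true (P : Params) (p : ZMod 2) (a b c : Lab) :
    signedMul P.mul₁ P.mul₁ (P.mul₁ * P.twist) a b c =
      (P.mul₁ * [P.weight (p + 1) a, P.weight p b].prod * [P.weight p c].prod : ℤˣ) *
        signedMul 1 1 1 a b c := by
  simp only [weight]
  generalize P.mul₁ = e, P.twist = t
  revert p a b c e t
  decide

theorem Params.signedComul_false (P : Params) (p : ZMod 2) (a b c : Lab) :
    signedComul P.comul₀ P.comul₀ P.comul₀ c a b =
      (P.comul₀ * P.twistPow p * [P.weight p c].prod * [P.weight p a, P.weight p b].prod : ℤˣ) *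
        signedComul 1 1 1 c a b := by
  simp only [weight, twistPow]
  generalize P.comul₀ = e, P.twist = t
  revert p a b c e t
  decide

theorem Params.signedComul_true (P : Params) (p : ZMod 2) (a b c : Lab) :
    signedComul P.comul₁ (P.comul₁ * P.twist) P.comul₁ c a b =
      (P.comul₁ * P.twistPow (p + 1) * [P.weight p c].prod *
        [P.weight (p + 1) a, P.weight p b].prod : ℤˣ) * signedComul 1 1 1 c a b := by
  simp only [weight, twistPow]
  generalize P.comul₁ = e, P.twist = t
  revert p a b c e t
  decide

theorem Params.unit_weight (P : Params) (p : ZMod 2) (a : Lab) :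
    khovanov.unit a = (1 * 1 * [P.weight p a].prod : ℤˣ) * khovanov.unit a := by
  simp only [weight]
  generalize P.twist = t
  revert p a t
  decide

theorem Params.counit_weight (P : Params) (p : ZMod 2) (a : Lab) :
    khovanov.counit a = (P.twistPow p * [P.weight p a].prod * 1 : ℤˣ) * khovanov.counit a := by
  simp only [weight, twistPow]
  generalize P.twist = t
  revert p a t
  decide

theorem Params.coeff_eq {P : Params} {F : GenValues} (hF : P.Gives F) {k : Kind}
    (hu : StdUnits F ∨ k.IsSaddle) {α β : Type} {p : α → ZMod 2} {q : β → ZMod 2}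
    {inp : List α} {out : List β} (hl : Levels k (inp.map p) (out.map q))
    (s : α → Lab) (r : β → Lab) :
    F.coeff k (inp.map s) (out.map r) =
      (P.genSign k (inp.map p) * (inp.map fun x => P.weight (p x) (s x)).prod *
        (out.map fun y => P.weight (q y) (r y)).prod : ℤˣ) *
        khovanov.coeff k (inp.map s) (out.map r) := by
  obtain ⟨mf, mt, cf, ct⟩ := hF
  cases k with
  | iso =>
    obtain ⟨hi, ho⟩ := hl
    obtain rfl := List.map_eq_nil_iff.1 hi
    obtain rfl := List.map_eq_nil_iff.1 ho
    rfl
  | birth =>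
    obtain ⟨c, hi, ho⟩ := hl
    obtain rfl := List.map_eq_nil_iff.1 hi
    obtain ⟨y, l, rfl, rfl, hl⟩ := List.map_eq_cons_iff.1 ho
    obtain rfl := List.map_eq_nil_iff.1 hl
    have := (hu.resolve_right id).1
    simp only [GenValues.coeff, List.map_cons, List.map_nil, this, Params.genSign]
    exact P.unit_weight _ _
  | death =>
    obtain ⟨c, hi, ho⟩ := hl
    obtain rfl := List.map_eq_nil_iff.1 ho
    obtain ⟨y, l, rfl, rfl, hl⟩ := List.map_eq_cons_iff.1 hi
    obtain rfl := List.map_eq_nil_iff.1 hl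
    have := (hu.resolve_right id).2
    simp only [GenValues.coeff, List.map_cons, List.map_nil, this, Params.genSign]
    exact P.counit_weight _ _
  | merge n =>
    obtain ⟨c, hi, ho⟩ := hl
    obtain ⟨a, l, rfl, ha, hi⟩ := List.map_eq_cons_iff.1 hi
    obtain ⟨b, l, rfl, hb, hi⟩ := List.map_eq_cons_iff.1 hi
    obtain rfl := List.map_eq_nil_iff.1 hi
    obtain ⟨y, l, rfl, hy, hl⟩ := List.map_eq_cons_iff.1 ho
    obtain rfl := List.map_eq_nil_iff.1 hl
    simp only [GenValues.coeff, List.map_cons, List.map_nil, ha, hb, hy, khovanov]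
    cases n
    · simp only [mf, Params.genSign]
      exact P.signedMul_false _ _ _ _
    · simp only [mt, Params.genSign]
      exact P.signedMul_true _ _ _ _
  | split n =>
    obtain ⟨c, hi, ho⟩ := hl
    obtain ⟨a, l, rfl, ha, ho⟩ := List.map_eq_cons_iff.1 ho
    obtain ⟨b, l, rfl, hb, ho⟩ := List.map_eq_cons_iff.1 ho
    obtain rfl := List.map_eq_nil_iff.1 ho
    obtain ⟨y, l, rfl, hy, hl⟩ := List.map_eq_cons_iff.1 hi
    obtain rfl := List.map_eq_nil_iff.1 hl
    simp only [GenValues.coeff, List.map_cons, List.map_nil, ha, hb, hy, khovanov]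
    cases n
    · simp only [cf, Params.genSign]
      exact P.signedComul_false _ _ _ _
    · simp only [ct, Params.genSign]
      exact P.signedComul_true _ _ _ _

theorem int_units_mul_self_left (a b : ℤˣ) : a * (a * b) = b := by
  rw [← mul_assoc, Int.units_mul_self, one_mul]

theorem Params.extend_eq {P : Params} {F : GenValues} (hF : P.Gives F) {k : Kind}
    (hu : StdUnits F ∨ k.IsSaddle) {α β : Type} [Fintype α] [Fintype β] {p : α → ZMod 2}
    {q : β → ZMod 2} {inp : List α} {out : List β} {same : α → β → Prop}
    (H : Matching inp out same) (hpq : ∀ x y, same x y → p x = q y)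
    (hl : Levels k (inp.map p) (out.map q)) (s : α → Lab) (r : β → Lab) :
    F.extend k inp out same s r =
      (P.genSign k (inp.map p) * P.stateSign p s * P.stateSign q r : ℤˣ) *
        khovanov.extend k inp out same s r := by
  classical
  rw [NestedKh.extend_eq, NestedKh.extend_eq]
  split_ifs with hc
  · have := H.prod_eq (fun x => P.weight (p x) (s x)) (fun y => P.weight (q y) (r y))
      fun x y h => by rw [hpq x y h, hc x y h]
    have e : P.stateSign p s * P.stateSign q r = (inp.map fun x => P.weight (p x) (s x)).prod *
        (out.map fun y => P.weight (q y) (r y)).prod := by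
      rw [stateSign, stateSign]
      generalize (∏ x, P.weight (p x) (s x)) = A, (∏ y, P.weight (q y) (r y)) = B,
        (inp.map fun x => P.weight (p x) (s x)).prod = I,
        (out.map fun y => P.weight (q y) (r y)).prod = O at this
      revert A B I O
      decide
    rw [coeff_eq hF hu hl, mul_assoc, mul_assoc, e]
  · simp

/-! ### Depth -/

section Depth

attribute [local instance] Classical.propDecidable

/-- The number of circles around a circle modulo 2. -/
noncomputable def Config.depth (C : Config) (x : C.Circ) : ZMod 2 :=
  letI := Fintype.ofFinite C.Circ
  ∑ y, if C.inside x y then 1 else 0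

theorem Gen.inside_iff {C D : Config} {g : Gen C D} {x y x' y'} (hx : g.same x x')
    (hy : g.same y y') : D.inside x' y' ↔ C.inside x y := by
  obtain ⟨h, rfl⟩ := hx
  obtain ⟨h', rfl⟩ := hy
  exact g.rest_inside _ _

theorem Pants.sums {n : Bool} {C D : Config} {a b : C.Circ} {c : D.Circ}
    {same : C.Circ → D.Circ → Prop} (h : Pants n C D a b c same)
    (H : Matching [a, b] [c] same) :
    C.depth a = (if n then C.depth b + 1 else C.depth b) ∧ D.depth c = C.depth b := by
  let _ := Fintype.ofFinite C.Circ
  let _ := Fintype.ofFinite D.Circ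
  obtain ⟨hne, h1, h2⟩ := h
  have hba : ¬ C.inside b a := by
    cases n
    · exact h1.2.1
    · exact fun h => C.irrefl _ (C.trans _ _ _ h1.1 h)
  constructor
  · cases n
    · simp only [Config.depth, h1.2.2]
      rfl
    · have : ∀ x, (if C.inside a x then (1 : ZMod 2) else 0) =
          (if C.inside b x then 1 else 0) + if x = b then 1 else 0 := by
        intro x
        by_cases hx : x = b
        · subst hx
          simp [h1.1, C.irrefl]
        · have : C.inside a x ↔ C.inside b x := by
            constructor
            · intro hax
              rcases C.chain a b x h1.1 hax with e | e | e
              · exact absurd e.symm hx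
              · exact e
              · exact absurd ⟨hax, e⟩ (h1.2 x)
            · exact C.trans _ _ _ h1.1
          simp [this, hx]
      simp only [Config.depth, this, Finset.sum_add_distrib]
      simp
  · have := H.sum_eq (fun x => if C.inside b x then (1 : ZMod 2) else 0)
      (fun y => if D.inside c y then 1 else 0) fun x y hxy => by simp only [(h2 x y hxy).2]
    simpa [Config.depth, D.irrefl, C.irrefl, hba] using this.symm

theorem Gen.levels {C D : Config} (g : Gen C D) :
    Levels g.kind (g.inp.map C.depth) (g.out.map D.depth) := by
  have H := g.matching
  have hs := g.shape
  generalize hk : g.kind = k at hs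
  cases k with
  | iso => simp [Levels, hs]
  | birth =>
    obtain ⟨h, c, h', -⟩ := hs
    simp [Levels, h, h']
  | death =>
    obtain ⟨h, c, h', -⟩ := hs
    simp [Levels, h, h']
  | merge n =>
    obtain ⟨a, b, c, h, h', hp⟩ := hs
    rw [h, h'] at H
    obtain ⟨e1, e2⟩ := hp.sums H
    rw [h, h']
    refine ⟨C.depth b, ?_, ?_⟩ <;> simp [e1, e2]
  | split n =>
    obtain ⟨a, b, c, h, h', hp⟩ := hs
    rw [h, h'] at H
    obtain ⟨e1, e2⟩ := hp.sums H.symm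
    rw [h, h']
    refine ⟨D.depth b, ?_, ?_⟩ <;> simp [e1, e2]

theorem xor_sum {P A B : Prop} (h : P ↔ Xor A B) :
    (if P then (1 : ZMod 2) else 0) = (if A then 1 else 0) + if B then 1 else 0 := by
  by_cases hA : A <;> by_cases hB : B <;> simp [h, hA, hB, Xor]; decide

theorem Gen.depth_eq {C D : Config} (g : Gen C D) {x : C.Circ} {x' : D.Circ} (hx : g.same x x') :
    C.depth x = D.depth x' := by
  let _ := Fintype.ofFinite C.Circ
  let _ := Fintype.ofFinite D.Circ
  have := g.matching.sum_eq (fun y => if C.inside x y then (1 : ZMod 2) else 0)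
    (fun y => if D.inside x' y then 1 else 0)
    fun y y' hy => by simp only [Gen.inside_iff hx hy]
  have key : (g.out.map fun y => if D.inside x' y then (1 : ZMod 2) else 0).sum =
      (g.inp.map fun y => if C.inside x y then (1 : ZMod 2) else 0).sum := by
    have hs := g.shape
    generalize hk : g.kind = k at hs
    cases k with
    | iso => simp [hs.1, hs.2]
    | birth =>
      obtain ⟨h, c, h', h''⟩ := hs
      simp [h, h', h'']
    | death =>
      obtain ⟨h, c, h', h''⟩ := hs
      simp [h, h', h'']
    | merge n =>
      obtain ⟨a, b, c, h, h', hp⟩ := hs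
      rw [h, h']
      simpa using xor_sum (hp.2.2 x x' hx).1
    | split n =>
      obtain ⟨a, b, c, h, h', hp⟩ := hs
      rw [h, h']
      simpa using (xor_sum (hp.2.2 x' x hx).1).symm
  rw [key] at this
  exact add_right_cancel this

end Depth

/-! ### The extension of a gauge transformation -/

namespace Params

variable (P : Params)

/-- The sign of a generator in its place. -/
noncomputable def genSign' {C D : Config} (g : Gen C D) : ℤˣ :=
  P.genSign g.kind (g.inp.map C.depth)

noncomputable def wordSign : ∀ {C D : Config}, Word C D → ℤˣ
  | _, _, .nil _ => 1
  | _, _, .cons g w => P.genSign' g * wordSign w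

theorem wordSign_comp {C D E : Config} (f : Word C D) (g : Word D E) :
    P.wordSign (f.comp g) = P.wordSign f * P.wordSign g := by
  induction f with
  | nil => simp [Word.comp, wordSign]
  | cons g' w ih => simp [Word.comp, wordSign, ih, mul_assoc]

/-- The sign of a labeling of a configuration. -/
noncomputable def configSign (C : Config) (s : C.Circ → Lab) : ℤˣ :=
  letI := Fintype.ofFinite C.Circ
  P.stateSign C.depth s

/-- The extension in which each relation holds up to the quotient of the signs of both sides. -/
noncomputable def ext : Z2Extension where
  sign _ _ f g := P.wordSign f * P.wordSign g
  cocycle {C D} f s h := by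
    have : ∀ {C D : Config} {s : ℤˣ} {f g : Word C D},
        TwoCell (fun _ _ f g => P.wordSign f * P.wordSign g) s f g →
        s = P.wordSign f * P.wordSign g := by
      intro C D s f g h
      induction h with
      | refl f => exact (Int.units_mul_self _).symm
      | rel _ => rfl
      | symm _ ih => rw [ih, Int.units_inv_eq_self, mul_comm]
      | @trans _ _ _ _ f g k _ _ ih ih' =>
        rw [ih, ih']
        generalize P.wordSign f = a, P.wordSign g = b, P.wordSign k = c
        revert a b c
        decide
      | @whisker _ _ _ _ _ f g u w _ ih =>
        rw [ih]
        simp only [wordSign_comp]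
        generalize P.wordSign f = a, P.wordSign g = b, P.wordSign u = c, P.wordSign w = d
        revert a b c d
        decide
    rw [this h, Int.units_mul_self]

theorem ext_isStrict : P.ext.IsStrict := by
  intro C D f g h
  obtain ⟨g, h, h', g', -, -, kg, kh, gi, -, hi, -, -⟩ := h
  have aux : ∀ {C D : Config} (k : Gen C D) {l : List C.Circ} {l' : List D.Circ},
      List.Forall₂ k.same l l' → l.map C.depth = l'.map D.depth := by
    intro C D k l l' hl
    induction hl with
    | nil => rfl
    | cons h _ ih => simp [k.depth_eq h, ih]
  have e1 : P.genSign' g' = P.genSign' g := by rw [genSign', genSign', kg, aux _ gi]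
  have e2 : P.genSign' h' = P.genSign' h := by rw [genSign', genSign', kh, aux _ hi]
  change P.wordSign (word₂ g h) * P.wordSign (word₂ h' g') = 1
  simp only [word₂, wordSign, e1, e2]
  generalize P.genSign' g = a, P.genSign' h = b
  revert a b
  decide

variable {P} {F : GenValues}

theorem mat_eq (hF : P.Gives F) (hu : StdUnits F) {C D : Config} (g : Gen C D)
    (s : C.Circ → Lab) (r : D.Circ → Lab) :
    F.mat g s r = (P.genSign' g * P.configSign C s * P.configSign D r : ℤˣ) *
      khovanov.mat g s r :=
  let _ := Fintype.ofFinite C.Circ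
  let _ := Fintype.ofFinite D.Circ
  P.extend_eq hF (.inl hu) g.matching (fun _ _ h => g.depth_eq h) g.levels s r

theorem map_apply_eq (hF : P.Gives F) (hu : StdUnits F) {C D : Config} (w : Word C D)
    (f : (C.Circ → Lab) → ℤ) (r : D.Circ → Lab) :
    F.map w f r = (P.wordSign w * P.configSign D r : ℤˣ) *
      khovanov.map w (fun s => (P.configSign C s : ℤ) * f s) r := by
  induction w with
  | nil C =>
    simp only [GenValues.map, LinearMap.id_apply, wordSign]
    rw [← mul_assoc, ← Units.val_mul, one_mul, Int.units_mul_self]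
    simp
  | @cons C D E g w ih =>
    change F.map w (linOf (F.mat g) f) r =
      _ * khovanov.map w (linOf (khovanov.mat g) fun s => (P.configSign C s : ℤ) * f s) r
    rw [ih]
    have : (fun s => (P.configSign D s : ℤ) * linOf (F.mat g) f s) =
        (P.genSign' g : ℤ) •
          linOf (khovanov.mat g) fun s => (P.configSign C s : ℤ) * f s := by
      funext r
      simp only [linOf_apply, Pi.smul_apply, smul_eq_mul, Finset.mul_sum, mat_eq hF hu]
      refine Finset.sum_congr rfl fun s _ => ?_
      have : (P.configSign D r : ℤ) * P.configSign D r = 1 := by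
        rw [← Units.val_mul, Int.units_mul_self, Units.val_one]
      push_cast
      linear_combination (f s * P.genSign' g * P.configSign C s * khovanov.mat g s r) * this
    rw [this, map_smul]
    simp only [wordSign, Pi.smul_apply, smul_eq_mul]
    push_cast
    ring

/-- The EQFT of a gauge transformation. -/
noncomputable def eqft (hF : P.Gives F) (hu : StdUnits F) : EQFT P.ext where
  val := F
  map_rel f g h := by
    refine LinearMap.ext fun x => funext fun r => ?_
    change _ = ((P.wordSign f * P.wordSign g : ℤˣ) : ℤ) * F.map g x r
    rw [map_apply_eq hF hu, map_apply_eq hF hu, h.khovanov_map_eq, ← mul_assoc, ← Units.val_mul]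
    congr 2
    generalize P.wordSign f = a, P.wordSign g = b, P.configSign _ r = c
    revert a b c
    decide

theorem Gives.isKhovanovLike (hF : P.Gives F) (hu : StdUnits F) : IsKhovanovLike F := by
  refine ⟨P.ext, P.ext_isStrict, ⟨eqft hF hu, rfl⟩, ?_, ?_⟩
  · obtain ⟨mf, mt, cf, ct⟩ := hF
    refine ⟨?_, ?_, ?_, ?_⟩
    · rintro (_ | _) (_ | _) (_ | _) (_ | _) <;>
        simp [mf, mt, signedMul, Lab.deg]
    · rintro (_ | _) (_ | _) (_ | _) (_ | _) <;>
        simp [cf, ct, signedComul, Lab.deg]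
    · rintro (_ | _) <;> simp [hu.1, khovanov, Lab.deg]
    · rintro (_ | _) <;> simp [hu.2, khovanov, Lab.deg]
  · have odd : ∀ u : ℤˣ, (u : ℤ) ≡ 1 [ZMOD 2] := by decide
    obtain ⟨mf, mt, cf, ct⟩ := hF
    refine ⟨?_, ?_, ?_, ?_⟩
    · rintro (_ | _) (_ | _) (_ | _) (_ | _) <;> rw [khovanov] <;> simp only [mf, mt] <;>
        first | exact odd _ | exact Int.ModEq.refl _
    · rintro (_ | _) (_ | _) (_ | _) (_ | _) <;> rw [khovanov] <;> simp only [cf, ct] <;>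
        first | exact odd _ | exact Int.ModEq.refl _
    · exact fun a => by rw [hu.1]
    · exact fun a => by rw [hu.2]

end Params

/-! ### Small configurations -/

section Elementary

variable {C D : Config} {inp : List C.Circ} {out : List D.Circ} (f : C.Circ → D.Circ)
  (g : D.Circ → C.Circ)

/-- At most one circle, moved by `f`, is not involved. -/
structure RestMaps (inp : List C.Circ) (out : List D.Circ) : Prop where
  left : ∀ x, x ∉ inp → f x ∉ out ∧ g (f x) = x
  right : ∀ y, y ∉ out → g y ∉ inp ∧ f (g y) = y
  subsingleton : ∀ x y, x ∉ inp → y ∉ inp → x = y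

def RestMaps.equiv {f : C.Circ → D.Circ} {g : D.Circ → C.Circ} (h : RestMaps f g inp out) :
    {x // x ∉ inp} ≃ {y // y ∉ out} where
  toFun x := ⟨f x, (h.left x x.2).1⟩
  invFun y := ⟨g y, (h.right y y.2).1⟩
  left_inv x := Subtype.ext (h.left x x.2).2
  right_inv y := Subtype.ext (h.right y y.2).2

theorem RestMaps.rest_inside {f : C.Circ → D.Circ} {g : D.Circ → C.Circ}
    (h : RestMaps f g inp out) (x y : {x // x ∉ inp}) :
    D.inside (h.equiv x) (h.equiv y) ↔ C.inside x y := by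
  obtain rfl : x = y := Subtype.ext (h.subsingleton x y x.2 y.2)
  simp [C.irrefl, D.irrefl]

variable {f g}

def mergeGen (n : Bool) {a b : C.Circ} {c : D.Circ} (h : RestMaps f g [a, b] [c])
    (hp : Pants n C D a b c fun x y => x ∉ [a, b] ∧ f x = y) : Gen C D where
  kind := .merge n
  inp := [a, b]
  out := [c]
  rest := h.equiv
  rest_inside := h.rest_inside
  shape := ⟨a, b, c, rfl, rfl, hp.1, hp.2.1, fun x y ⟨hx, hy⟩ => hp.2.2 x y ⟨hx, hy⟩⟩

def splitGen (n : Bool) {a b : D.Circ} {c : C.Circ} (h : RestMaps f g [c] [a, b])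
    (hp : Pants n D C a b c fun y x => x ∉ [c] ∧ f x = y) : Gen C D where
  kind := .split n
  inp := [c]
  out := [a, b]
  rest := h.equiv
  rest_inside := h.rest_inside
  shape := ⟨a, b, c, rfl, rfl, hp.1, hp.2.1, fun x y ⟨hx, hy⟩ => hp.2.2 x y ⟨hx, hy⟩⟩

def birthGen {c : D.Circ} (h : RestMaps f g [] [c]) (hc : ∀ y, ¬ D.inside y c) : Gen C D where
  kind := .birth
  inp := []
  out := [c]
  rest := h.equiv
  rest_inside := h.rest_inside
  shape := ⟨rfl, c, rfl, hc⟩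

def deathGen {c : C.Circ} (h : RestMaps f g [c] []) (hc : ∀ y, ¬ C.inside y c) : Gen C D where
  kind := .death
  inp := [c]
  out := []
  rest := h.equiv
  rest_inside := h.rest_inside
  shape := ⟨rfl, c, rfl, hc⟩

def isoGen (h : RestMaps f g [] []) : Gen C D where
  kind := .iso
  inp := []
  out := []
  rest := h.equiv
  rest_inside := h.rest_inside
  shape := ⟨rfl, rfl⟩

end Elementary

/-- One circle. -/
def oneCircle : Config where
  Circ := Unit
  finite := inferInstance
  inside _ _ := False
  irrefl _ h := h
  trans _ _ _ h _ := h
  chain _ _ _ h _ := h.elim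

/-- Two circles; if `n` is true, then `true` lies inside `false`. -/
def twoCircles (n : Bool) : Config where
  Circ := Bool
  finite := inferInstance
  inside a b := n = true ∧ a = true ∧ b = false
  irrefl := by revert n; decide
  trans := by revert n; decide
  chain := by revert n; decide

/-- Three circles inside each other, the innermost being `0`. -/
def threeCircles : Config where
  Circ := Fin 3
  finite := inferInstance
  inside a b := a < b
  irrefl := by decide
  trans := by decide
  chain := by decide

theorem unit_maps_bool {l : List Unit} {l' : List Bool}
    (h : ∀ x : Unit, x ∉ l → false ∉ l') (h' : ∀ y : Bool, y ∉ l' → () ∉ l ∧ false = y) (n : Bool) :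
    RestMaps (C := oneCircle) (D := twoCircles n) (inp := l) (out := l') (fun _ => false)
      (fun _ => ()) :=
  ⟨fun x hx => ⟨h x hx, rfl⟩, h', fun _ _ _ _ => rfl⟩

theorem bool_maps_unit {l : List Bool} {l' : List Unit}
    (h : ∀ x : Unit, x ∉ l' → false ∉ l) (h' : ∀ y : Bool, y ∉ l → () ∉ l' ∧ false = y) (n : Bool) :
    RestMaps (C := twoCircles n) (D := oneCircle) (inp := l) (out := l') (fun _ => ())
      (fun _ => false) :=
  ⟨h', fun x hx => ⟨h x hx, rfl⟩, fun x y hx hy => (h' x hx).2.symm.trans (h' y hy).2⟩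

def idOne : Gen oneCircle oneCircle :=
  isoGen (f := fun x => x) (g := fun x => x)
    ⟨fun _ h => ⟨h, rfl⟩, fun _ h => ⟨h, rfl⟩, fun _ _ _ _ => rfl⟩

def birthTwo (n : Bool) : Gen oneCircle (twoCircles n) :=
  birthGen (unit_maps_bool (l := []) (l' := [true]) (by decide) (by decide) n)
    fun _ h => nomatch h.2.2

def deathTwo (n : Bool) : Gen (twoCircles n) oneCircle :=
  deathGen (bool_maps_unit (l := [true]) (l' := []) (by decide) (by decide) n)
    fun _ h => nomatch h.2.2

theorem pants_two (n : Bool) {same : Bool → Unit → Prop} (h : ∀ x y, ¬ same x y) :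
    Pants n (twoCircles n) oneCircle true false () same := by
  refine ⟨Bool.noConfusion, ?_, fun x y hxy => absurd hxy (h x y)⟩
  cases n
  · exact ⟨fun h => Bool.noConfusion h.1, fun h => Bool.noConfusion h.1,
      fun x => ⟨fun h => Bool.noConfusion h.1, fun h => Bool.noConfusion h.1⟩⟩
  · exact ⟨⟨rfl, rfl, rfl⟩, fun x h => nomatch h.1.2.2.symm.trans h.2.2.1⟩

theorem pants_two' {same : Bool → Unit → Prop} (h : ∀ x y, ¬ same x y) :
    Pants false (twoCircles false) oneCircle false true () same := by
  refine ⟨Bool.noConfusion, ?_, fun x y hxy => absurd hxy (h x y)⟩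
  exact ⟨fun h => Bool.noConfusion h.1, fun h => Bool.noConfusion h.1,
      fun x => ⟨fun h => Bool.noConfusion h.1, fun h => Bool.noConfusion h.1⟩⟩

theorem bool_not_mem (x : Bool) : ¬ (x ∉ [true, false]) ∧ ¬ (x ∉ [false, true]) := by
  revert x
  decide

def mergeTwo (n : Bool) : Gen (twoCircles n) oneCircle :=
  mergeGen n (bool_maps_unit (l := [true, false]) (l' := [()]) (by decide) (by decide) n)
    (pants_two n fun x _ h => (bool_not_mem x).1 h.1)

def mergeTwo' : Gen (twoCircles false) oneCircle :=
  mergeGen false (bool_maps_unit (l := [false, true]) (l' := [()]) (by decide) (by decide) false)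
    (pants_two' fun x _ h => (bool_not_mem x).2 h.1)

theorem unit_not_mem (x : Unit) : ¬ (x ∉ [()]) := by
  revert x
  decide

def splitTwo (n : Bool) : Gen oneCircle (twoCircles n) :=
  splitGen n (unit_maps_bool (l := [()]) (l' := [true, false]) (by decide) (by decide) n)
    (pants_two n fun _ x h => unit_not_mem x h.1)

def splitTwo' : Gen oneCircle (twoCircles false) :=
  splitGen false (unit_maps_bool (l := [()]) (l' := [false, true]) (by decide) (by decide) false)
    (pants_two' fun _ x h => unit_not_mem x h.1)

theorem pants_inner {same : Fin 3 → Bool → Prop} (h : ∀ x y, same x y → x = 2 ∧ y = false) :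
    Pants true threeCircles (twoCircles true) (0 : Fin 3) (1 : Fin 3) true same := by
  refine ⟨(by decide : (0 : Fin 3) ≠ 1), ⟨(by decide : (0 : Fin 3) < 1),
    (by decide : ∀ x : Fin 3, ¬ (0 < x ∧ x < 1))⟩, fun x y hxy => ?_⟩
  obtain ⟨rfl, rfl⟩ := h x y hxy
  exact (by decide : ((true = true ∧ false = true ∧ true = false) ↔
    Xor ((2 : Fin 3) < 0) ((2 : Fin 3) < 1)) ∧
    ((true = true ∧ true = true ∧ false = false) ↔ (1 : Fin 3) < 2))

theorem pants_outer {same : Fin 3 → Bool → Prop} (h : ∀ x y, same x y → x = 0 ∧ y = true) :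
    Pants true threeCircles (twoCircles false) (1 : Fin 3) (2 : Fin 3) false same := by
  refine ⟨(by decide : (1 : Fin 3) ≠ 2), ⟨(by decide : (1 : Fin 3) < 2),
    (by decide : ∀ x : Fin 3, ¬ (1 < x ∧ x < 2))⟩, fun x y hxy => ?_⟩
  obtain ⟨rfl, rfl⟩ := h x y hxy
  exact (by decide : ((false = true ∧ true = true ∧ false = false) ↔
    Xor ((0 : Fin 3) < 1) ((0 : Fin 3) < 2)) ∧
    ((false = true ∧ false = true ∧ true = false) ↔ (2 : Fin 3) < 0))

def mergeInner : Gen threeCircles (twoCircles true) :=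
  mergeGen (C := threeCircles) (D := twoCircles true) true (f := fun _ => false)
    (g := fun _ => (2 : Fin 3)) (a := (0 : Fin 3)) (b := (1 : Fin 3)) (c := true)
    ⟨(by decide : ∀ x : Fin 3, x ∉ [0, 1] → false ∉ [true] ∧ 2 = x),
      (by decide : ∀ y : Bool, y ∉ [true] → (2 : Fin 3) ∉ ([0, 1] : List (Fin 3)) ∧ false = y),
      (by decide : ∀ x y : Fin 3, x ∉ [0, 1] → y ∉ [0, 1] → x = y)⟩
    (pants_inner (by decide :
      ∀ (x : Fin 3) (y : Bool), x ∉ ([0, 1] : List (Fin 3)) ∧ false = y → x = 2 ∧ y = false))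

def mergeOuter : Gen threeCircles (twoCircles false) :=
  mergeGen (C := threeCircles) (D := twoCircles false) true (f := fun _ => true)
    (g := fun _ => (0 : Fin 3)) (a := (1 : Fin 3)) (b := (2 : Fin 3)) (c := false)
    ⟨(by decide : ∀ x : Fin 3, x ∉ [1, 2] → true ∉ [false] ∧ 0 = x),
      (by decide : ∀ y : Bool, y ∉ [false] → (0 : Fin 3) ∉ ([1, 2] : List (Fin 3)) ∧ true = y),
      (by decide : ∀ x y : Fin 3, x ∉ [1, 2] → y ∉ [1, 2] → x = y)⟩
    (pants_outer (by decide :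
      ∀ (x : Fin 3) (y : Bool), x ∉ ([1, 2] : List (Fin 3)) ∧ true = y → x = 0 ∧ y = true))

def splitInner : Gen (twoCircles true) threeCircles :=
  splitGen (D := threeCircles) (C := twoCircles true) true (g := fun _ => false)
    (f := fun _ => (2 : Fin 3)) (a := (0 : Fin 3)) (b := (1 : Fin 3)) (c := true)
    ⟨(by decide : ∀ y : Bool, y ∉ [true] → (2 : Fin 3) ∉ ([0, 1] : List (Fin 3)) ∧ false = y),
      (by decide : ∀ x : Fin 3, x ∉ [0, 1] → false ∉ [true] ∧ 2 = x),
      (by decide : ∀ x y : Bool, x ∉ [true] → y ∉ [true] → x = y)⟩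
    (pants_inner (by decide :
      ∀ (x : Fin 3) (y : Bool), y ∉ [true] ∧ (2 : Fin 3) = x → x = 2 ∧ y = false))

def splitOuter : Gen (twoCircles false) threeCircles :=
  splitGen (D := threeCircles) (C := twoCircles false) true (g := fun _ => true)
    (f := fun _ => (0 : Fin 3)) (a := (1 : Fin 3)) (b := (2 : Fin 3)) (c := false)
    ⟨(by decide : ∀ y : Bool, y ∉ [false] → (0 : Fin 3) ∉ ([1, 2] : List (Fin 3)) ∧ true = y),
      (by decide : ∀ x : Fin 3, x ∉ [1, 2] → true ∉ [false] ∧ 0 = x),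
      (by decide : ∀ x y : Bool, x ∉ [false] → y ∉ [false] → x = y)⟩
    (pants_outer (by decide :
      ∀ (x : Fin 3) (y : Bool), y ∉ [false] ∧ (0 : Fin 3) = x → x = 0 ∧ y = true))

/-! ### Generator values of an EQFT -/

theorem mat₂_one_of_family (F : GenValues) {C D E : Config} {g : Gen C D} {h : Gen D E}
    {s : C.Circ → Lab} {z : E.Circ → Lab} (ρ : Lab → D.Circ → Lab) (u : D.Circ)
    (h1 : Compat g.same s (ρ .one)) (h2 : Compat h.same (ρ .one) z) (hu : ∀ l, ρ l u = l)
    (hρ : ∀ l y, y ≠ u → ρ l y = ρ .one y) (hm : ∀ y, y ∈ g.out ∧ y ∈ h.inp ↔ y = u) :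
    F.mat₂ g h s z = ∑ l, F.coeff g.kind (g.inp.map s) (g.out.map (ρ l)) *
        F.coeff h.kind (h.inp.map (ρ l)) (h.out.map z) := by
  classical
  rw [mat₂_one F h1 h2 u hm]
  have : ∀ l, Function.update (ρ .one) u l = ρ l := fun l =>
    funext fun y => by
      by_cases hy : y = u
      · subst hy; simp [hu]
      · rw [Function.update_of_ne hy, hρ l y hy]
  simp only [this]

theorem mat₂_two_of_family (F : GenValues) {C D E : Config} {g : Gen C D} {h : Gen D E}
    {s : C.Circ → Lab} {z : E.Circ → Lab} (ρ : Lab → Lab → D.Circ → Lab) (u v : D.Circ)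
    (huv : u ≠ v) (h1 : Compat g.same s (ρ .one .one)) (h2 : Compat h.same (ρ .one .one) z)
    (hu : ∀ l l', ρ l l' u = l) (hv : ∀ l l', ρ l l' v = l')
    (hρ : ∀ l l' y, y ≠ u → y ≠ v → ρ l l' y = ρ .one .one y)
    (hm : ∀ y, y ∈ g.out ∧ y ∈ h.inp ↔ y = u ∨ y = v) :
    F.mat₂ g h s z = ∑ l, ∑ l', F.coeff g.kind (g.inp.map s) (g.out.map (ρ l l')) *
        F.coeff h.kind (h.inp.map (ρ l l')) (h.out.map z) := by
  classical
  have hu' := (hm u).2 (.inl rfl)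
  have hv' := (hm v).2 (.inr rfl)
  rw [GenValues.mat₂, GenValues.mat, GenValues.mat, two_step_two F _ _ g.matching h.matching h1 h2
    u v huv hu'.1 hu'.2 hv'.1 hv'.2 fun y hy hy' => (hm y).1 ⟨hy, hy'⟩]
  have : ∀ l l', Function.update (Function.update (ρ .one .one) u l) v l' = ρ l l' := fun l l' =>
    funext fun y => by
      by_cases hy : y = v
      · subst hy; simp [hv]
      by_cases hy' : y = u
      · subst hy'; simp [hu, hy]
      · rw [Function.update_of_ne hy, Function.update_of_ne hy', hρ l l' y hy' hy]
  simp only [this]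

theorem mat_of_compat (F : GenValues) {C D : Config} {g : Gen C D} {s : C.Circ → Lab}
    {r : D.Circ → Lab} (h : Compat g.same s r) :
    F.mat g s r = F.coeff g.kind (g.inp.map s) (g.out.map r) :=
  if_pos h

/-- The labeling of two circles. -/
def two (l l' : Lab) (y : Bool) : Lab := if y then l else l'

/-- The labeling of three circles. -/
def three (l l' l'' : Lab) (y : Fin 3) : Lab := if y = 0 then l else if y = 1 then l' else l''

section

variable (F : GenValues) (n : Bool)

theorem mat₂_birth_merge (l l' : Lab) :
    F.mat₂ (birthTwo n) (mergeTwo n) (fun _ => l) (fun _ => l') =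
      ∑ m, F.unit m * F.mul n m l l' :=
  mat₂_one_of_family F (g := birthTwo n) (h := mergeTwo n) (fun m => two m l) true
    (by rintro ⟨⟩ y ⟨_, rfl⟩; rfl) (fun x _ h => absurd h.1 (bool_not_mem x).1) (fun _ => rfl)
    (by rintro l (_ | _) h; exacts [rfl, absurd rfl h])
    (by decide : ∀ y : Bool, y ∈ [true] ∧ y ∈ [true, false] ↔ y = true)

theorem mat₂_split_death (l l' : Lab) :
    F.mat₂ (splitTwo n) (deathTwo n) (fun _ => l) (fun _ => l') =
      ∑ m, F.comul n l m l' * F.counit m :=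
  mat₂_one_of_family F (g := splitTwo n) (h := deathTwo n) (fun m => two m l') true
    (fun x _ h => absurd h.1 (unit_not_mem x)) (by
      rintro (_ | _) _ ⟨h, -⟩
      · rfl
      · exact absurd (List.mem_singleton.2 rfl) h)
    (fun _ => rfl) (by rintro l (_ | _) h; exacts [rfl, absurd rfl h])
    (by decide : ∀ y : Bool, y ∈ [true, false] ∧ y ∈ [true] ↔ y = true)

theorem mat₂_split_merge (l l' : Lab) :
    F.mat₂ (splitTwo n) (mergeTwo n) (fun _ => l) (fun _ => l') =
      ∑ m, ∑ m', F.comul n l m m' * F.mul n m m' l' :=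
  mat₂_two_of_family F (g := splitTwo n) (h := mergeTwo n) two true false Bool.noConfusion
    (fun x _ h => absurd h.1 (unit_not_mem x)) (fun x _ h => absurd h.1 (bool_not_mem x).1)
    (fun _ _ => rfl) (fun _ _ => rfl)
    (by rintro l l' (_ | _) h h'; exacts [absurd rfl h', absurd rfl h])
    (by decide : ∀ y : Bool, y ∈ [true, false] ∧ y ∈ [true, false] ↔ y = true ∨ y = false)

theorem mat₂_inner_merge (a b c d : Lab) :
    F.mat₂ mergeInner (mergeTwo true) (three a b c) (fun _ => d) =
      ∑ m, F.mul true a b m * F.mul true m c d :=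
  mat₂_one_of_family F (g := mergeInner) (h := mergeTwo true) (fun m => two m c) true
    (by
      rintro x y ⟨h, rfl⟩
      obtain rfl := (by decide : ∀ x : Fin 3, x ∉ [0, 1] → x = 2) x h
      rfl)
    (fun x _ h => absurd h.1 (bool_not_mem x).1) (fun _ => rfl)
    (by rintro l (_ | _) h; exacts [rfl, absurd rfl h])
    (by decide : ∀ y : Bool, y ∈ [true] ∧ y ∈ [true, false] ↔ y = true)

theorem mat₂_outer_merge (a b c d : Lab) :
    F.mat₂ mergeOuter (mergeTwo false) (three a b c) (fun _ => d) =
      ∑ m, F.mul true b c m * F.mul false a m d :=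
  mat₂_one_of_family F (g := mergeOuter) (h := mergeTwo false) (fun m => two a m) false
    (by
      rintro x y ⟨h, rfl⟩
      obtain rfl := (by decide : ∀ x : Fin 3, x ∉ [1, 2] → x = 0) x h
      rfl)
    (fun x _ h => absurd h.1 (bool_not_mem x).1) (fun _ => rfl)
    (by rintro l (_ | _) h; exacts [absurd rfl h, rfl])
    (by decide : ∀ y : Bool, y ∈ [false] ∧ y ∈ [true, false] ↔ y = false)

theorem mat₂_split_inner (a b c d : Lab) :
    F.mat₂ (splitTwo true) splitInner (fun _ => d) (three a b c) =
      ∑ m, F.comul true d m c * F.comul true m a b :=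
  mat₂_one_of_family F (g := splitTwo true) (h := splitInner) (fun m => two m c) true
    (fun x _ h => absurd h.1 (unit_not_mem x))
    (by
      rintro x y ⟨h, rfl⟩
      obtain rfl := (by decide : ∀ x : Bool, x ∉ [true] → x = false) x h
      rfl)
    (fun _ => rfl) (by rintro l (_ | _) h; exacts [rfl, absurd rfl h])
    (by decide : ∀ y : Bool, y ∈ [true, false] ∧ y ∈ [true] ↔ y = true)

theorem mat₂_split_outer (a b c d : Lab) :
    F.mat₂ (splitTwo false) splitOuter (fun _ => d) (three a b c) =
      ∑ m, F.comul false d a m * F.comul true m b c :=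
  mat₂_one_of_family F (g := splitTwo false) (h := splitOuter) (fun m => two a m) false
    (fun x _ h => absurd h.1 (unit_not_mem x))
    (by
      rintro x y ⟨h, rfl⟩
      obtain rfl := (by decide : ∀ x : Bool, x ∉ [false] → x = true) x h
      rfl)
    (fun _ => rfl) (by rintro l (_ | _) h; exacts [absurd rfl h, rfl])
    (by decide : ∀ y : Bool, y ∈ [true, false] ∧ y ∈ [false] ↔ y = false)

theorem mat_merge (l l' m : Lab) :
    F.mat (mergeTwo n) (two l l') (fun _ => m) = F.mul n l l' m :=
  mat_of_compat F (g := mergeTwo n) fun x _ h => absurd h.1 (bool_not_mem x).1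

theorem mat_merge' (l l' m : Lab) :
    F.mat mergeTwo' (two l l') (fun _ => m) = F.mul false l' l m :=
  mat_of_compat F (g := mergeTwo') fun x _ h => absurd h.1 (bool_not_mem x).2

theorem mat_split (l l' m : Lab) :
    F.mat (splitTwo n) (fun _ => m) (two l l') = F.comul n m l l' :=
  mat_of_compat F (g := splitTwo n) fun x _ h => absurd h.1 (unit_not_mem x)

theorem mat_split' (l l' m : Lab) :
    F.mat splitTwo' (fun _ => m) (two l l') = F.comul false m l' l :=
  mat_of_compat F (g := splitTwo') fun x _ h => absurd h.1 (unit_not_mem x)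

theorem mat_idOne (l l' : Lab) :
    F.mat idOne (fun _ => l) (fun _ => l') = if l = l' then 1 else 0 := by
  classical
  rw [Gen.iso_mat F rfl]
  congr 1
  exact propext ⟨fun h => h () () ⟨List.not_mem_nil, rfl⟩, fun h _ _ _ => h⟩

end

theorem merges_two (n : Bool) : (mergeTwo n).Merges true false () :=
  ⟨⟨n, rfl⟩, .inl rfl, rfl⟩

theorem splits_two (n : Bool) : (splitTwo n).Splits () true false :=
  ⟨⟨n, rfl⟩, rfl, .inl rfl⟩

theorem no_same_merge {C : Config} {n : Bool} {g : Gen C (twoCircles n)} {z} (x) :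
    ¬ same₂ g (mergeTwo n) x z := fun ⟨y, _, h⟩ => (bool_not_mem y).1 h.1

theorem no_same_split {D : Config} {n : Bool} {h : Gen (twoCircles n) D} {z} (x) :
    ¬ same₂ (splitTwo n) h x z := fun ⟨_, h, _⟩ => unit_not_mem x h.1

theorem rel_unit (n : Bool) : Rel (word₂ (birthTwo n) (mergeTwo n)) idOne.word :=
  .unit _ _ _ () true false () rfl rfl ⟨List.not_mem_nil, rfl⟩ (merges_two n) rfl
    ⟨List.not_mem_nil, rfl⟩ fun _ _ h => absurd rfl h

theorem rel_counit (n : Bool) : Rel (word₂ (splitTwo n) (deathTwo n)) idOne.word :=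
  .counit _ _ _ () true false () (splits_two n) rfl rfl
    ⟨(by decide : (false : Bool) ∉ [true]), rfl⟩ rfl
    ⟨List.not_mem_nil, rfl⟩ fun _ _ h => absurd rfl h

theorem rel_comm : Rel (mergeTwo false).word mergeTwo'.word :=
  .comm _ _ true false () (merges_two false) ⟨⟨false, rfl⟩, .inl rfl, rfl⟩ fun x _ =>
    ⟨fun h => absurd h.1 (bool_not_mem x).1, fun h => absurd h.1 (bool_not_mem x).2⟩

theorem rel_cocomm : Rel (splitTwo false).word splitTwo'.word :=
  .cocomm _ _ () true false (splits_two false) ⟨⟨false, rfl⟩, rfl, .inl rfl⟩ fun x _ =>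
    ⟨fun h => absurd h.1 (unit_not_mem x), fun h => absurd h.1 (unit_not_mem x)⟩

theorem rel_torus : Rel (word₂ (splitTwo false) (mergeTwo false))
    (word₂ (splitTwo true) (mergeTwo true)) :=
  .torus _ _ _ _ () true false true false () (splits_two _) (merges_two _) (splits_two _)
    (merges_two _) fun x _ =>
      ⟨fun h => absurd h (no_same_split x), fun h => absurd h (no_same_split x)⟩

theorem rel_assoc : Rel (word₂ mergeInner (mergeTwo true)) (word₂ mergeOuter (mergeTwo false)) :=
  .assoc _ _ _ _ (0 : Fin 3) (1 : Fin 3) (2 : Fin 3) true false false true ()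
    ⟨⟨true, rfl⟩, .inl rfl, rfl⟩ ⟨(by decide : (2 : Fin 3) ∉ ([0, 1] : List (Fin 3))), rfl⟩
    (merges_two _) ⟨⟨true, rfl⟩, .inl rfl, rfl⟩
    ⟨(by decide : (0 : Fin 3) ∉ ([1, 2] : List (Fin 3))), rfl⟩ (merges_two _) fun x _ =>
      ⟨fun h => absurd h (no_same_merge x), fun h => absurd h (no_same_merge x)⟩

theorem rel_coassoc : Rel (word₂ (splitTwo true) splitInner) (word₂ (splitTwo false) splitOuter) :=
  .coassoc _ _ _ _ () true false false true (0 : Fin 3) (1 : Fin 3) (2 : Fin 3) (splits_two _)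
    ⟨⟨true, rfl⟩, rfl, .inl rfl⟩ ⟨(by decide : (false : Bool) ∉ [true]), rfl⟩
    (splits_two _) ⟨⟨true, rfl⟩, rfl, .inl rfl⟩
    ⟨(by decide : (true : Bool) ∉ [false]), rfl⟩ fun x _ =>
      ⟨fun h => absurd h (no_same_split x), fun h => absurd h (no_same_split x)⟩

namespace EQFT

variable {E : Z2Extension} (T : EQFT E)

theorem exists_sign {C D : Config} {f g : Word C D} (h : Rel f g)
    {k k' : (C.Circ → Lab) → (D.Circ → Lab) → ℤ} (hk : T.val.map f = linOf k)
    (hk' : T.val.map g = linOf k') : ∃ σ : ℤˣ, ∀ s z, k s z = σ * k' s z := by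
  refine ⟨E.sign C D f g, fun s z => ?_⟩
  have := T.map_rel f g h
  rw [hk, hk', ← linOf_smul] at this
  exact congrFun (congrFun (linOf_injective this) s) z

end EQFT

theorem isUnit_of_mul_mul {u m : ℤ} {σ : ℤˣ} (h : u * m = σ) : IsUnit m :=
  isUnit_of_mul_isUnit_right (h ▸ σ.isUnit)

/-- The generator values of a graded EQFT are given by signs. -/
theorem EQFT.exists_params {E : Z2Extension} (T : EQFT E) (hG : T.val.Graded) :
    ∃ P : Params, P.Gives T.val := by
  have hm : ∀ n a b c, c.deg ≠ a.deg + b.deg - 1 → T.val.mul n a b c = 0 := fun n a b c h => by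
    by_contra h'
    exact h (hG.1 n a b c h')
  have hc : ∀ n a b c, b.deg + c.deg ≠ a.deg - 1 → T.val.comul n a b c = 0 := fun n a b c h => by
    by_contra h'
    exact h (hG.2.1 n a b c h')
  have hu : T.val.unit .X = 0 := by
    by_contra h'
    exact absurd (hG.2.2.1 _ h') (by decide)
  have hcu : T.val.counit .one = 0 := by
    by_contra h'
    exact absurd (hG.2.2.2 _ h') (by decide)
  have hunit : ∀ n, ∃ e : ℤˣ, T.val.mul n .one .one .one = e ∧ T.val.mul n .one .X .X = e := by
    intro n
    obtain ⟨σ, hσ⟩ := T.exists_sign (rel_unit n) (map_word₂ _ _ _) (map_word _ _)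
    have h1 := hσ (fun _ => .one) (fun _ => .one)
    have h2 := hσ (fun _ => .X) (fun _ => .X)
    rw [mat₂_birth_merge, mat_idOne, sum_lab, hu] at h1 h2
    simp only [zero_mul, add_zero, if_true, mul_one] at h1 h2
    have hu0 : T.val.unit .one ≠ 0 := fun h => σ.ne_zero (by rw [← h1, h]; simp)
    obtain ⟨e, he⟩ := isUnit_of_mul_mul h1
    exact ⟨e, he.symm, (mul_left_cancel₀ hu0 (h2.trans h1.symm)).trans he.symm⟩
  have hcounit : ∀ n, ∃ e : ℤˣ, T.val.comul n .one .X .one = e ∧ T.val.comul n .X .X .X = e := by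
    intro n
    obtain ⟨σ, hσ⟩ := T.exists_sign (rel_counit n) (map_word₂ _ _ _) (map_word _ _)
    have h1 := hσ (fun _ => .one) (fun _ => .one)
    have h2 := hσ (fun _ => .X) (fun _ => .X)
    rw [mat₂_split_death, mat_idOne, sum_lab, hcu] at h1 h2
    simp only [mul_zero, zero_add, if_true, mul_one] at h1 h2
    have hu0 : T.val.counit .X ≠ 0 := fun h => σ.ne_zero (by rw [← h1, h]; simp)
    rw [mul_comm] at h1 h2
    obtain ⟨e, he⟩ := isUnit_of_mul_mul h1
    exact ⟨e, he.symm, (mul_left_cancel₀ hu0 (h2.trans h1.symm)).trans he.symm⟩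
  obtain ⟨e₁, h1, h1'⟩ := hunit false
  obtain ⟨e₅, h5, h5'⟩ := hunit true
  obtain ⟨e₃, h3, h3'⟩ := hcounit false
  obtain ⟨e₈, h8, h8'⟩ := hcounit true
  have h2 : T.val.mul false .X .one .X = e₁ := by
    obtain ⟨σ, hσ⟩ := T.exists_sign rel_comm (map_word _ _) (map_word _ _)
    have t1 := hσ (two .one .one) (fun _ => .one)
    have t2 := hσ (two .X .one) (fun _ => .X)
    rw [mat_merge, mat_merge', h1] at t1
    rw [mat_merge, mat_merge', h1', ← t1] at t2
    exact t2
  have h4 : T.val.comul false .one .one .X = e₃ := by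
    obtain ⟨σ, hσ⟩ := T.exists_sign rel_cocomm (map_word _ _) (map_word _ _)
    have t1 := hσ (fun _ => .X) (two .X .X)
    have t2 := hσ (fun _ => .one) (two .one .X)
    rw [mat_split, mat_split', h3'] at t1
    rw [mat_split, mat_split', h3, ← t1] at t2
    exact t2
  obtain ⟨e₇, h7⟩ : ∃ e : ℤˣ, T.val.mul true .X .one .X = e := by
    obtain ⟨σ, hσ⟩ := T.exists_sign rel_assoc (map_word₂ _ _ _) (map_word₂ _ _ _)
    have t := hσ (three .X .one .one) (fun _ => .X)
    rw [mat₂_inner_merge, mat₂_outer_merge, sum_lab, sum_lab, hm true .X .one .one (by decide),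
      hm true .one .one .X (by decide), h2, h5, zero_mul, zero_mul, zero_add, add_zero] at t
    obtain ⟨e, he⟩ := isUnit_of_mul_mul (σ := σ * (e₅ * e₁)) (by rw [t]; push_cast; rfl)
    exact ⟨e, he.symm⟩
  obtain ⟨e₉, h9⟩ : ∃ e : ℤˣ, T.val.comul true .one .one .X = e := by
    obtain ⟨σ, hσ⟩ := T.exists_sign rel_coassoc (map_word₂ _ _ _) (map_word₂ _ _ _)
    have t := hσ (fun _ => .one) (three .one .X .X)
    rw [mat₂_split_inner, mat₂_split_outer, sum_lab, sum_lab, hc true .one .X .X (by decide),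
      hc false .one .one .one (by decide), h4, h8', zero_mul, zero_mul, zero_add, add_zero] at t
    obtain ⟨e, he⟩ := isUnit_of_mul_mul (σ := σ * (e₃ * e₈)) (by rw [t]; push_cast; rfl)
    exact ⟨e, he.symm⟩
  have htorus : e₉ = e₈ * (e₅ * e₇) := by
    obtain ⟨σ, hσ⟩ := T.exists_sign rel_torus (map_word₂ _ _ _) (map_word₂ _ _ _)
    have t := hσ (fun _ => .one) (fun _ => .X)
    rw [mat₂_split_merge, mat₂_split_merge] at t
    simp only [sum_lab, h1', h2, h3, h4, h5', h7, h8, h9, hm true .X .X .X (by decide),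
      hm false .X .X .X (by decide), hm true .one .one .X (by decide),
      hm false .one .one .X (by decide)] at t
    revert t
    clear * -
    simp only [mul_zero, add_zero, zero_add]
    revert e₁ e₃ e₅ e₇ e₈ e₉ σ
    decide
  refine ⟨⟨e₁, e₃, e₅, e₈, e₅ * e₇⟩, ?_, ?_, ?_, ?_⟩
  · funext a b c
    cases a <;> cases b <;> cases c <;>
      first | exact h1 | exact h1' | exact h2 | exact hm _ _ _ _ (by decide)
  · funext a b c
    rw [← int_units_mul_self_left e₅ e₇] at h7
    cases a <;> cases b <;> cases c <;>
      first | exact h5 | exact h5' | exact h7 | exact hm _ _ _ _ (by decide)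
  · funext a b c
    cases a <;> cases b <;> cases c <;>
      first | exact h3 | exact h3' | exact h4 | exact hc _ _ _ _ (by decide)
  · funext a b c
    rw [htorus] at h9
    cases a <;> cases b <;> cases c <;>
      first | exact h8 | exact h8' | exact h9 | exact hc _ _ _ _ (by decide)

/-! ### Classification of the operations -/

namespace Params

def mulOf (P : Params) : Bool → Lab → Lab → Lab → ℤ
  | false => signedMul P.mul₀ P.mul₀ P.mul₀
  | true => signedMul P.mul₁ P.mul₁ (P.mul₁ * P.twist)

def comulOf (P : Params) : Bool → Lab → Lab → Lab → ℤ
  | false => signedComul P.comul₀ P.comul₀ P.comul₀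
  | true => signedComul P.comul₁ (P.comul₁ * P.twist) P.comul₁

theorem gives_iff {P : Params} {F : GenValues} :
    P.Gives F ↔ F.mul = P.mulOf ∧ F.comul = P.comulOf := by
  constructor
  · rintro ⟨h1, h2, h3, h4⟩
    exact ⟨funext fun n => by cases n <;> assumption, funext fun n => by cases n <;> assumption⟩
  · rintro ⟨h1, h2⟩
    exact ⟨congrFun h1 _, congrFun h1 _, congrFun h2 _, congrFun h2 _⟩

theorem ops_injective :
    Function.Injective fun P : Params => (P.mulOf, P.comulOf) := by
  intro P Q h
  have h1 : P.mulOf = Q.mulOf := congrArg Prod.fst h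
  have h2 : P.comulOf = Q.comulOf := congrArg Prod.snd h
  have e1 : P.mul₀ = Q.mul₀ :=
    Units.ext (congrFun (congrFun (congrFun (congrFun h1 false) .one) .one) .one)
  have e2 : P.mul₁ = Q.mul₁ :=
    Units.ext (congrFun (congrFun (congrFun (congrFun h1 true) .one) .one) .one)
  have e3 : P.comul₀ = Q.comul₀ :=
    Units.ext (congrFun (congrFun (congrFun (congrFun h2 false) .X) .X) .X)
  have e4 : P.comul₁ = Q.comul₁ :=
    Units.ext (congrFun (congrFun (congrFun (congrFun h2 true) .X) .X) .X)
  have e5 : P.mul₁ * P.twist = Q.mul₁ * Q.twist :=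
    Units.ext (congrFun (congrFun (congrFun (congrFun h1 true) .X) .one) .X)
  rw [e2] at e5
  have e5 := mul_left_cancel e5
  cases P
  cases Q
  simp_all

def equivProd : Params ≃ ℤˣ × ℤˣ × ℤˣ × ℤˣ × ℤˣ where
  toFun P := ⟨P.mul₀, P.comul₀, P.mul₁, P.comul₁, P.twist⟩
  invFun p := ⟨p.1, p.2.1, p.2.2.1, p.2.2.2.1, p.2.2.2.2⟩
  left_inv _ := rfl
  right_inv _ := rfl

theorem card_params : Nat.card Params = 32 := by
  rw [Nat.card_congr equivProd, Nat.card_eq_fintype_card]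
  simp [Fintype.card_prod]

end Params

theorem exists_isKhovanovLike_iff (μ δ : Bool → Lab → Lab → Lab → ℤ) :
    (∃ F : GenValues, IsKhovanovLike F ∧ F.mul = μ ∧ F.comul = δ) ↔
      ∃ P : Params, P.mulOf = μ ∧ P.comulOf = δ := by
  constructor
  · rintro ⟨F, ⟨E, -, ⟨T, rfl⟩, hG, -⟩, rfl, rfl⟩
    obtain ⟨P, hP⟩ := T.exists_params hG
    exact ⟨P, (Params.gives_iff.1 hP).1.symm, (Params.gives_iff.1 hP).2.symm⟩
  · rintro ⟨P, rfl, rfl⟩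
    exact ⟨⟨P.mulOf, P.comulOf, khovanov.unit, khovanov.counit⟩,
      (Params.gives_iff.2 ⟨rfl, rfl⟩).isKhovanovLike ⟨rfl, rfl⟩, rfl, rfl⟩

theorem exists_params_iff (μ δ : Bool → Lab → Lab → Lab → ℤ) :
    (∃ P : Params, P.mulOf = μ ∧ P.comulOf = δ) ↔
      ∃ e₁ e₂ e₃ e₄ e₅ e₆ e₇ e₈ e₉ e₁₀ : ℤˣ,
        (e₁ = e₂ ∧ e₃ = e₄ ∧ e₅ = e₆ ∧ e₈ = e₁₀ ∧ e₇ * e₈ = e₅ * e₉) ∧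
        μ false = signedMul e₁ e₂ e₂ ∧ μ true = signedMul e₅ e₆ e₇ ∧
        δ false = signedComul e₃ e₃ e₄ ∧ δ true = signedComul e₈ e₉ e₁₀ := by
  constructor
  · rintro ⟨P, rfl, rfl⟩
    refine ⟨P.mul₀, P.mul₀, P.comul₀, P.comul₀, P.mul₁, P.mul₁, P.mul₁ * P.twist, P.comul₁,
      P.comul₁ * P.twist, P.comul₁, ⟨rfl, rfl, rfl, rfl, ?_⟩, rfl, rfl, rfl, rfl⟩
    rw [mul_assoc, mul_comm P.twist]
  · rintro ⟨e₁, _, e₃, _, e₅, _, e₇, e₈, e₉, _, ⟨rfl, rfl, rfl, rfl, h⟩, h1, h2, h3, h4⟩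
    refine ⟨⟨e₁, e₃, e₅, e₈, e₅ * e₇⟩, ?_, ?_⟩
    · funext n
      cases n
      · exact h1.symm
      · rw [h2, Params.mulOf, int_units_mul_self_left]
    · funext n
      cases n
      · exact h3.symm
      · rw [h4, Params.comulOf]
        congr 1
        change e₈ * (e₅ * e₇) = e₉
        clear h1 h2 h3 h4
        revert e₅ e₇ e₈ e₉
        decide

theorem ncard_operations :
    Set.ncard {p : (Bool → Lab → Lab → Lab → ℤ) × (Bool → Lab → Lab → Lab → ℤ) |
      ∃ F : GenValues, IsKhovanovLike F ∧ F.mul = p.1 ∧ F.comul = p.2} = 32 := by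
  have : {p : (Bool → Lab → Lab → Lab → ℤ) × (Bool → Lab → Lab → Lab → ℤ) |
      ∃ F : GenValues, IsKhovanovLike F ∧ F.mul = p.1 ∧ F.comul = p.2} =
      (fun P : Params => (P.mulOf, P.comulOf)) '' Set.univ := by
    ext ⟨μ, δ⟩
    simp [exists_isKhovanovLike_iff]
  rw [this, Set.ncard_image_of_injective _ Params.ops_injective, Set.ncard_univ,
    Params.card_params]

/-! ### Multiplying a permutation by a transposition -/

section Swap

open Equiv Equiv.Perm

variable {L : Type*} {σ : Perm L} {u w : L}

theorem pow_succ_apply' (σ : Perm L) (n : ℕ) (x : L) : (σ ^ (n + 1)) x = σ ((σ ^ n) x) := by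
  rw [pow_succ', Perm.mul_apply]

theorem sameCycle_iff_exists_nat [Finite L] {x y : L} :
    σ.SameCycle x y ↔ ∃ n : ℕ, (σ ^ n) x = y :=
  ⟨fun h => h.exists_nat_pow_eq, fun ⟨n, h⟩ => ⟨n, by simpa using h⟩⟩

variable [DecidableEq L]

theorem not_sameCycle_swap_mul [Finite L] (huw : u ≠ w) (h : σ.SameCycle u w) :
    ¬ (swap u w * σ).SameCycle u w := by
  classical
  have hk := sameCycle_iff_exists_nat.1 h
  have hk0 : Nat.find hk ≠ 0 := fun h0 => huw (by
    have := Nat.find_spec hk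
    rwa [h0] at this)
  rw [sameCycle_iff_exists_nat]
  rintro ⟨n, hn⟩
  have key : ∀ n : ℕ, ∃ i < Nat.find hk, ((swap u w * σ) ^ n) u = (σ ^ i) u := by
    intro n
    induction n with
    | zero => exact ⟨0, Nat.pos_of_ne_zero hk0, rfl⟩
    | succ n ih =>
      obtain ⟨i, hi, e⟩ := ih
      rw [pow_succ_apply', e, Perm.mul_apply, ← pow_succ_apply']
      by_cases hi' : i + 1 = Nat.find hk
      · refine ⟨0, Nat.pos_of_ne_zero hk0, ?_⟩
        rw [hi', Nat.find_spec hk, swap_apply_right]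
        rfl
      · have hlt : i + 1 < Nat.find hk := by omega
        have h1 : (σ ^ (i + 1)) u ≠ w := Nat.find_min hk hlt
        have h2 : (σ ^ (i + 1)) u ≠ u := fun e' => by
          have h3 := Nat.find_spec hk
          obtain ⟨m, hm⟩ := Nat.exists_eq_add_of_lt hlt
          have h4 : Nat.find hk = (m + 1) + (i + 1) := by omega
          rw [h4, pow_add, Perm.mul_apply, e'] at h3
          exact Nat.find_min hk (m := m + 1) (by omega) h3
        exact ⟨i + 1, hlt, swap_apply_of_ne_of_ne h2 h1⟩
  obtain ⟨i, hi, e⟩ := key n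
  exact Nat.find_min hk hi (e ▸ hn)

theorem sameCycle_swap_mul [Finite L] (h : ¬ σ.SameCycle u w) :
    (swap u w * σ).SameCycle u w := by
  classical
  have hm : ∃ m, 0 < m ∧ (σ ^ m) u = u :=
    ⟨orderOf σ, orderOf_pos σ, by rw [pow_orderOf_eq_one]; rfl⟩
  have key : ∀ n < Nat.find hm, ((swap u w * σ) ^ n) u = (σ ^ n) u := by
    intro n hn
    induction n with
    | zero => rfl
    | succ n ih =>
      rw [pow_succ_apply', ih (by omega), Perm.mul_apply, ← pow_succ_apply']
      refine swap_apply_of_ne_of_ne (fun e => ?_) fun e => ?_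
      · exact Nat.find_min hm hn ⟨n.succ_pos, e⟩
      · exact h (sameCycle_iff_exists_nat.2 ⟨_, e⟩)
  obtain ⟨h1, h2⟩ := Nat.find_spec hm
  refine sameCycle_iff_exists_nat.2 ⟨Nat.find hm, ?_⟩
  obtain ⟨m, hm'⟩ := Nat.exists_eq_succ_of_ne_zero h1.ne'
  rw [hm', pow_succ_apply', key m (by omega), Perm.mul_apply, ← pow_succ_apply',
    ← Nat.succ_eq_add_one, ← hm', h2, swap_apply_left]

theorem sameCycle_swap_mul_imp [Finite L] {p q : L} (h : (swap u w * σ).SameCycle p q) :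
    σ.SameCycle p q ∨
      (σ.SameCycle p u ∨ σ.SameCycle p w) ∧ (σ.SameCycle q u ∨ σ.SameCycle q w) := by
  obtain ⟨n, rfl⟩ := sameCycle_iff_exists_nat.1 h
  clear h
  induction n with
  | zero => exact .inl (SameCycle.refl _ _)
  | succ n ih =>
    rw [pow_succ_apply', Perm.mul_apply]
    generalize ((swap u w * σ) ^ n) p = q at ih ⊢
    have hq : σ.SameCycle q (σ q) := sameCycle_apply_right.2 (SameCycle.refl _ _)
    have ru := SameCycle.refl σ u
    have rw' := SameCycle.refl σ w
    rcases eq_or_ne (σ q) u with e | e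
    · rw [e, swap_apply_left]
      rw [e] at hq
      rcases ih with ih | ih
      · exact .inr ⟨.inl (ih.trans hq), .inr rw'⟩
      · exact .inr ⟨ih.1, .inr rw'⟩
    rcases eq_or_ne (σ q) w with e' | e'
    · rw [e', swap_apply_right]
      rw [e'] at hq
      rcases ih with ih | ih
      · exact .inr ⟨.inr (ih.trans hq), .inl ru⟩
      · exact .inr ⟨ih.1, .inl ru⟩
    rw [swap_apply_of_ne_of_ne e e']
    rcases ih with ih | ⟨h1, h2⟩
    · exact .inl (ih.trans hq)
    · exact .inr ⟨h1, h2.imp hq.symm.trans hq.symm.trans⟩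

/-- If `u` and `w` are in different cycles of `σ`, then `swap u w * σ` joins them. -/
theorem sameCycle_swap_mul_iff [Finite L] (h : ¬ σ.SameCycle u w) {p q : L} :
    (swap u w * σ).SameCycle p q ↔ σ.SameCycle p q ∨
      (σ.SameCycle p u ∨ σ.SameCycle p w) ∧ (σ.SameCycle q u ∨ σ.SameCycle q w) := by
  refine ⟨sameCycle_swap_mul_imp, ?_⟩
  have huw := sameCycle_swap_mul h
  have back : ∀ {p q}, σ.SameCycle p q → (swap u w * σ).SameCycle p q ∨
      ((swap u w * σ).SameCycle p u ∨ (swap u w * σ).SameCycle p w) ∧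
        ((swap u w * σ).SameCycle q u ∨ (swap u w * σ).SameCycle q w) := fun {p q} hpq => by
    refine sameCycle_swap_mul_imp (σ := swap u w * σ) ?_
    rwa [← mul_assoc, swap_mul_self, one_mul]
  have toU : ∀ {p}, (swap u w * σ).SameCycle p u ∨ (swap u w * σ).SameCycle p w →
      (swap u w * σ).SameCycle p u := fun h => h.elim id fun h => h.trans huw.symm
  have back' : ∀ {p q}, σ.SameCycle p q → (swap u w * σ).SameCycle p q := fun hpq =>
    (back hpq).elim id fun h => (toU h.1).trans (toU h.2).symm
  rintro (h1 | ⟨h1, h2⟩)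
  · exact back' h1
  · exact (toU (h1.imp back' back')).trans (toU (h2.imp back' back')).symm

end Swap

/-! ### The board -/

section Board

variable {n : ℕ}

def Side.opp : Side → Side
  | .N => .S
  | .S => .N
  | .E => .W
  | .W => .E

theorem pt_left_injective {t t' : Fin n × Fin n} {s : Side} (h : pt t s = pt t' s) : t = t' := by
  cases s <;> simpa [pt, Prod.ext_iff] using h

theorem pt_eq_pt {t t' : Fin n × Fin n} {s s' : Side} (h : pt t s = pt t' s') :
    t = t' ∧ s' = s ∨ t ≠ t' ∧ s' = s.opp := by
  by_cases hs : s' = s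
  · subst hs
    exact .inl ⟨pt_left_injective h, rfl⟩
  · refine .inr ⟨?_, ?_⟩
    · rintro rfl
      cases s <;> cases s' <;> simp_all [pt, Fin.ext_iff]
    · cases s <;> cases s' <;> simp_all [pt, Side.opp]

theorem leaves_opp (dir : Pt n → Bool) {t t' : Fin n × Fin n} {s s' : Side}
    (h : pt t s = pt t' s') (ht : t ≠ t') : leaves dir t' s' = !leaves dir t s := by
  obtain rfl := ((pt_eq_pt h).resolve_left fun h => ht h.1).2
  cases s <;> simp only [leaves, Side.opp] at * <;> simp [h]

theorem Tile.even_of_strands {T : Tile} (hT : ¬ T.IsCrossing) {f : Side → ZMod 2}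
    (h1 : ∀ s, ¬ T.Has s → f s = 0) (h2 : ∀ a ∈ T.strands, f a.1 = f a.2) :
    f .N + f .E + f .S + f .W = 0 := by
  have hN := h1 .N
  have hE := h1 .E
  have hS := h1 .S
  have hW := h1 .W
  clear h1
  cases T <;> simp [Tile.Has, Tile.strands, Tile.IsCrossing] at hN hE hS hW h2 hT <;>
    (generalize f .N = a, f .E = b, f .S = c, f .W = d at *
     revert a b c d
     decide)

/-- The position at a side of a tile of a quantity defined at the corners of the tile. -/
def cornerAt (ne sw se : ZMod 2) : Side → ZMod 2
  | .N => ne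
  | .S => se
  | .E => se
  | .W => sw

theorem Tile.corner_eq_of_strands {T : Tile} (hT : ¬ T.IsCrossing) {f : Side → ZMod 2}
    (h1 : ∀ s, ¬ T.Has s → f s = 0) {nw ne sw se : ZMod 2} (hN : f .N = nw + ne)
    (hE : f .E = se + ne) (hS : f .S = sw + se) (hW : f .W = sw + nw) {a : Side × Side}
    (ha : a ∈ T.strands) (h : f a.1 = 0) (h' : f a.2 = 0) :
    cornerAt ne sw se a.1 = cornerAt ne sw se a.2 := by
  have h1N := h1 .N
  have h1E := h1 .E
  have h1S := h1 .S
  have h1W := h1 .W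
  clear h1
  rw [hN] at h1N
  rw [hE] at h1E
  rw [hS] at h1S
  rw [hW] at h1W
  obtain ⟨s, s'⟩ := a
  cases T <;> cases s <;> cases s' <;> simp [Tile.strands, Tile.IsCrossing] at ha hT <;>
    simp [Tile.Has, Tile.strands, hN, hE, hS, hW] at h1N h1E h1S h1W h h' <;>
    simp only [cornerAt] <;>
    (clear hN hE hS hW
     revert nw ne sw se
     decide)

/-- The checkerboard orientation on the sides of a tile, in terms of its corners. -/
def cornerLeaves (nw ne sw : ZMod 2) : Side → Bool
  | .N => decide (nw = 0)
  | .S => !decide (sw = 0)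
  | .E => decide (ne = 0)
  | .W => !decide (nw = 0)

theorem Tile.cornerLeaves_ne {T : Tile} (hT : ¬ T.IsCrossing) {f : Side → ZMod 2}
    (h1 : ∀ s, ¬ T.Has s → f s = 0) (h2 : ∀ s, T.Has s → f s = 1) {nw ne sw se : ZMod 2}
    (hN : f .N = nw + ne) (hE : f .E = se + ne) (hS : f .S = sw + se) (hW : f .W = sw + nw)
    {a : Side × Side} (ha : a ∈ T.strands) :
    cornerLeaves nw ne sw a.1 ≠ cornerLeaves nw ne sw a.2 := by
  have h1N := h1 .N
  have h1E := h1 .E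
  have h1S := h1 .S
  have h1W := h1 .W
  have h2N := h2 .N
  have h2E := h2 .E
  have h2S := h2 .S
  have h2W := h2 .W
  clear h1 h2
  rw [hN] at h1N h2N
  rw [hE] at h1E h2E
  rw [hS] at h1S h2S
  rw [hW] at h1W h2W
  obtain ⟨s, s'⟩ := a
  cases T <;> cases s <;> cases s' <;> simp [Tile.strands, Tile.IsCrossing] at ha hT <;>
    simp [Tile.Has, Tile.strands] at h1N h1E h1S h1W h2N h2E h2S h2W <;>
    simp only [cornerLeaves] <;>
    (clear hN hE hS hW
     revert nw ne sw se
     decide)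

end Board

namespace Diagram

variable {n : ℕ} (D : Diagram n)

theorem has_of_pt_eq {t t' : Fin n × Fin n} {s s' : Side} (h : pt t s = pt t' s')
    (hs : (D.tile t').Has s') : (D.tile t).Has s := by
  rcases pt_eq_pt h with ⟨rfl, rfl⟩ | ⟨hne, rfl⟩
  · exact hs
  · obtain ⟨t'', s'', hne', h', hs'⟩ := D.connected t' _ hs
    have e := ((pt_eq_pt h').resolve_left fun h => hne' h.1).2
    have : s'' = s := by
      revert e
      cases s <;> cases s'' <;> simp [Side.opp]
    subst this
    obtain rfl := pt_left_injective (h.trans h'.symm)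
    exact hs'

/-- The points of the link. -/
def link : Set (Pt n) := {p | ∃ t s, (D.tile t).Has s ∧ pt t s = p}

theorem pt_mem_link {t : Fin n × Fin n} {s : Side} : pt t s ∈ D.link ↔ (D.tile t).Has s :=
  ⟨fun ⟨_, _, h, e⟩ => D.has_of_pt_eq e.symm h, fun h => ⟨t, s, h, rfl⟩⟩

theorem right_boundary (j : Fin n) : Sum.inr (Fin.last n, j) ∉ D.link := by
  rintro ⟨t, s, h, e⟩
  obtain ⟨t', s', hne, e', -⟩ := D.connected t s h
  obtain rfl := ((pt_eq_pt e').resolve_left fun h => hne h.1).2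
  rw [← e'] at e
  have e'' := e'.symm.trans e
  cases s' <;> simp [pt, Side.opp, Fin.ext_iff] at e e'' <;> omega

variable (v : D.Vertex)

theorem resolved_not_isCrossing (t : Fin n × Fin n) : ¬ (D.resolved v t).IsCrossing := by
  rw [resolved]
  cases D.tile t <;> cases decide (∃ x ∈ v, x.1 = t) <;> simp [Tile.smooth, Tile.IsCrossing]

theorem resolved_has (t : Fin n × Fin n) (s : Side) :
    (D.resolved v t).Has s ↔ (D.tile t).Has s := by
  rw [resolved]
  cases D.tile t <;> cases decide (∃ x ∈ v, x.1 = t) <;>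
    simp only [Tile.smooth] <;> cases s <;> simp [Tile.Has, Tile.strands]

theorem has_of_mem_strands {T : Tile} {a : Side × Side} (h : a ∈ T.strands) :
    T.Has a.1 ∧ T.Has a.2 :=
  ⟨⟨a, h, .inl rfl⟩, ⟨a, h, .inr rfl⟩⟩

/-! ### Winding numbers modulo 2 -/

open scoped Classical in
/-- The indicator function of a set of points. -/
noncomputable def ind (S : Set (Pt n)) (p : Pt n) : ZMod 2 := if p ∈ S then 1 else 0

/-- The number of points of `S` at the height `j` with abscissa at least `i`. -/
noncomputable def wind (S : Set (Pt n)) (i : ℕ) (j : Fin (n + 1)) : ZMod 2 :=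
  ∑ i' : Fin n, if i ≤ i' then ind S (.inl (i', j)) else 0

theorem wind_step (S : Set (Pt n)) (i : Fin n) (j : Fin (n + 1)) :
    wind S i j = ind S (.inl (i, j)) + wind S (i + 1) j := by
  have : ∀ i' : Fin n, (if (i : ℕ) ≤ i' then ind S (.inl (i', j)) else 0) =
      (if i' = i then ind S (.inl (i, j)) else 0) +
        if (i : ℕ) + 1 ≤ i' then ind S (.inl (i', j)) else 0 := by
    intro i'
    by_cases h : i' = i
    · subst h; simp
    · have : (i : ℕ) ≤ i' ↔ (i : ℕ) + 1 ≤ i' := by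
        have := fun e => h (Fin.ext e)
        omega
      simp [h, this]
  simp only [wind, this, Finset.sum_add_distrib]
  simp

/-- A set of points of the link that contains with a point all of its circle. -/
structure StrandClosed (S : Set (Pt n)) : Prop where
  sub : S ⊆ D.link
  strand : ∀ t, ∀ a ∈ (D.resolved v t).strands, pt t a.1 ∈ S ↔ pt t a.2 ∈ S

variable {D v} {S : Set (Pt n)}

theorem ind_eq_zero {p : Pt n} (h : p ∉ S) : ind S p = 0 := if_neg h

theorem ind_eq_one {p : Pt n} (h : p ∈ S) : ind S p = 1 := if_pos h

theorem StrandClosed.ind_of_not_has (h : D.StrandClosed v S) {t : Fin n × Fin n} {s : Side}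
    (hs : ¬ (D.resolved v t).Has s) : ind S (pt t s) = 0 :=
  ind_eq_zero fun hp => hs ((D.resolved_has v t s).2 (D.pt_mem_link.1 (h.sub hp)))

theorem StrandClosed.ind_strand (h : D.StrandClosed v S) {t : Fin n × Fin n} {a b : Side}
    (ha : (a, b) ∈ (D.resolved v t).strands) : ind S (pt t a) = ind S (pt t b) := by
  classical
  exact if_congr (h.strand t _ ha) rfl rfl

theorem StrandClosed.even (h : D.StrandClosed v S) (t : Fin n × Fin n) :
    ind S (pt t .N) + ind S (pt t .E) + ind S (pt t .S) + ind S (pt t .W) = 0 :=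
  Tile.even_of_strands (f := fun s => ind S (pt t s)) (D.resolved_not_isCrossing v t)
    (fun _ hs => h.ind_of_not_has hs) fun _ ha => h.ind_strand ha

theorem StrandClosed.vertical (h : D.StrandClosed v S) (i : Fin (n + 1)) (j : Fin n) :
    ind S (.inr (i, j)) = wind S i j.castSucc + wind S i j.succ := by
  induction i using Fin.reverseInduction with
  | last =>
    have : ∀ j, wind S n j = 0 := fun j => Finset.sum_eq_zero fun i _ => if_neg (by omega)
    rw [ind_eq_zero fun hp => D.right_boundary j (h.sub hp), Fin.val_last, this, this, add_zero]
  | cast i ih =>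
    have e := h.even (i, j)
    simp only [pt] at e
    rw [ih] at e
    simp only [Fin.val_castSucc, wind_step, Fin.val_succ] at e ⊢
    generalize ind S (.inl (i, j.succ)) = a, ind S (.inl (i, j.castSucc)) = b,
      ind S (.inr (i.castSucc, j)) = c, wind S (i + 1) j.castSucc = x,
      wind S (i + 1) j.succ = y at *
    clear * - e
    revert a b c x y
    decide

/-- The winding number of `S` around a point outside of `S`. -/
noncomputable def windAt (S : Set (Pt n)) : Pt n → ZMod 2
  | .inl (i, j) => wind S (i + 1) j
  | .inr (i, j) => wind S i j.castSucc

theorem windAt_pt (S : Set (Pt n)) (t : Fin n × Fin n) (s : Side) :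
    windAt S (pt t s) = cornerAt (wind S (t.1 + 1) t.2.succ) (wind S t.1 t.2.castSucc)
      (wind S (t.1 + 1) t.2.castSucc) s := by
  cases s <;> simp [pt, windAt, cornerAt]

theorem ind_N (S : Set (Pt n)) (t : Fin n × Fin n) :
    ind S (pt t .N) = wind S t.1 t.2.succ + wind S (t.1 + 1) t.2.succ := by
  rw [wind_step, add_assoc, CharTwo.add_self_eq_zero, add_zero, pt]

theorem ind_S (S : Set (Pt n)) (t : Fin n × Fin n) :
    ind S (pt t .S) = wind S t.1 t.2.castSucc + wind S (t.1 + 1) t.2.castSucc := by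
  rw [wind_step, add_assoc, CharTwo.add_self_eq_zero, add_zero, pt]

theorem StrandClosed.ind_E (h : D.StrandClosed v S) (t : Fin n × Fin n) :
    ind S (pt t .E) = wind S (t.1 + 1) t.2.castSucc + wind S (t.1 + 1) t.2.succ :=
  h.vertical t.1.succ t.2

theorem StrandClosed.ind_W (h : D.StrandClosed v S) (t : Fin n × Fin n) :
    ind S (pt t .W) = wind S t.1 t.2.castSucc + wind S t.1 t.2.succ :=
  h.vertical t.1.castSucc t.2

theorem StrandClosed.windAt_eq_of_linked (h : D.StrandClosed v S) {p q : Pt n}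
    (hpq : D.Linked v p q) (hp : p ∉ S) (hq : q ∉ S) : windAt S p = windAt S q := by
  obtain ⟨t, a, ha, rfl, rfl⟩ := hpq
  rw [windAt_pt, windAt_pt]
  exact Tile.corner_eq_of_strands (f := fun s => ind S (pt t s)) (D.resolved_not_isCrossing v t)
    (fun _ hs => h.ind_of_not_has hs) (ind_N S t) (h.ind_E t) (ind_S S t) (h.ind_W t) ha
    (ind_eq_zero hp) (ind_eq_zero hq)

theorem StrandClosed.mem_iff (h : D.StrandClosed v S) {p q : Pt n}
    (hpq : Relation.EqvGen (D.Linked v) p q) : p ∈ S ↔ q ∈ S := by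
  induction hpq with
  | rel p q h' =>
    obtain ⟨t, a, ha, rfl, rfl⟩ := h'
    exact h.strand t a ha
  | refl => rfl
  | symm _ _ _ ih => exact ih.symm
  | trans _ _ _ _ _ ih ih' => exact ih.trans ih'

theorem StrandClosed.windAt_eq (h : D.StrandClosed v S) {p q : Pt n}
    (hpq : Relation.EqvGen (D.Linked v) p q) (hp : p ∉ S) : windAt S p = windAt S q := by
  induction hpq with
  | rel p q h' => exact h.windAt_eq_of_linked h' hp fun hq => hp ((h.mem_iff (.rel _ _ h')).2 hq)
  | refl => rfl
  | symm p q h' ih => exact (ih fun hq => hp ((h.mem_iff h').1 hq)).symm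
  | trans p q r h' _ ih ih' =>
    exact (ih hp).trans (ih' fun hq => hp ((h.mem_iff h').2 hq))

/-! ### The checkerboard orientation -/

variable (D) in
/-- All resolutions are consistently oriented by `dir`. -/
def Orients (dir : Pt n → Bool) : Prop :=
  ∀ (v : D.Vertex) (t : Fin n × Fin n), ∀ p ∈ (D.resolved v t).strands,
    leaves dir t p.1 ≠ leaves dir t p.2

variable (D) in
theorem link_strandClosed (v : D.Vertex) : D.StrandClosed v D.link where
  sub := subset_rfl
  strand t a ha := by
    rw [pt_mem_link, pt_mem_link, ← D.resolved_has v, ← D.resolved_has v]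
    exact iff_of_true (has_of_mem_strands ha).1 (has_of_mem_strands ha).2

variable (D) in
noncomputable def checkerboard : Pt n → Bool
  | .inl (i, j) => decide (wind D.link i j = 0)
  | .inr (i, j) => decide (wind D.link i j.succ = 0)

variable (D) in
theorem orients_checkerboard : D.Orients D.checkerboard := by
  intro v t a ha
  have key : ∀ s, leaves D.checkerboard t s = cornerLeaves (wind D.link t.1 t.2.succ)
      (wind D.link (t.1 + 1) t.2.succ) (wind D.link t.1 t.2.castSucc) s := by
    intro s
    cases s <;> simp [leaves, pt, checkerboard, cornerLeaves]
  have h := D.link_strandClosed v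
  rw [key, key]
  exact Tile.cornerLeaves_ne (f := fun s => ind D.link (pt t s)) (D.resolved_not_isCrossing v t)
    (fun _ hs => h.ind_of_not_has hs)
    (fun s hs => ind_eq_one (D.pt_mem_link.2 ((D.resolved_has v t s).1 hs)))
    (ind_N _ t) (h.ind_E t) (ind_S _ t) (h.ind_W t) ha

theorem Orients.neg {dir : Pt n → Bool} (h : D.Orients dir) : D.Orients fun p => !dir p := by
  intro v t a ha
  have key : ∀ s, leaves (fun p => !dir p) t s = !leaves dir t s := by
    intro s
    cases s <;> simp [leaves]
  rw [key, key]
  exact fun e => h v t a ha (by simpa using e)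

variable (D) in
theorem exists_orients (t : Fin n × Fin n) (s : Side) :
    ∃ dir, D.Orients dir ∧ leaves dir t s = true := by
  by_cases h : leaves D.checkerboard t s = true
  · exact ⟨_, D.orients_checkerboard, h⟩
  · refine ⟨_, D.orients_checkerboard.neg, ?_⟩
    cases s <;> simpa [leaves] using h

end Diagram

/-- The sides `s` and `s'` are joined by a strand of `T`. -/
def Tile.Joins (T : Tile) (s s' : Side) : Prop := (s, s') ∈ T.strands ∨ (s', s) ∈ T.strands

theorem Tile.Joins.symm {T : Tile} {s s' : Side} (h : T.Joins s s') : T.Joins s' s := Or.symm h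

theorem Tile.Joins.has {T : Tile} {s s' : Side} (h : T.Joins s s') : T.Has s :=
  h.elim (fun h => ⟨_, h, .inl rfl⟩) fun h => ⟨_, h, .inr rfl⟩

theorem Tile.Has.exists_joins {T : Tile} {s : Side} (h : T.Has s) : ∃ s', T.Joins s s' := by
  obtain ⟨⟨a, b⟩, h, rfl | rfl⟩ := h
  · exact ⟨b, .inl h⟩
  · exact ⟨a, .inr h⟩

theorem Tile.Joins.unique {T : Tile} {s s' s'' : Side} (h : T.Joins s s') (h' : T.Joins s s'') :
    s' = s'' := by
  revert h h'
  cases T <;> simp only [Joins, strands, List.mem_cons, Prod.mk.injEq, List.not_mem_nil] <;> grind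

namespace Diagram

variable {n : ℕ} (D : Diagram n)

/-- The points `p` and `q` lie on the same circle of the resolution `v`. -/
abbrev Conn (v : D.Vertex) : Pt n → Pt n → Prop := Relation.EqvGen (D.Linked v)

/-- In the resolution `v`, oriented by `dir`, the point `q` comes next after `p`. -/
def Step (dir : Pt n → Bool) (v : D.Vertex) (p q : Pt n) : Prop :=
  ∃ t s s', (D.resolved v t).Joins s s' ∧ leaves dir t s = false ∧ leaves dir t s' = true ∧
    pt t s = p ∧ pt t s' = q

variable {D} {dir : Pt n → Bool} {v : D.Vertex}

theorem Orients.leaves_ne (ho : D.Orients dir) {t : Fin n × Fin n} {s s' : Side}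
    (h : (D.resolved v t).Joins s s') : leaves dir t s' = !leaves dir t s := by
  rcases h with h | h
  · have := ho v t _ h
    revert this
    cases leaves dir t s <;> cases leaves dir t s' <;> simp
  · have := ho v t _ h
    revert this
    cases leaves dir t s <;> cases leaves dir t s' <;> simp

theorem eq_of_leaves {t t' : Fin n × Fin n} {s s' : Side} (h : pt t s = pt t' s')
    (hl : leaves dir t s = leaves dir t' s') : t = t' ∧ s = s' := by
  by_cases ht : t = t'
  · exact ⟨ht, (((pt_eq_pt h).resolve_right fun h => h.1 ht).2).symm⟩
  · rw [leaves_opp dir h ht] at hl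
    simp at hl

theorem mem_link_of_joins {t : Fin n × Fin n} {s s' : Side} (h : (D.resolved v t).Joins s s') :
    pt t s ∈ D.link :=
  D.pt_mem_link.2 ((D.resolved_has v t s).1 h.has)

theorem Step.mem_left {p q : Pt n} (h : D.Step dir v p q) : p ∈ D.link := by
  obtain ⟨t, s, s', h, -, -, rfl, -⟩ := h
  exact mem_link_of_joins h

theorem Step.mem_right {p q : Pt n} (h : D.Step dir v p q) : q ∈ D.link := by
  obtain ⟨t, s, s', h, -, -, -, rfl⟩ := h
  exact mem_link_of_joins h.symm

theorem Step.right_unique {p q q' : Pt n} (h : D.Step dir v p q) (h' : D.Step dir v p q') :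
    q = q' := by
  obtain ⟨t, s, s', h, h1, -, rfl, rfl⟩ := h
  obtain ⟨t₁, s₁, s₁', h', h2, -, e, rfl⟩ := h'
  obtain ⟨rfl, rfl⟩ := eq_of_leaves (dir := dir) e (h2.trans h1.symm)
  rw [h.unique h']

theorem Step.left_unique {p p' q : Pt n} (h : D.Step dir v p q) (h' : D.Step dir v p' q) :
    p = p' := by
  obtain ⟨t, s, s', h, -, h1, rfl, rfl⟩ := h
  obtain ⟨t₁, s₁, s₁', h', -, h2, rfl, e⟩ := h'
  obtain ⟨rfl, rfl⟩ := eq_of_leaves (dir := dir) e (h2.trans h1.symm)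
  rw [h.symm.unique h'.symm]

theorem Orients.exists_step (ho : D.Orients dir) (v : D.Vertex) {p : Pt n} (hp : p ∈ D.link) :
    ∃ q, D.Step dir v p q := by
  have key : ∃ t s, (D.tile t).Has s ∧ leaves dir t s = false ∧ pt t s = p := by
    obtain ⟨t, s, h, rfl⟩ := hp
    cases hl : leaves dir t s with
    | false => exact ⟨t, s, h, hl, rfl⟩
    | true =>
      obtain ⟨t', s', hne, e, h'⟩ := D.connected t s h
      exact ⟨t', s', h', by rw [leaves_opp dir e.symm hne.symm, hl]; rfl, e⟩
  obtain ⟨t, s, h, hl, rfl⟩ := key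
  obtain ⟨s', hs⟩ := ((D.resolved_has v t s).2 h).exists_joins
  exact ⟨_, t, s, s', hs, hl, by rw [ho.leaves_ne hs, hl]; rfl, rfl, rfl⟩

/-- The permutation of the points of the link whose cycles are the circles of `v`. -/
noncomputable def Orients.perm (ho : D.Orients dir) (v : D.Vertex) : Equiv.Perm D.link :=
  Equiv.ofBijective
    (fun p => ⟨(ho.exists_step v p.2).choose, (ho.exists_step v p.2).choose_spec.mem_right⟩)
    (Finite.injective_iff_bijective.1 fun p q h => by
      have h1 := (ho.exists_step v p.2).choose_spec
      have h2 := (ho.exists_step v q.2).choose_spec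
      simp only [Subtype.mk.injEq] at h
      rw [← h] at h2
      exact Subtype.ext (h1.left_unique h2))

theorem Orients.step_perm (ho : D.Orients dir) (v : D.Vertex) (p : D.link) :
    D.Step dir v p (ho.perm v p) :=
  (ho.exists_step v p.2).choose_spec

theorem Step.conn {p q : Pt n} (h : D.Step dir v p q) : D.Conn v p q := by
  obtain ⟨t, s, s', h | h, -, -, rfl, rfl⟩ := h
  · exact .rel _ _ ⟨t, _, h, rfl, rfl⟩
  · exact .symm _ _ (.rel _ _ ⟨t, _, h, rfl, rfl⟩)

theorem Orients.sameCycle_iff (ho : D.Orients dir) (v : D.Vertex) (p q : D.link) :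
    (ho.perm v).SameCycle p q ↔ D.Conn v p q := by
  constructor
  · rw [sameCycle_iff_exists_nat]
    rintro ⟨m, rfl⟩
    induction m with
    | zero => exact .refl _
    | succ m ih =>
      rw [pow_succ_apply']
      exact .trans _ _ _ ih (ho.step_perm v _).conn
  · have step : ∀ {p q : Pt n} (h : D.Step dir v p q),
        (ho.perm v).SameCycle ⟨p, h.mem_left⟩ ⟨q, h.mem_right⟩ := fun {p q} h => by
      have : ho.perm v ⟨p, h.mem_left⟩ = ⟨q, h.mem_right⟩ :=
        Subtype.ext ((ho.step_perm v ⟨p, h.mem_left⟩).right_unique h)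
      rw [← this]
      exact Equiv.Perm.sameCycle_apply_right.2 (Equiv.Perm.SameCycle.refl _ _)
    have key : ∀ {p q : Pt n}, D.Conn v p q →
        p = q ∨ ∃ (hp : p ∈ D.link) (hq : q ∈ D.link), (ho.perm v).SameCycle ⟨p, hp⟩ ⟨q, hq⟩ := by
      intro p q h
      induction h with
      | rel p q h =>
        obtain ⟨t, ⟨s, s'⟩, h, rfl, rfl⟩ := h
        have h : (D.resolved v t).Joins s s' := .inl h
        have hl := ho.leaves_ne h
        cases hs : leaves dir t s with
        | false => exact .inr ⟨_, _, step ⟨t, s, s', h, hs, by rw [hl, hs]; rfl, rfl, rfl⟩⟩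
        | true =>
          exact .inr ⟨_, _, (step ⟨t, s', s, h.symm, by rw [hl, hs]; rfl, hs, rfl, rfl⟩).symm⟩
      | refl => exact .inl rfl
      | symm _ _ _ ih =>
        rcases ih with rfl | ⟨hp, hq, h⟩
        · exact .inl rfl
        · exact .inr ⟨hq, hp, h.symm⟩
      | trans _ _ _ _ _ ih ih' =>
        rcases ih with rfl | ⟨hp, hq, h⟩
        · exact ih'
        rcases ih' with rfl | ⟨hp', hq', h'⟩
        · exact .inr ⟨hp, hq, h⟩
        · exact .inr ⟨hp, hq', h.trans h'⟩
    intro h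
    rcases key h with e | ⟨_, _, h⟩
    · obtain rfl := Subtype.ext e
      exact Equiv.Perm.SameCycle.refl _ _
    · exact h

/-! ### Changing the smoothing of a crossing -/

variable (D) in
/-- The northern and the southern point of a crossing. -/
def northPt (x : D.Crossing) : D.link := ⟨pt x.1 .N, x.1, .N, D.crossing_has x .N, rfl⟩

variable (D) in
def southPt (x : D.Crossing) : D.link := ⟨pt x.1 .S, x.1, .S, D.crossing_has x .S, rfl⟩

theorem northPt_ne_southPt (x : D.Crossing) : D.northPt x ≠ D.southPt x := fun h => by
  simpa [northPt, southPt, pt, Fin.ext_iff] using congrArg Subtype.val h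

theorem resolved_insert_of_ne {x : D.Crossing} {t : Fin n × Fin n} (ht : t ≠ x.1) :
    D.resolved (insert x v) t = D.resolved v t := by
  have : (∃ y ∈ insert x v, y.1 = t) ↔ ∃ y ∈ v, y.1 = t := by
    refine ⟨fun ⟨y, hy, e⟩ => ⟨y, (Finset.mem_insert.1 hy).resolve_left ?_, e⟩,
      fun ⟨y, hy, e⟩ => ⟨y, Finset.mem_insert_of_mem hy, e⟩⟩
    rintro rfl
    exact ht e.symm
  simp only [resolved, this]

/-- At `x`, one of the resolutions `v` and `insert x v` has the arcs `NE`, `SW`, the other one has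
the arcs `NW`, `SE`. -/
theorem resolved_insert_self {x : D.Crossing} (hx : x ∉ v) :
    D.resolved v x.1 = .nesw ∧ D.resolved (insert x v) x.1 = .nwse ∨
      D.resolved v x.1 = .nwse ∧ D.resolved (insert x v) x.1 = .nesw := by
  have h1 : ¬ ∃ y ∈ v, y.1 = x.1 := by
    rintro ⟨y, hy, e⟩
    exact hx (Subtype.ext e ▸ hy)
  have h2 : ∃ y ∈ insert x v, y.1 = x.1 := ⟨x, Finset.mem_insert_self _ _, rfl⟩
  rcases x.2 with h | h
  · exact .inl (by simp only [resolved, h, h1, h2]; exact ⟨rfl, rfl⟩)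
  · exact .inr (by simp only [resolved, h, h1, h2]; exact ⟨rfl, rfl⟩)

theorem Tile.smoothings_joins {T T' : Tile}
    (hT : T = .nesw ∧ T' = .nwse ∨ T = .nwse ∧ T' = .nesw) {s s' : Side} (h : T.Joins s s') :
    s = .N ∨ s = .S ∨ s' = .N ∧ T'.Joins s .S ∨ s' = .S ∧ T'.Joins s .N := by
  revert h
  rcases hT with ⟨rfl, rfl⟩ | ⟨rfl, rfl⟩ <;> cases s <;> cases s' <;>
    simp [Tile.Joins, Tile.strands]

theorem Orients.perm_insert (ho : D.Orients dir) {x : D.Crossing} (hx : x ∉ v)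
    (hl : leaves dir x.1 .N = true) :
    ho.perm (insert x v) = Equiv.swap (D.northPt x) (D.southPt x) * ho.perm v := by
  classical
  have hS : leaves dir x.1 .S = true := by
    have hE : ∀ (w : D.Vertex) (s s'), (D.resolved w x.1).Joins s s' →
      leaves dir x.1 s' = !leaves dir x.1 s := fun w s s' h => ho.leaves_ne h
    rcases resolved_insert_self hx with ⟨h1, h2⟩ | ⟨h1, h2⟩
    · have e1 := hE v .N .E (by rw [h1]; simp [Tile.Joins, Tile.strands])
      have e2 := hE (insert x v) .E .S (by rw [h2]; simp [Tile.Joins, Tile.strands])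
      rw [e2, e1, hl]
      rfl
    · have e1 := hE v .N .W (by rw [h1]; simp [Tile.Joins, Tile.strands])
      have e2 := hE (insert x v) .W .S (by rw [h2]; simp [Tile.Joins, Tile.strands])
      rw [e2, e1, hl]
      rfl
  refine Equiv.ext fun p => Subtype.ext ((ho.step_perm _ p).right_unique ?_)
  rw [Equiv.Perm.mul_apply]
  have h0 := ho.step_perm v p
  generalize ho.perm v p = q at h0 ⊢
  obtain ⟨t, s, s', h, h1, h2, e, e'⟩ := h0
  by_cases ht : t = x.1
  · subst ht
    have hq : ∀ {r : D.link}, pt x.1 s' = r → q = r := fun h => Subtype.ext (e'.symm.trans h)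
    rcases Tile.smoothings_joins (resolved_insert_self hx) h with rfl | rfl | ⟨rfl, h'⟩ | ⟨rfl, h'⟩
    · rw [hl] at h1
      cases h1
    · rw [hS] at h1
      cases h1
    · rw [hq (r := D.northPt x) rfl, Equiv.swap_apply_left]
      exact ⟨_, _, _, h', h1, hS, e, rfl⟩
    · rw [hq (r := D.southPt x) rfl, Equiv.swap_apply_right]
      exact ⟨_, _, _, h', h1, hl, e, rfl⟩
  · have hN : q ≠ D.northPt x := fun h =>
      ht (eq_of_leaves (dir := dir)
        (show pt t s' = pt x.1 .N from e'.trans (congrArg Subtype.val h)) (h2.trans hl.symm)).1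
    have hS' : q ≠ D.southPt x := fun h =>
      ht (eq_of_leaves (dir := dir)
        (show pt t s' = pt x.1 .S from e'.trans (congrArg Subtype.val h)) (h2.trans hS.symm)).1
    rw [Equiv.swap_apply_of_ne_of_ne hN hS']
    exact ⟨t, s, s', by rwa [resolved_insert_of_ne ht], h1, h2, e, e'⟩

variable (D) in
/-- The circles of `v'` arise from those of `v` by joining the circles through both sides of
`x`. -/
structure Joining (v v' : D.Vertex) (x : D.Crossing) : Prop where
  not_conn : ¬ D.Conn v (pt x.1 .N) (pt x.1 .S)
  conn_iff : ∀ p ∈ D.link, ∀ q ∈ D.link, D.Conn v' p q ↔ D.Conn v p q ∨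
    (D.Conn v p (pt x.1 .N) ∨ D.Conn v p (pt x.1 .S)) ∧
      (D.Conn v q (pt x.1 .N) ∨ D.Conn v q (pt x.1 .S))

theorem joining_of_swap {v' : D.Vertex} {x : D.Crossing} {σ : Equiv.Perm D.link}
    (h : ∀ p q : D.link, σ.SameCycle p q ↔ D.Conn v p q)
    (h' : ∀ p q : D.link, (Equiv.swap (D.northPt x) (D.southPt x) * σ).SameCycle p q ↔
      D.Conn v' p q)
    (hx : ¬ D.Conn v (pt x.1 .N) (pt x.1 .S)) : D.Joining v v' x where
  not_conn := hx
  conn_iff p hp q hq := by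
    have := sameCycle_swap_mul_iff (σ := σ) (u := D.northPt x) (w := D.southPt x)
      (fun h0 => hx ((h _ _).1 h0)) (p := ⟨p, hp⟩) (q := ⟨q, hq⟩)
    simp only [h, h'] at this
    exact this

theorem joining_or {x : D.Crossing} (hx : x ∉ v) :
    D.Joining v (insert x v) x ∨ D.Joining (insert x v) v x := by
  classical
  obtain ⟨dir, ho, hl⟩ := D.exists_orients x.1 .N
  have e := ho.perm_insert hx hl
  by_cases h : D.Conn v (pt x.1 .N) (pt x.1 .S)
  · refine .inr (joining_of_swap (ho.sameCycle_iff _) (fun p q => ?_) fun h' => ?_)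
    · rw [e, ← mul_assoc, Equiv.swap_mul_self, one_mul, ho.sameCycle_iff]
    · have h1 := (ho.sameCycle_iff v (D.northPt x) (D.southPt x)).2 h
      have h2 := (ho.sameCycle_iff (insert x v) (D.northPt x) (D.southPt x)).2 h'
      rw [e] at h2
      exact not_sameCycle_swap_mul (northPt_ne_southPt x) h1 h2
  · refine .inl (joining_of_swap (ho.sameCycle_iff _) (fun p q => ?_) h)
    rw [← e, ho.sameCycle_iff]

theorem Joining.conn {v' : D.Vertex} {x : D.Crossing} (h : D.Joining v v' x) :
    D.Conn v' (pt x.1 .N) (pt x.1 .S) :=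
  (h.conn_iff _ (D.northPt x).2 _ (D.southPt x).2).2
    (.inr ⟨.inl (.refl _), .inr (.refl _)⟩)

end Diagram

theorem Matching.swap_inp {α β : Type} {a b : α} {out : List β} {same : α → β → Prop}
    (H : Matching [a, b] out same) : Matching [b, a] out same where
  nodup_inp := by simpa [eq_comm] using H.nodup_inp
  nodup_out := H.nodup_out
  not_mem_inp h := by simpa [and_comm] using H.not_mem_inp h
  not_mem_out := H.not_mem_out
  exists_right h := H.exists_right (by simpa [and_comm] using h)
  exists_left h := by simpa [and_comm] using H.exists_left h
  right_unique := H.right_unique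
  left_unique := H.left_unique

namespace Diagram

variable {n : ℕ} {D : Diagram n} {v v' : D.Vertex}

/-! ### Circles -/

variable (v) in
/-- The circle of `v` through a point of the link. -/
def circ (p : D.link) : D.Circle v :=
  ⟨D.circleSet v p, by
    obtain ⟨_, t, s, h, rfl⟩ := p
    exact ⟨t, s, h, rfl⟩⟩

theorem exists_circ (c : D.Circle v) : ∃ p, circ v p = c := by
  obtain ⟨c, t, s, h, rfl⟩ := c
  exact ⟨⟨_, t, s, h, rfl⟩, rfl⟩

theorem mem_circ {p : D.link} {q : Pt n} : q ∈ (circ v p).1 ↔ D.Conn v p q := Iff.rfl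

theorem self_mem_circ (p : D.link) : (p : Pt n) ∈ (circ v p).1 := .refl _

theorem circ_eq_iff {p q : D.link} : circ v p = circ v q ↔ D.Conn v p q := by
  constructor
  · intro h
    rw [← mem_circ, h]
    exact self_mem_circ q
  · exact fun h => Subtype.ext (Set.ext fun r =>
      ⟨fun h' => .trans _ _ _ (.symm _ _ h) h', fun h' => .trans _ _ _ h h'⟩)

theorem circ_eq_of_mem {c : D.Circle v} {p : D.link} (h : (p : Pt n) ∈ c.1) : circ v p = c := by
  obtain ⟨q, rfl⟩ := exists_circ c
  exact circ_eq_iff.2 (.symm _ _ h)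

theorem circleAt_north (x : D.Crossing) : D.circleAt v x .N = circ v (D.northPt x) := rfl

theorem circleAt_south (x : D.Crossing) : D.circleAt v x .S = circ v (D.southPt x) := rfl

theorem circle_strandClosed (c : D.Circle v) : D.StrandClosed v c.1 := by
  obtain ⟨p, rfl⟩ := exists_circ c
  refine ⟨fun q hq => ((D.link_strandClosed v).mem_iff hq).1 p.2, fun t a ha => ?_⟩
  have h : D.Conn v (pt t a.1) (pt t a.2) := .rel _ _ ⟨t, a, ha, rfl, rfl⟩
  exact ⟨fun h' => .trans _ _ _ h' h, fun h' => .trans _ _ _ h' (.symm _ _ h)⟩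

theorem circle_subset (c : D.Circle v) : c.1 ⊆ D.link := (circle_strandClosed c).sub

theorem compl_strandClosed (c : D.Circle v) : D.StrandClosed v (D.link \ c.1) where
  sub := Set.sdiff_subset
  strand t a ha := by
    rw [Set.mem_sdiff, Set.mem_sdiff, (D.link_strandClosed v).strand t a ha,
      (circle_strandClosed c).strand t a ha]

theorem eq_of_mem {c d : D.Circle v} {p : Pt n} (hc : p ∈ c.1) (hd : p ∈ d.1) : c = d := by
  have hp := circle_subset c hc
  rw [← circ_eq_of_mem (p := ⟨p, hp⟩) hc, circ_eq_of_mem (p := ⟨p, hp⟩) hd]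

theorem conn_of_mem {c : D.Circle v} {p q : Pt n} (hp : p ∈ c.1) (hq : q ∈ c.1) :
    D.Conn v p q := by
  obtain ⟨r, rfl⟩ := exists_circ c
  exact .trans _ _ _ (.symm _ _ hp) hq

/-! ### Circles before and after a change of smoothing -/

/-- A circle of `v` is also a circle of `v'`. -/
def SameCircle (c : D.Circle v) (c' : D.Circle v') : Prop := c.1 = c'.1

theorem Joining.coe_circ_north {x : D.Crossing} (h : D.Joining v v' x) :
    (circ v' (D.northPt x)).1 = (circ v (D.northPt x)).1 ∪ (circ v (D.southPt x)).1 := by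
  ext q
  by_cases hq : q ∈ D.link
  · have := h.conn_iff _ (D.northPt x).2 _ hq
    have e1 : D.Conn v (D.northPt x).1 (D.northPt x).1 := .refl _
    have key : ∀ r, D.Conn v q r ↔ D.Conn v r q := fun r => ⟨.symm _ _, .symm _ _⟩
    rw [Set.mem_union, mem_circ, mem_circ, mem_circ, this]
    constructor
    · rintro (h | ⟨-, h | h⟩)
      · exact .inl h
      · exact .inl (.symm _ _ h)
      · exact .inr (.symm _ _ h)
    · rintro (h | h)
      · exact .inl h
      · exact .inr ⟨.inl e1, .inr (.symm _ _ h)⟩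
  · refine iff_of_false (fun h => hq (circle_subset _ h)) fun h => hq ?_
    exact h.elim (fun h => circle_subset _ h) fun h => circle_subset _ h

theorem Joining.circ_south {x : D.Crossing} (h : D.Joining v v' x) :
    circ v' (D.southPt x) = circ v' (D.northPt x) :=
  (circ_eq_iff.2 h.conn).symm

theorem Joining.circ_ne {x : D.Crossing} (h : D.Joining v v' x) :
    circ v (D.northPt x) ≠ circ v (D.southPt x) :=
  fun e => h.not_conn (circ_eq_iff.1 e)

theorem Joining.coe_circ_of_not {x : D.Crossing} (h : D.Joining v v' x) {p : D.link}
    (hN : ¬ D.Conn v p (pt x.1 .N)) (hS : ¬ D.Conn v p (pt x.1 .S)) :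
    (circ v p).1 = (circ v' p).1 := by
  ext q
  by_cases hq : q ∈ D.link
  · rw [mem_circ, mem_circ, h.conn_iff _ p.2 _ hq]
    tauto
  · exact iff_of_false (fun h => hq (circle_subset _ h)) fun h => hq (circle_subset _ h)

theorem Joining.conn_mono {x : D.Crossing} (h : D.Joining v v' x) {p q : D.link}
    (hpq : D.Conn v p q) : D.Conn v' p q :=
  (h.conn_iff _ p.2 _ q.2).2 (.inl hpq)

theorem Joining.matching {x : D.Crossing} (h : D.Joining v v' x) :
    Matching [circ v (D.northPt x), circ v (D.southPt x)] [circ v' (D.northPt x)]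
      (SameCircle (v := v) (v' := v')) where
  nodup_inp := by simpa using h.circ_ne
  nodup_out := by simp
  not_mem_inp {c c'} e hc := by
    simp only [List.mem_cons, List.not_mem_nil, or_false] at hc
    have key : circ v' (D.northPt x) = c' := by
      rcases hc with rfl | rfl
      · exact circ_eq_of_mem (e ▸ self_mem_circ _)
      · rw [← h.circ_south]
        exact circ_eq_of_mem (e ▸ self_mem_circ _)
    subst key
    have e := (show c.1 = _ from e).trans h.coe_circ_north
    have h1 : (D.northPt x : Pt n) ∈ c.1 := by
      rw [e]
      exact .inl (self_mem_circ _)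
    have h2 : (D.southPt x : Pt n) ∈ c.1 := by
      rw [e]
      exact .inr (self_mem_circ _)
    exact h.not_conn (conn_of_mem h1 h2)
  not_mem_out {c c'} e hc := by
    obtain rfl := List.mem_singleton.1 hc
    have e := (show c.1 = _ from e).trans h.coe_circ_north
    have h1 : (D.northPt x : Pt n) ∈ c.1 := by
      rw [e]
      exact .inl (self_mem_circ _)
    have h2 : (D.southPt x : Pt n) ∈ c.1 := by
      rw [e]
      exact .inr (self_mem_circ _)
    exact h.not_conn (conn_of_mem h1 h2)
  exists_right {c} hc := by
    obtain ⟨p, rfl⟩ := exists_circ c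
    simp only [List.mem_cons, List.not_mem_nil, or_false, not_or, circ_eq_iff] at hc
    exact ⟨circ v' p, h.coe_circ_of_not hc.1 hc.2⟩
  exists_left {c} hc := by
    obtain ⟨p, rfl⟩ := exists_circ c
    simp only [List.mem_cons, List.not_mem_nil, or_false, circ_eq_iff] at hc
    refine ⟨circ v p, h.coe_circ_of_not (fun h' => hc ?_) fun h' => hc ?_⟩
    · exact h.conn_mono (q := D.northPt x) h'
    · exact .trans _ _ _ (h.conn_mono (q := D.southPt x) h') (.symm _ _ h.conn)
  right_unique e e' := Subtype.ext (e.symm.trans e')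
  left_unique e e' := Subtype.ext (e.trans e'.symm)

theorem Joining.matching' {x : D.Crossing} (h : D.Joining v' v x) :
    Matching [circ v (D.northPt x)] [circ v' (D.northPt x), circ v' (D.southPt x)]
      (SameCircle (v := v) (v' := v')) := by
  have : (SameCircle : D.Circle v → D.Circle v' → Prop) = fun c c' => SameCircle c' c :=
    funext fun _ => funext fun _ => propext eq_comm
  rw [this]
  exact h.matching.symm

/-! ### Depth -/

theorem odd_ncard_iff (S : Set (Pt n)) (i : Fin n) (j : Fin (n + 1)) :
    Odd (Set.ncard {i' | i < i' ∧ Sum.inl (i', j) ∈ S}) ↔ windAt S (.inl (i, j)) = 1 := by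
  classical
  rw [← ZMod.natCast_eq_one_iff_odd]
  have : {i' | i < i' ∧ Sum.inl (i', j) ∈ S} =
      ((Finset.univ.filter fun i' => i < i' ∧ Sum.inl (i', j) ∈ S : Finset (Fin n)) :
        Set (Fin n)) := by
    ext
    simp
  rw [this, Set.ncard_coe_finset, Finset.card_filter, Nat.cast_sum, windAt, wind]
  refine Eq.congr (Finset.sum_congr rfl fun i' _ => ?_) rfl
  by_cases h1 : i < i' <;> by_cases h2 : Sum.inl (i', j) ∈ S <;>
    simp [h1, h2, ind]

theorem inside_iff {c d : D.Circle v} (hne : c ≠ d) {i : Fin n} {j : Fin (n + 1)}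
    (h : Sum.inl (i, j) ∈ c.1) : D.Inside c d ↔ windAt d.1 (.inl (i, j)) = 1 := by
  constructor
  · rintro ⟨-, i', j', h', ho⟩
    rw [odd_ncard_iff] at ho
    rw [← ho]
    exact (circle_strandClosed d).windAt_eq (conn_of_mem h h') fun hd => hne (eq_of_mem h hd)
  · exact fun h' => ⟨hne, i, j, h, (odd_ncard_iff _ _ _).2 h'⟩

theorem not_inside_inside {c d : D.Circle v} (h : D.Inside c d) (h' : D.Inside d c) : False := by
  classical
  obtain ⟨hne, i₀, j₀, h0, -⟩ := id h
  obtain ⟨p, hp, hmax⟩ := Finset.exists_max_image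
    (Finset.univ.filter fun p : Fin n × Fin (n + 1) => Sum.inl p ∈ c.1 ∪ d.1) Prod.fst
    ⟨(i₀, j₀), by simp [h0]⟩
  simp only [Finset.mem_filter, Finset.mem_univ, true_and] at hp hmax
  have key : ∀ S : Set (Pt n), S ⊆ c.1 ∪ d.1 → windAt S (.inl p) = 0 := by
    intro S hS
    rw [windAt, wind]
    refine Finset.sum_eq_zero fun i _ => ?_
    split_ifs with hi
    · refine ind_eq_zero fun hm => ?_
      have := hmax (i, p.2) (hS hm)
      simp only [Fin.le_def] at this
      omega
    · rfl
  rcases hp with hp | hp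
  · rw [inside_iff hne hp, key _ Set.subset_union_right] at h
    exact zero_ne_one h
  · rw [inside_iff hne.symm hp, key _ Set.subset_union_left] at h'
    exact zero_ne_one h'

open scoped Classical in
/-- The number of circles around a circle modulo 2. -/
noncomputable def depth (c : D.Circle v) : ZMod 2 :=
  if ∃ i j, Sum.inl (i, j) ∈ c.1 ∧ windAt (D.link \ c.1) (.inl (i, j)) = 1 then 1 else 0

theorem depth_eq {c : D.Circle v} {i : Fin n} {j : Fin (n + 1)} (h : Sum.inl (i, j) ∈ c.1) :
    depth c = windAt (D.link \ c.1) (.inl (i, j)) := by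
  have key : ∀ z : ZMod 2, z ≠ 1 → 0 = z := by decide
  rw [depth]
  split_ifs with h'
  · obtain ⟨i', j', h', e⟩ := h'
    rw [← e]
    exact (compl_strandClosed c).windAt_eq (conn_of_mem h' h) fun h => h.2 h'
  · exact key _ fun e => h' ⟨i, j, h, e⟩

theorem SameCircle.depth_eq {c : D.Circle v} {c' : D.Circle v'} (h : SameCircle c c') :
    depth c = depth c' := by
  unfold depth
  rw [show c.1 = c'.1 from h]

theorem windAt_add {S T U : Set (Pt n)} (h : ∀ p, ind S p = ind T p + ind U p)
    (p : Fin n × Fin (n + 1)) : windAt S (.inl p) = windAt T (.inl p) + windAt U (.inl p) := by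
  simp only [windAt, wind, h, ← Finset.sum_add_distrib]
  refine Finset.sum_congr rfl fun i _ => ?_
  split_ifs <;> simp

theorem ind_diff {S T L : Set (Pt n)} (hT : T ⊆ L) (h : Disjoint S T) (p : Pt n) :
    ind (L \ S) p = ind T p + ind (L \ (S ∪ T)) p := by
  classical
  have hd : p ∈ S → p ∉ T := fun h1 h2 => Set.disjoint_left.1 h h1 h2
  have hl : p ∈ T → p ∈ L := fun h => hT h
  by_cases h1 : p ∈ S <;> by_cases h2 : p ∈ T <;> by_cases h3 : p ∈ L <;>
    simp_all [ind]

theorem disjoint_of_ne {c d : D.Circle v} (h : c ≠ d) : Disjoint c.1 d.1 :=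
  Set.disjoint_left.2 fun _ hc hd => h (eq_of_mem hc hd)

open scoped Classical in
theorem Joining.depth_eq {x : D.Crossing} (h : D.Joining v v' x) :
    depth (circ v (D.northPt x)) = (if D.Inside (circ v (D.northPt x)) (circ v (D.southPt x))
      then 1 else 0) + depth (circ v' (D.northPt x)) ∧
    depth (circ v (D.southPt x)) = (if D.Inside (circ v (D.southPt x)) (circ v (D.northPt x))
      then 1 else 0) + depth (circ v' (D.northPt x)) := by
  have key : ∀ z : ZMod 2, (if z = 1 then 1 else 0) = z := by decide
  have hN : Sum.inl (x.1.1, x.1.2.succ) ∈ (circ v (D.northPt x)).1 := self_mem_circ (D.northPt x)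
  have hS : Sum.inl (x.1.1, x.1.2.castSucc) ∈ (circ v (D.southPt x)).1 :=
    self_mem_circ (D.southPt x)
  have hN' : Sum.inl (x.1.1, x.1.2.succ) ∈ (circ v' (D.northPt x)).1 := by
    rw [h.coe_circ_north]
    exact .inl hN
  have hS' : Sum.inl (x.1.1, x.1.2.castSucc) ∈ (circ v' (D.northPt x)).1 := by
    rw [h.coe_circ_north]
    exact .inr hS
  constructor
  · rw [Diagram.depth_eq hN, Diagram.depth_eq hN', if_congr (inside_iff h.circ_ne hN) rfl rfl, key,
      h.coe_circ_north]
    exact windAt_add (ind_diff (circle_subset _) (disjoint_of_ne h.circ_ne)) _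
  · rw [Diagram.depth_eq hS, Diagram.depth_eq hS', if_congr (inside_iff h.circ_ne.symm hS) rfl rfl,
      key, h.coe_circ_north, Set.union_comm]
    exact windAt_add (ind_diff (circle_subset _) (disjoint_of_ne h.circ_ne.symm)) _

/-! ### The saddles -/

variable (v v') in
open scoped Classical in
/-- The circles through a crossing `x` and the kind of their nesting: `x` joins the first two, the
first being inside the second if the flag is `true`. -/
noncomputable def nestedPair (x : D.Crossing) : Bool × List (D.Circle v) :=
  if D.Inside (circ v (D.northPt x)) (circ v (D.southPt x)) then
    (true, [circ v (D.northPt x), circ v (D.southPt x)])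
  else if D.Inside (circ v (D.southPt x)) (circ v (D.northPt x)) then
    (true, [circ v (D.southPt x), circ v (D.northPt x)])
  else (false, [circ v (D.northPt x), circ v (D.southPt x)])

theorem edge_of_joining (F : GenValues) {x : D.Crossing} (h : D.Joining v v' x) :
    D.edge F v v' x = F.extend (.merge (nestedPair v x).1) (nestedPair v x).2
      [circ v' (D.northPt x)] SameCircle := by
  by_cases h1 : D.Inside (circ v (D.northPt x)) (circ v (D.southPt x)) <;>
  by_cases h2 : D.Inside (circ v (D.southPt x)) (circ v (D.northPt x)) <;>
  simp only [edge, circleAt_north, circleAt_south, nestedPair, ne_eq, h.circ_ne,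
    not_false_eq_true, if_true, if_false, h1, h2] <;> rfl

theorem edge_of_splitting (F : GenValues) {x : D.Crossing} (h : D.Joining v' v x) :
    D.edge F v v' x = F.extend (.split (nestedPair v' x).1) [circ v (D.northPt x)]
      (nestedPair v' x).2 SameCircle := by
  by_cases h1 : D.Inside (circ v' (D.northPt x)) (circ v' (D.southPt x)) <;>
  by_cases h2 : D.Inside (circ v' (D.southPt x)) (circ v' (D.northPt x)) <;>
  simp only [edge, circleAt_north, circleAt_south, nestedPair, ne_eq, h.circ_south,
    not_true_eq_false, if_true, if_false, h1, h2] <;> rfl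

theorem nestedPair_snd (x : D.Crossing) :
    (nestedPair v x).2 = [circ v (D.northPt x), circ v (D.southPt x)] ∨
      (nestedPair v x).2 = [circ v (D.southPt x), circ v (D.northPt x)] := by
  rw [nestedPair]
  split_ifs <;> simp

theorem Joining.matching_nestedPair {x : D.Crossing} (h : D.Joining v v' x) :
    Matching (nestedPair v x).2 [circ v' (D.northPt x)] (SameCircle (v := v) (v' := v')) := by
  rcases nestedPair_snd (v := v) x with e | e <;> rw [e]
  · exact h.matching
  · exact h.matching.swap_inp

theorem Joining.matching_nestedPair' {x : D.Crossing} (h : D.Joining v' v x) :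
    Matching [circ v (D.northPt x)] (nestedPair v' x).2 (SameCircle (v := v) (v' := v')) := by
  rcases nestedPair_snd (v := v') x with e | e <;> rw [e]
  · exact h.matching'
  · exact h.matching'.symm.swap_inp.symm

theorem Joining.levels {x : D.Crossing} (h : D.Joining v v' x) :
    (nestedPair v x).2.map depth = [if (nestedPair v x).1 then depth (circ v' (D.northPt x)) + 1
      else depth (circ v' (D.northPt x)), depth (circ v' (D.northPt x))] := by
  classical
  obtain ⟨e1, e2⟩ := h.depth_eq
  by_cases h1 : D.Inside (circ v (D.northPt x)) (circ v (D.southPt x)) <;>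
  by_cases h2 : D.Inside (circ v (D.southPt x)) (circ v (D.northPt x))
  · exact (not_inside_inside h1 h2).elim
  all_goals simp [nestedPair, e1, e2, h1, h2, add_comm]

/-- Every saddle is a gauge transform of Khovanov's. -/
theorem exists_edge_eq {P : Params} {F : GenValues} (hF : P.Gives F) {x : D.Crossing}
    (hx : x ∉ v) : ∃ ε : ℤˣ, ∀ s r, D.edge F v (insert x v) x s r =
      (ε * P.stateSign depth s * P.stateSign depth r : ℤˣ) *
        D.edge khovanov v (insert x v) x s r := by
  rcases joining_or hx with h | h
  · rw [edge_of_joining F h, edge_of_joining khovanov h]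
    exact ⟨_, P.extend_eq hF (.inr (show Kind.IsSaddle (.merge _) from trivial))
      h.matching_nestedPair (fun _ _ e => e.depth_eq)
      ⟨_, h.levels, rfl⟩⟩
  · rw [edge_of_splitting F h, edge_of_splitting khovanov h]
    exact ⟨_, P.extend_eq hF (.inr (show Kind.IsSaddle (.split _) from trivial))
      h.matching_nestedPair' (fun _ _ e => e.depth_eq)
      ⟨_, rfl, h.levels⟩⟩

end Diagram

/-! ## Multiplication by `X` -/

section Operators

variable {α β : Type}

open scoped Classical in
/-- Multiplication by `X` in the factor of the circle `c`. -/
noncomputable def mulX (c : α) : ((α → Lab) → ℤ) →ₗ[ℤ] ((α → Lab) → ℤ) where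
  toFun f t := if t c = .X then f (Function.update t c .one) else 0
  map_add' f g := by
    funext t
    simp only [Pi.add_apply]
    split_ifs <;> simp
  map_smul' r f := by
    funext t
    simp

open scoped Classical in
/-- The tensor product of the units. -/
noncomputable def vacuum : (α → Lab) → ℤ := Pi.single (fun _ => .one) 1

open scoped Classical in
theorem mulX_apply_of_X {c : α} {t : α → Lab} (h : t c = .X) (f : (α → Lab) → ℤ) :
    mulX c f t = f (Function.update t c .one) := by
  simp [mulX, h]

theorem mulX_apply_of_one {c : α} {t : α → Lab} (h : t c = .one) (f : (α → Lab) → ℤ) :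
    mulX c f t = 0 := by
  simp [mulX, h]

theorem mulX_nonneg {f : (α → Lab) → ℤ} (h : ∀ t, 0 ≤ f t) (c : α) (t : α → Lab) :
    0 ≤ mulX c f t := by
  classical
  cases e : t c
  · rw [mulX_apply_of_one e]
  · rw [mulX_apply_of_X e]
    exact h _

open scoped Classical in
theorem mulX_single (c : α) (s : α → Lab) :
    mulX c (Pi.single s 1) = if s c = .one then Pi.single (Function.update s c .X) 1 else 0 := by
  funext t
  by_cases hs : s c = .one
  · rw [if_pos hs]
    cases e : t c
    · rw [mulX_apply_of_one e, Pi.single_apply, if_neg]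
      rintro rfl
      simp at e
    · rw [mulX_apply_of_X e, Pi.single_apply, Pi.single_apply]
      refine if_congr ⟨?_, ?_⟩ rfl rfl
      · rintro rfl
        simp [← e]
      · rintro rfl
        simp [← hs]
  · rw [if_neg hs]
    cases e : t c
    · rw [mulX_apply_of_one e]
      rfl
    · rw [mulX_apply_of_X e, Pi.single_apply, if_neg]
      · rfl
      · rintro rfl
        simp at hs

theorem mulX_comm (c d : α) (f : (α → Lab) → ℤ) : mulX c (mulX d f) = mulX d (mulX c f) := by
  classical
  by_cases hcd : c = d
  · rw [hcd]
  funext t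
  cases ec : t c <;> cases ed : t d
  · rw [mulX_apply_of_one ec, mulX_apply_of_one ed]
  · rw [mulX_apply_of_one ec, mulX_apply_of_X ed, mulX_apply_of_one]
    simpa [hcd] using ec
  · rw [mulX_apply_of_X ec, mulX_apply_of_one ed, mulX_apply_of_one]
    simpa [Ne.symm hcd] using ed
  · rw [mulX_apply_of_X ec, mulX_apply_of_X ed, mulX_apply_of_X, mulX_apply_of_X,
      Function.update_comm hcd]
    · simpa [hcd] using ec
    · simpa [Ne.symm hcd] using ed

theorem Matching.swap_out {same : α → β → Prop} {a : List α} {b c : β}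
    (H : Matching a [b, c] same) :
    Matching a [c, b] same := H.symm.swap_inp.symm

open scoped Classical in
theorem vacuum_apply (t : α → Lab) : vacuum t = if ∀ x, t x = .one then 1 else 0 := by
  rw [vacuum, Pi.single_apply]
  exact if_congr funext_iff rfl rfl

/-- Linear maps that commute with the multiplications by `X` are determined by the vacuum. -/
theorem ext_vacuum [Finite α] {M : Type} [AddCommGroup M] {A B : ((α → Lab) → ℤ) →ₗ[ℤ] M}
    (h : A vacuum = B vacuum)
    (h' : ∀ c f, A f = B f → A (mulX c f) = B (mulX c f)) : A = B := by
  classical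
  have key : ∀ (k : ℕ) (s : α → Lab), Set.ncard {c | s c = .X} = k →
      A (Pi.single s 1) = B (Pi.single s 1) := by
    intro k
    induction k with
    | zero =>
      intro s hs
      have : s = fun _ => .one := by
        funext c
        cases e : s c
        · rfl
        · have : c ∈ {c | s c = .X} := e
          rw [(Set.ncard_eq_zero (Set.toFinite _)).1 hs] at this
          exact this.elim
      rw [this]
      exact h
    | succ k ih =>
      intro s hs
      obtain ⟨c, hc : s c = .X⟩ := Set.nonempty_of_ncard_ne_zero (hs.trans_ne k.succ_ne_zero)
      have h1 := ih (Function.update s c .one) <| by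
        have : {d | Function.update s c .one d = .X} = {c | s c = .X} \ {c} := by
          ext d
          by_cases hd : d = c <;> simp [hd]
        rw [this, Set.ncard_sdiff_singleton_of_mem (show c ∈ {c | s c = .X} from hc), hs,
          Nat.add_sub_cancel]
      have h2 := h' c _ h1
      rw [mulX_single, if_pos (by simp)] at h2
      simpa [← hc] using h2
  refine LinearMap.pi_ext' fun s => LinearMap.ext_ring ?_
  simpa using key _ s rfl

theorem merge_swap {same : α → β → Prop} (m : Bool) (a b : α) (c : β) :
    khovanov.extend (.merge m) [a, b] [c] same = khovanov.extend (.merge m) [b, a] [c] same := by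
  classical
  funext s t
  exact if_congr Iff.rfl (kmul_comm _ _ _) rfl

theorem split_swap {same : α → β → Prop} (m : Bool) (a : α) (b c : β) :
    khovanov.extend (.split m) [a] [b, c] same = khovanov.extend (.split m) [a] [c, b] same := by
  classical
  funext s t
  exact if_congr Iff.rfl (kcomul_comm _ _ _) rfl

variable [Fintype (α → Lab)]

theorem linOf_vacuum (K : (α → Lab) → (β → Lab) → ℤ) (t : β → Lab) :
    linOf K vacuum t = K (fun _ => .one) t := linOf_single _ _ _

theorem Matching.merge_vacuum {same : α → β → Prop} {a b : α} {c : β}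
    (H : Matching [a, b] [c] same) (m : Bool) :
    linOf (khovanov.extend (.merge m) [a, b] [c] same) vacuum = vacuum := by
  classical
  funext t
  rw [linOf_vacuum, extend_eq, vacuum_apply]
  have e : khovanov.coeff (.merge m) ([a, b].map fun _ => .one) ([c].map t) =
      if t c = .one then 1 else 0 := by
    simp only [List.map_cons, List.map_nil]
    cases t c <;> rfl
  rw [e, ← ite_and]
  refine if_congr ⟨fun h y => ?_, fun h => ⟨fun _ y _ => (h y).symm, h c⟩⟩ rfl rfl
  by_cases hy : y = c
  · exact hy ▸ h.2
  · obtain ⟨x, hx⟩ := H.exists_left (y := y) (by simpa using hy)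
    exact (h.1 x y hx).symm

theorem Matching.split_vacuum {same : α → β → Prop} {a : α} {b c : β}
    (H : Matching [a] [b, c] same) (m : Bool) :
    linOf (khovanov.extend (.split m) [a] [b, c] same) vacuum =
      mulX b vacuum + mulX c vacuum := by
  classical
  funext t
  have hbc : c ≠ b := fun e => by simpa [e] using H.nodup_out
  have key : ∀ b c, c ≠ b → mulX b vacuum t = if ∀ x, x ≠ b → t x = .one then
      (if t b = .X then 1 else 0) else 0 := by
    intro b c _
    cases e : t b
    · simp [mulX_apply_of_one e]
    · rw [mulX_apply_of_X e, vacuum_apply]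
      simp only [if_true]
      refine if_congr ⟨fun h x hx => ?_, fun h x => ?_⟩ rfl rfl
      · simpa [hx] using h x
      · by_cases hx : x = b
        · simp [hx]
        · simpa [hx] using h x hx
  rw [linOf_vacuum, extend_eq, Pi.add_apply, key b c hbc, key c b hbc.symm]
  by_cases h : Compat same (fun _ => .one) t
  · have h1 : ∀ x, x ≠ b → x ≠ c → t x = .one := fun y h1 h2 => by
      obtain ⟨x, hx⟩ := H.exists_left (y := y) (by simp [h1, h2])
      exact (h x y hx).symm
    have e1 : (∀ x, x ≠ b → t x = .one) ↔ t c = .one :=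
      ⟨fun h => h c hbc, fun h x hx => if hc : x = c then hc ▸ h else h1 x hx hc⟩
    have e2 : (∀ x, x ≠ c → t x = .one) ↔ t b = .one :=
      ⟨fun h => h b hbc.symm, fun h x hx => if hb : x = b then hb ▸ h else h1 x hb hx⟩
    rw [if_pos h, if_congr e1 rfl rfl, if_congr e2 rfl rfl]
    simp only [List.map_cons, List.map_nil]
    cases t b <;> cases t c <;> rfl
  · rw [if_neg h, if_neg, if_neg]
    · rfl
    · refine fun h' => h fun x y hxy => (h' y ?_).symm
      rintro rfl
      exact H.not_mem_out hxy (by simp)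
    · refine fun h' => h fun x y hxy => (h' y ?_).symm
      rintro rfl
      exact H.not_mem_out hxy (by simp)

variable [Finite α]

open scoped Classical in
theorem linOf_mulX {K : (α → Lab) → (β → Lab) → ℤ} {x : α} {y : β}
    (hK : ∀ s t, (if s x = .one then K (Function.update s x .X) t else 0) =
      if t y = .X then K s (Function.update t y .one) else 0) (f : (α → Lab) → ℤ) :
    linOf K (mulX x f) = mulX y (linOf K f) := by
  have : linOf K ∘ₗ mulX x = mulX y ∘ₗ linOf K := by
    refine LinearMap.pi_ext' fun s => LinearMap.ext_ring ?_
    funext t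
    simp only [LinearMap.comp_apply, LinearMap.coe_single]
    rw [mulX_single]
    have := hK s t
    cases e : t y
    · rw [mulX_apply_of_one e]
      rw [if_neg (show ¬ t y = .X by simp [e])] at this
      split_ifs with h
      · rw [if_pos h] at this
        rw [linOf_single, this]
      · rw [map_zero]
        rfl
    · rw [mulX_apply_of_X e, linOf_single]
      rw [if_pos e] at this
      split_ifs with h
      · rw [if_pos h] at this
        rw [linOf_single, this]
      · rw [if_neg h] at this
        rw [map_zero, ← this]
        rfl
  exact LinearMap.congr_fun this f

variable {inp : List α} {out : List β} {same : α → β → Prop}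

open scoped Classical in
theorem map_update_of_not_mem {α γ : Type} {l : List α} {x : α} (h : x ∉ l)
    (s : α → γ) (z : γ) : l.map (Function.update s x z) = l.map s :=
  List.map_congr_left fun y hx => Function.update_of_ne (fun e : y = x => h (e ▸ hx)) _ _

theorem Matching.mulX_same (H : Matching inp out same) {x : α} {y : β} (hxy : same x y)
    (F : GenValues) (k : Kind) (f : (α → Lab) → ℤ) :
    linOf (F.extend k inp out same) (mulX x f) = mulX y (linOf (F.extend k inp out same) f) := by
  classical
  refine linOf_mulX (fun s t => ?_) f
  rw [extend_eq, extend_eq, map_update_of_not_mem (H.not_mem_inp hxy),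
    map_update_of_not_mem (H.not_mem_out hxy), ← ite_and, ← ite_and]
  refine if_congr ⟨fun h => ⟨?_, fun x' y' h' => ?_⟩, fun h => ⟨?_, fun x' y' h' => ?_⟩⟩ rfl rfl
  · simpa using (h.2 x y hxy).symm
  · by_cases e : x' = x
    · subst e
      obtain rfl := H.right_unique hxy h'
      simpa using h.1
    · have e' : y' ≠ y := by
        rintro rfl
        exact e (H.left_unique h' hxy)
      simpa [e, e'] using h.2 x' y' h'
  · simpa using h.2 x y hxy
  · by_cases e : x' = x
    · subst e
      obtain rfl := H.right_unique hxy h'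
      simpa using h.1.symm
    · have e' : y' ≠ y := by
        rintro rfl
        exact e (H.left_unique h' hxy)
      simpa [e, e'] using h.2 x' y' h'

open scoped Classical in
theorem Matching.mulX_mem (H : Matching inp out same) {x : α} {y : β} (hx : x ∈ inp)
    (hy : y ∈ out) {F : GenValues} {k : Kind}
    (hc : ∀ s t, (if s x = .one then
        F.coeff k (inp.map (Function.update s x .X)) (out.map t) else 0) =
      if t y = .X then F.coeff k (inp.map s) (out.map (Function.update t y .one)) else 0)
    (f : (α → Lab) → ℤ) :
    linOf (F.extend k inp out same) (mulX x f) = mulX y (linOf (F.extend k inp out same) f) := by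
  refine linOf_mulX (fun s t => ?_) f
  have h1 : Compat same (Function.update s x .X) t ↔ Compat same s t := by
    refine forall₂_congr fun x' y' => imp_congr_right fun h => ?_
    rw [Function.update_of_ne]
    rintro rfl
    exact H.not_mem_inp h hx
  have h2 : Compat same s (Function.update t y .one) ↔ Compat same s t := by
    refine forall₂_congr fun x' y' => imp_congr_right fun h => ?_
    rw [Function.update_of_ne]
    rintro rfl
    exact H.not_mem_out h hy
  rw [extend_eq, extend_eq, if_congr h1 rfl rfl, if_congr h2 rfl rfl]
  by_cases h : Compat same s t
  · simpa only [h, if_true] using hc s t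
  · simp [h]

theorem Matching.merge_mulX {a b : α} {c : β} (H : Matching [a, b] [c] same) (m : Bool)
    (f : (α → Lab) → ℤ) :
    linOf (khovanov.extend (.merge m) [a, b] [c] same) (mulX a f) =
      mulX c (linOf (khovanov.extend (.merge m) [a, b] [c] same) f) := by
  classical
  refine H.mulX_mem (by simp) (by simp) (fun s t => ?_) f
  have hab : b ≠ a := fun e => by simpa [e] using H.nodup_inp
  simp only [List.map_cons, List.map_nil, Function.update_self, Function.update_of_ne hab]
  cases s a <;> cases s b <;> cases t c <;> rfl

theorem Matching.split_mulX {a : α} {b c : β} (H : Matching [a] [b, c] same) (m : Bool)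
    (f : (α → Lab) → ℤ) :
    linOf (khovanov.extend (.split m) [a] [b, c] same) (mulX a f) =
      mulX b (linOf (khovanov.extend (.split m) [a] [b, c] same) f) := by
  classical
  refine H.mulX_mem (by simp) (by simp) (fun s t => ?_) f
  have hbc : c ≠ b := fun e => by simpa [e] using H.nodup_out
  simp only [List.map_cons, List.map_nil, Function.update_self, Function.update_of_ne hbc]
  cases s a <;> cases t b <;> cases t c <;> rfl

theorem Matching.merge_mulX' {a b : α} {c : β} (H : Matching [a, b] [c] same) (m : Bool)
    (f : (α → Lab) → ℤ) :
    linOf (khovanov.extend (.merge m) [a, b] [c] same) (mulX b f) =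
      mulX c (linOf (khovanov.extend (.merge m) [a, b] [c] same) f) := by
  rw [merge_swap]
  exact H.swap_inp.merge_mulX m f

theorem Matching.split_mulX' {a : α} {b c : β} (H : Matching [a] [b, c] same) (m : Bool)
    (f : (α → Lab) → ℤ) :
    linOf (khovanov.extend (.split m) [a] [b, c] same) (mulX a f) =
      mulX c (linOf (khovanov.extend (.split m) [a] [b, c] same) f) := by
  rw [split_swap]
  exact H.swap_out.split_mulX m f

end Operators

namespace Diagram

variable {n : ℕ} {D : Diagram n} {v v' u u' w : D.Vertex} {x y : D.Crossing}

/-! ### The saddles of Khovanov's cube -/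

theorem Joining.exists_edge (h : D.Joining v v' x) : ∃ m, D.edge khovanov v v' x =
    khovanov.extend (.merge m) [circ v (D.northPt x), circ v (D.southPt x)]
      [circ v' (D.northPt x)] SameCircle := by
  refine ⟨(nestedPair v x).1, (edge_of_joining khovanov h).trans ?_⟩
  rcases nestedPair_snd (v := v) x with e | e <;> rw [e]
  rw [merge_swap]

theorem Joining.exists_edge' (h : D.Joining v' v x) : ∃ m, D.edge khovanov v v' x =
    khovanov.extend (.split m) [circ v (D.northPt x)]
      [circ v' (D.northPt x), circ v' (D.southPt x)] SameCircle := by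
  refine ⟨(nestedPair v' x).1, (edge_of_splitting khovanov h).trans ?_⟩
  rcases nestedPair_snd (v := v') x with e | e <;> rw [e]
  rw [split_swap]

/-- The resolutions `v` and `v'` differ by a surgery at `x`. -/
def Surgery (v v' : D.Vertex) (x : D.Crossing) : Prop := D.Joining v v' x ∨ D.Joining v' v x

theorem Surgery.edge_mulX (h : Surgery v v' x) (p : D.link) (f : (D.Circle v → Lab) → ℤ) :
    linOf (D.edge khovanov v v' x) (mulX (circ v p) f) =
      mulX (circ v' p) (linOf (D.edge khovanov v v' x) f) := by
  rcases h with h | h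
  · obtain ⟨m, e⟩ := h.exists_edge
    rw [e]
    by_cases hN : D.Conn v p (D.northPt x)
    · rw [circ_eq_iff.2 hN, circ_eq_iff.2 (h.conn_mono hN)]
      exact h.matching.merge_mulX m f
    by_cases hS : D.Conn v p (D.southPt x)
    · rw [circ_eq_iff.2 hS, circ_eq_iff.2 (h.conn_mono hS), h.circ_south]
      exact h.matching.merge_mulX' m f
    exact h.matching.mulX_same (h.coe_circ_of_not hN hS) _ _ f
  · obtain ⟨m, e⟩ := h.exists_edge'
    rw [e]
    by_cases hN : D.Conn v' p (D.northPt x)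
    · rw [circ_eq_iff.2 hN, circ_eq_iff.2 (h.conn_mono hN)]
      exact h.matching'.split_mulX m f
    by_cases hS : D.Conn v' p (D.southPt x)
    · rw [circ_eq_iff.2 hS, circ_eq_iff.2 (h.conn_mono hS), h.circ_south]
      exact h.matching'.split_mulX' m f
    exact h.matching'.mulX_same (h.coe_circ_of_not hN hS).symm _ _ f

/-- Multiplication by the sum of the `X` of the circles through the northern and through the
southern side of a crossing. -/
noncomputable def handle (w : D.Vertex) (x : D.Crossing) :
    ((D.Circle w → Lab) → ℤ) →ₗ[ℤ] ((D.Circle w → Lab) → ℤ) :=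
  mulX (circ w (D.northPt x)) + mulX (circ w (D.southPt x))

open scoped Classical in
/-- The factor that the saddle at `x`, starting at a resolution `v`, contributes to the image of
the vacuum in a later resolution `w`. -/
noncomputable def factor (v w : D.Vertex) (x : D.Crossing) :
    ((D.Circle w → Lab) → ℤ) →ₗ[ℤ] ((D.Circle w → Lab) → ℤ) :=
  if D.Conn v (D.northPt x) (D.southPt x) then handle w x else LinearMap.id

theorem Joining.factor_left (h : D.Joining v v' x) : factor v w x = LinearMap.id :=
  if_neg h.not_conn

theorem Joining.factor_right (h : D.Joining v v' x) : factor v' w x = handle w x :=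
  if_pos h.conn

theorem Surgery.edge_vacuum (h : Surgery v v' x) :
    linOf (D.edge khovanov v v' x) vacuum = factor v v' x vacuum := by
  rcases h with h | h
  · obtain ⟨m, e⟩ := h.exists_edge
    rw [e, h.factor_left]
    exact h.matching.merge_vacuum m
  · obtain ⟨m, e⟩ := h.exists_edge'
    rw [e, h.factor_right]
    exact h.matching'.split_vacuum m

theorem Surgery.edge_factor (h : Surgery v v' x) (f : (D.Circle v → Lab) → ℤ) :
    linOf (D.edge khovanov v v' x) (factor u v y f) =
      factor u v' y (linOf (D.edge khovanov v v' x) f) := by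
  unfold factor
  split_ifs
  · rw [handle, handle, LinearMap.add_apply, map_add, h.edge_mulX, h.edge_mulX]
    rfl
  · rfl

theorem handle_comm (f : (D.Circle w → Lab) → ℤ) :
    handle w x (handle w y f) = handle w y (handle w x f) := by
  simp only [handle, LinearMap.add_apply, map_add, mulX_comm (circ w (D.northPt x)),
    mulX_comm (circ w (D.southPt x))]
  abel

theorem Surgery.edge_edge_vacuum (h : Surgery v u x) (h' : Surgery u w y) :
    linOf (D.edge khovanov u w y) (linOf (D.edge khovanov v u x) vacuum) =
      factor v w x (factor u w y vacuum) := by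
  rw [h.edge_vacuum, h'.edge_factor, h'.edge_vacuum]

/-! ### Two surgeries -/

theorem conn_symm {p q : Pt n} (h : D.Conn v p q) : D.Conn v q p := .symm _ _ h

theorem conn_trans {p q r : Pt n} (h : D.Conn v p q) (h' : D.Conn v q r) : D.Conn v p r :=
  .trans _ _ _ h h'

/-- If the surgery at `x` joins circles before the surgery at `y` and separates circles after it,
then both connect the same two circles. -/
theorem Joining.handle_eq (hA : D.Joining v u x) (hD : D.Joining w u' x) (hB : Surgery u w y)
    (hC : Surgery v u' y) :
    D.Joining w u y ∧ D.Joining v u' y ∧ handle w x = handle w y := by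
  have hC : D.Joining v u' y := hC.resolve_right fun h =>
    hA.not_conn (h.conn_mono (p := D.northPt x) (q := D.southPt x) hD.conn)
  have hB : D.Joining w u y := hB.resolve_left fun h =>
    hD.not_conn (h.conn_mono (p := D.northPt x) (q := D.southPt x) hA.conn)
  refine ⟨hB, hC, ?_⟩
  have h0 := ((hC.conn_iff _ (D.northPt x).2 _ (D.southPt x).2).1 hD.conn).resolve_left hA.not_conn
  have key : ∀ p q : D.link, D.Conn v p q → (q = D.northPt y ∨ q = D.southPt y) →
      D.Conn w p (D.northPt y) ∨ D.Conn w p (D.southPt y) := by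
    intro p q h hq
    rcases (hB.conn_iff _ p.2 _ q.2).1 (hA.conn_mono h) with h | h
    · rcases hq with rfl | rfl
      · exact .inl h
      · exact .inr h
    · exact h.1
  have hN : D.Conn w (D.northPt x) (D.northPt y) ∨ D.Conn w (D.northPt x) (D.southPt y) :=
    h0.1.elim (fun h => key _ (D.northPt y) h (.inl rfl)) fun h => key _ (D.southPt y) h (.inr rfl)
  have hS : D.Conn w (D.southPt x) (D.northPt y) ∨ D.Conn w (D.southPt x) (D.southPt y) :=
    h0.2.elim (fun h => key _ (D.northPt y) h (.inl rfl)) fun h => key _ (D.southPt y) h (.inr rfl)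
  have hne := hD.not_conn
  rcases hN with hN | hN <;> rcases hS with hS | hS
  · exact (hne (conn_trans hN (conn_symm hS))).elim
  · rw [handle, handle, circ_eq_iff.2 hN, circ_eq_iff.2 hS]
  · rw [handle, handle, circ_eq_iff.2 hN, circ_eq_iff.2 hS, add_comm]
  · exact (hne (conn_trans hN (conn_symm hS))).elim

/-- If the surgery at `x` separates circles before the surgery at `y` and joins circles after it,
then all involved circles become one. -/
theorem Joining.handle_eq' (hA : D.Joining u v x) (hD : D.Joining u' w x) (hB : Surgery u w y)
    (hC : Surgery v u' y) :
    D.Joining u w y ∧ D.Joining u' v y ∧ handle w x = handle w y := by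
  have hC : D.Joining u' v y := hC.resolve_left fun h =>
    hD.not_conn (h.conn_mono (p := D.northPt x) (q := D.southPt x) hA.conn)
  have hB : D.Joining u w y := hB.resolve_right fun h =>
    hA.not_conn (h.conn_mono (p := D.northPt x) (q := D.southPt x) hD.conn)
  refine ⟨hB, hC, ?_⟩
  have h0 := ((hC.conn_iff _ (D.northPt x).2 _ (D.southPt x).2).1 hA.conn).resolve_left hD.not_conn
  have hx : D.Conn w (D.northPt x) (D.southPt x) := hD.conn
  have hy : D.Conn w (D.northPt y) (D.southPt y) := hB.conn
  have hxy : D.Conn w (D.northPt x) (D.northPt y) := h0.1.elim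
    (fun h => hD.conn_mono (q := D.northPt y) h)
    fun h => conn_trans (hD.conn_mono (q := D.southPt y) h) (conn_symm hy)
  rw [handle, handle, ← circ_eq_iff.2 hx, ← circ_eq_iff.2 hy, circ_eq_iff.2 hxy]

theorem Surgery.factor_factor (hA : Surgery v u x) (hB : Surgery u w y) (hC : Surgery v u' y)
    (hD : Surgery u' w x) (f : (D.Circle w → Lab) → ℤ) :
    factor v w x (factor u w y f) = factor v w y (factor u' w x f) := by
  rcases id hA with a | a <;> rcases id hD with d | d
  · rcases id hB with b | b <;> rcases id hC with c | c
    · rw [a.factor_left, b.factor_left, c.factor_left, d.factor_left]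
    · exact ((c.handle_eq' b hD hA).2.1.not_conn a.conn).elim
    · exact ((c.handle_eq b hD hA).1.not_conn d.conn).elim
    · rw [a.factor_left, b.factor_right, c.factor_right, d.factor_left]
      rfl
  · obtain ⟨b, c, e⟩ := a.handle_eq d hB hC
    rw [a.factor_left, b.factor_right, c.factor_left, d.factor_right, e]
  · obtain ⟨b, c, e⟩ := a.handle_eq' d hB hC
    rw [a.factor_right, b.factor_left, c.factor_right, d.factor_left, e]
  · rcases id hB with b | b <;> rcases id hC with c | c
    · rw [a.factor_right, b.factor_left, c.factor_left, d.factor_right]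
      rfl
    · exact ((c.handle_eq' b hD hA).1.not_conn d.conn).elim
    · exact ((c.handle_eq b hD hA).2.1.not_conn a.conn).elim
    · rw [a.factor_right, b.factor_right, c.factor_right, d.factor_right, handle_comm]

theorem Surgery.edge_comm (hA : Surgery v u x) (hB : Surgery u w y) (hC : Surgery v u' y)
    (hD : Surgery u' w x) :
    linOf (D.edge khovanov u w y) ∘ₗ linOf (D.edge khovanov v u x) =
      linOf (D.edge khovanov u' w x) ∘ₗ linOf (D.edge khovanov v u' y) := by
  refine ext_vacuum ?_ fun c f h => ?_
  · rw [LinearMap.comp_apply, LinearMap.comp_apply, hA.edge_edge_vacuum hB,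
      hC.edge_edge_vacuum hD, hA.factor_factor hB hC hD]
  · obtain ⟨p, rfl⟩ := exists_circ c
    simp only [LinearMap.comp_apply] at h ⊢
    rw [hA.edge_mulX, hB.edge_mulX, hC.edge_mulX, hD.edge_mulX, h]

/-! ### Nonvanishing -/

theorem handle_nonneg {f : (D.Circle w → Lab) → ℤ} (hf : ∀ t, 0 ≤ f t) (t : D.Circle w → Lab) :
    0 ≤ handle w x f t :=
  add_nonneg (mulX_nonneg hf _ t) (mulX_nonneg hf _ t)

open scoped Classical in
theorem handle_pos {f : (D.Circle w → Lab) → ℤ} (hf : ∀ t, 0 ≤ f t) {t : D.Circle w → Lab}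
    (ht : 0 < f t) {c : D.Circle w}
    (hc : c = circ w (D.northPt x) ∨ c = circ w (D.southPt x)) (htc : t c = .one) :
    0 < handle w x f (Function.update t c .X) := by
  have h : mulX c f (Function.update t c .X) = f t := by
    rw [mulX_apply_of_X (by simp)]
    simp [← htc]
  rcases hc with rfl | rfl
  · exact add_pos_of_pos_of_nonneg (h ▸ ht) (mulX_nonneg hf _ _)
  · exact add_pos_of_nonneg_of_pos (mulX_nonneg hf _ _) (h ▸ ht)

theorem Surgery.edge_edge_ne_zero (h : Surgery v u x) (h' : Surgery u w y) :
    ∃ s t, ∑ r, D.edge khovanov v u x s r * D.edge khovanov u w y r t ≠ 0 := by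
  classical
  suffices H : ∃ t, 0 < factor v w x (factor u w y vacuum) t by
    obtain ⟨t, ht⟩ := H
    refine ⟨fun _ => .one, t, ne_of_gt ?_⟩
    rwa [← h.edge_edge_vacuum h', ← LinearMap.comp_apply, linOf_comp, linOf_vacuum] at ht
  have h0 : ∀ t : D.Circle w → Lab, 0 ≤ vacuum t := fun t => by
    rw [vacuum_apply]
    split_ifs <;> simp
  have h1 : 0 < vacuum (fun _ : D.Circle w => .one) := by simp [vacuum_apply]
  rcases h with a | a <;> rcases h' with b | b
  · rw [a.factor_left, b.factor_left]
    exact ⟨_, h1⟩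
  · rw [a.factor_left, b.factor_right]
    exact ⟨_, handle_pos h0 h1 (.inl rfl) rfl⟩
  · rw [a.factor_right, b.factor_left]
    exact ⟨_, handle_pos h0 h1 (.inl rfl) rfl⟩
  · rw [a.factor_right, b.factor_right]
    have : ∃ c, (c = circ w (D.northPt y) ∨ c = circ w (D.southPt y)) ∧
        circ w (D.northPt x) ≠ c := by
      by_cases e : circ w (D.northPt x) = circ w (D.northPt y)
      · exact ⟨_, .inr rfl, e ▸ b.circ_ne⟩
      · exact ⟨_, .inl rfl, e⟩
    obtain ⟨c, hc, hne⟩ := this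
    exact ⟨_, handle_pos (handle_nonneg h0) (handle_pos h0 h1 hc rfl) (.inl rfl)
      (Function.update_of_ne hne _ _)⟩

/-! ### Faces -/

theorem surgery_insert (hx : x ∉ v) : Surgery v (insert x v) x := joining_or hx

theorem union_pair (v : D.Vertex) (x y : D.Crossing) :
    v ∪ {x, y} = insert y (insert x v) := by
  ext
  simp
  tauto

theorem linOf_facePath (F : GenValues) : linOf (D.facePath F v w x y) =
    linOf (D.edge F (insert x v) w y) ∘ₗ linOf (D.edge F v (insert x v) x) :=
  (linOf_comp _ _).symm

theorem khovanov_faceCommutes (hx : x ∉ v) (hy : y ∉ v) (hxy : x ≠ y) :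
    D.FaceCommutes khovanov v x y := by
  have h1 : y ∉ insert x v := by simp [hy, hxy.symm]
  have h2 : x ∉ insert y v := by simp [hx, hxy]
  have hB := surgery_insert h1
  have hD := surgery_insert h2
  rw [← union_pair] at hB
  rw [← union_pair, Finset.pair_comm] at hD
  have := (surgery_insert hx).edge_comm hB (surgery_insert hy) hD
  rw [← linOf_facePath, ← linOf_facePath] at this
  exact fun s t => congrFun (congrFun (linOf_injective this) s) t

theorem khovanov_facePath_ne_zero (hx : x ∉ v) (hy : y ∉ v) (hxy : x ≠ y) :
    ∃ s t, D.facePath khovanov v (v ∪ {x, y}) x y s t ≠ 0 := by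
  have h1 : y ∉ insert x v := by simp [hy, hxy.symm]
  have hB := surgery_insert h1
  rw [← union_pair] at hB
  exact (surgery_insert hx).edge_edge_ne_zero hB

end Diagram

/-! ## Signs on a cube -/

section Cube

variable {α : Type} [DecidableEq α]

/-- The product of the signs around a face of the cube. -/
def faceSign (σ : Finset α → α → ℤˣ) (v : Finset α) (x y : α) : ℤˣ :=
  σ v x * σ (insert x v) y * σ v y * σ (insert y v) x

theorem faceSign_mul (σ τ : Finset α → α → ℤˣ) (v : Finset α) (x y : α) :
    faceSign (fun v x => σ v x * τ v x) v x y = faceSign σ v x y * faceSign τ v x y := by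
  simp only [faceSign]
  ac_rfl

theorem int_units_eq_of_mul_eq_one {a b : ℤˣ} (h : a * b = 1) : a = b :=
  (mul_eq_one_iff_eq_inv.1 h).trans (Int.units_inv_eq_self b)

/-- A sign on the edges of the cube with product `1` around every face is a coboundary. -/
theorem exists_potential {τ : Finset α → α → ℤˣ}
    (hτ : ∀ v x y, x ∉ v → y ∉ v → x ≠ y → faceSign τ v x y = 1) (U : Finset α) :
    ∃ η : Finset α → ℤˣ, ∀ v x, x ∉ v → insert x v ⊆ U → η (insert x v) = η v * τ v x := by
  induction U using Finset.induction_on with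
  | empty => exact ⟨fun _ => 1, fun v x _ h => absurd (h (Finset.mem_insert_self x v)) (by simp)⟩
  | insert a U ha ih =>
    obtain ⟨η, hη⟩ := ih
    have hU : ∀ {v : Finset α}, v ⊆ insert a U → a ∉ v → v ⊆ U := fun h hv =>
      (Finset.subset_insert_iff_of_notMem hv).1 h
    refine ⟨fun v => if a ∈ v then η (v.erase a) * τ (v.erase a) a else η v, fun v x hx h => ?_⟩
    by_cases hxa : x = a
    · subst hxa
      simp [hx]
    by_cases hav : a ∈ v
    · obtain ⟨v, hv, rfl⟩ : ∃ v', a ∉ v' ∧ insert a v' = v :=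
        ⟨v.erase a, Finset.notMem_erase a v, Finset.insert_erase hav⟩
      have hxv : x ∉ v := fun h => hx (Finset.mem_insert_of_mem h)
      have h1 : a ∉ insert x v := by simp [hv, Ne.symm hxa]
      have h2 : insert x v ⊆ U :=
        hU (fun z hz => h (by
          rcases Finset.mem_insert.1 hz with rfl | hz
          · simp
          · simp [hz])) h1
      have h3 := hτ v x a hxv hv hxa
      have h4 : τ v x * τ (insert x v) a = τ v a * τ (insert a v) x :=
        int_units_eq_of_mul_eq_one (by rw [← h3, faceSign]; ac_rfl)
      rw [Finset.insert_comm x a v]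
      simp only [Finset.mem_insert_self, if_true, Finset.erase_insert h1, Finset.erase_insert hv]
      rw [hη v x hxv h2, mul_assoc, h4, mul_assoc]
    · have h1 : a ∉ insert x v := by simp [hav, Ne.symm hxa]
      simp only [h1, hav, if_false]
      exact hη v x hx (hU h h1)

end Cube

namespace Diagram

variable {n : ℕ} {D : Diagram n} {v w : D.Vertex} {x y : D.Crossing}

theorem stdSign_insert {z : D.Crossing} (hy : y ∉ v) :
    D.stdSign (insert y v) z = (if y.1.2 < z.1.2 ∨ (y.1.2 = z.1.2 ∧ y.1.1 < z.1.1) then -1 else 1) *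
      D.stdSign v z := by
  classical
  unfold stdSign
  rw [Finset.filter_insert]
  split_ifs with h
  · rw [Finset.card_insert_of_notMem (by simp [hy]), pow_succ']
  · rw [one_mul]

theorem faceSign_stdSign (hx : x ∉ v) (hy : y ∉ v) (hxy : x ≠ y) :
    faceSign D.stdSign v x y = -1 := by
  rw [faceSign, stdSign_insert hx, stdSign_insert hy]
  have h1 : x.1.1 ≠ y.1.1 ∨ x.1.2 ≠ y.1.2 := by
    by_contra! h
    exact hxy (Subtype.ext (Prod.ext h.1 h.2))
  have h2 : ∀ a b c d : ℤˣ, a * (b * c) * c * (d * a) = b * d := fun a b c d => by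
    calc a * (b * c) * c * (d * a) = (a * a) * (c * c) * (b * d) := by ac_rfl
      _ = b * d := by rw [Int.units_mul_self, Int.units_mul_self, one_mul, one_mul]
  rw [h2]
  simp only [Fin.lt_def, Fin.ext_iff, ne_eq] at h1 ⊢
  split_ifs <;> first | rfl | omega

/-- The sign by which a saddle of a theory differs from Khovanov's, up to the signs of the
labelings. -/
def IsEdgeSign (P : Params) (F : GenValues) (ε : D.Vertex → D.Crossing → ℤˣ) : Prop :=
  ∀ v x, x ∉ v → ∀ s r, D.edge F v (insert x v) x s r =
    (ε v x * P.stateSign depth s * P.stateSign depth r : ℤˣ) *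
      D.edge khovanov v (insert x v) x s r

variable (D) in
theorem exists_isEdgeSign {P : Params} {F : GenValues} (hF : P.Gives F) :
    ∃ ε : D.Vertex → D.Crossing → ℤˣ, IsEdgeSign P F ε := by
  have (v : D.Vertex) (x : D.Crossing) : ∃ ε : ℤˣ, x ∉ v → ∀ s r, D.edge F v (insert x v) x s r =
      (ε * P.stateSign depth s * P.stateSign depth r : ℤˣ) *
        D.edge khovanov v (insert x v) x s r := by
    by_cases hx : x ∈ v
    · exact ⟨1, fun h => absurd hx h⟩
    · obtain ⟨ε, h⟩ := exists_edge_eq hF hx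
      exact ⟨ε, fun _ => h⟩
  choose ε hε using this
  exact ⟨ε, hε⟩

section Signs

variable {P : Params} {F : GenValues} {ε : D.Vertex → D.Crossing → ℤˣ}

theorem IsEdgeSign.facePath_eq (hε : IsEdgeSign P F ε) (hx : x ∉ v) (hy : y ∉ v) (hxy : x ≠ y)
    (s : D.Circle v → Lab) (t : D.Circle (v ∪ {x, y}) → Lab) :
    D.facePath F v (v ∪ {x, y}) x y s t =
      (ε v x * ε (insert x v) y * (P.stateSign depth s * P.stateSign depth t) : ℤˣ) *
        D.facePath khovanov v (v ∪ {x, y}) x y s t := by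
  have h1 : y ∉ insert x v := by simp [hy, hxy.symm]
  have key := hε (insert x v) y h1
  rw [← union_pair] at key
  rw [facePath, facePath, Finset.mul_sum]
  refine Finset.sum_congr rfl fun r _ => ?_
  rw [hε v x hx, key]
  have h2 : ∀ a b c d e : ℤˣ, (a * b * c) * (d * c * e) = a * d * (b * e) := fun a b c d e => by
    calc (a * b * c) * (d * c * e) = (c * c) * (a * d * (b * e)) := by ac_rfl
      _ = a * d * (b * e) := by rw [Int.units_mul_self, one_mul]
  rw [← h2 _ _ (P.stateSign depth r)]
  push_cast
  ring

theorem IsEdgeSign.face (hε : IsEdgeSign P F ε) (hx : x ∉ v) (hy : y ∉ v) (hxy : x ≠ y) :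
    (D.FaceCommutes F v x y ∧ ¬ D.FaceAnticommutes F v x y ∧ faceSign ε v x y = 1) ∨
    (D.FaceAnticommutes F v x y ∧ ¬ D.FaceCommutes F v x y ∧ faceSign ε v x y = -1) := by
  have h1 := hε.facePath_eq hx hy hxy
  have h2 := hε.facePath_eq hy hx hxy.symm
  rw [Finset.pair_comm] at h2
  have hc := khovanov_faceCommutes hx hy hxy
  obtain ⟨s, t, hne⟩ := khovanov_facePath_ne_zero hx hy hxy
  have h0 : D.facePath F v (v ∪ {x, y}) x y s t ≠ 0 := by
    rw [h1]
    exact mul_ne_zero (Units.ne_zero _) hne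
  have hs : faceSign ε v x y =
      (ε v x * ε (insert x v) y) * (ε v y * ε (insert y v) x) := by
    rw [faceSign]
    ac_rfl
  rw [hs]
  rcases Int.units_eq_one_or (ε v x * ε (insert x v) y) with a | a <;>
  rcases Int.units_eq_one_or (ε v y * ε (insert y v) x) with b | b
  all_goals
    rw [a] at h1
    rw [b] at h2
    rw [a, b]
  · have h3 : D.FaceCommutes F v x y := fun s t => by rw [h1, h2, hc s t]
    exact .inl ⟨h3, fun h4 => h0 (by linarith [h3 s t, h4 s t]), rfl⟩
  · have h3 : D.FaceAnticommutes F v x y := fun s t => by rw [h1, h2, hc s t]; simp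
    exact .inr ⟨h3, fun h4 => h0 (by linarith [h3 s t, h4 s t]), rfl⟩
  · have h3 : D.FaceAnticommutes F v x y := fun s t => by rw [h1, h2, hc s t]; simp
    exact .inr ⟨h3, fun h4 => h0 (by linarith [h3 s t, h4 s t]), rfl⟩
  · have h3 : D.FaceCommutes F v x y := fun s t => by rw [h1, h2, hc s t]
    exact .inl ⟨h3, fun h4 => h0 (by linarith [h3 s t, h4 s t]), rfl⟩

theorem IsEdgeSign.isSignAssignment_iff (hε : IsEdgeSign P F ε)
    {sgn : D.Vertex → D.Crossing → ℤˣ} :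
    D.IsSignAssignment F sgn ↔
      ∀ v x y, x ∉ v → y ∉ v → x ≠ y → faceSign sgn v x y = - faceSign ε v x y := by
  refine forall₃_congr fun v x y => forall₃_congr fun hx hy hxy => ?_
  rcases hε.face hx hy hxy with ⟨h1, h2, h3⟩ | ⟨h1, h2, h3⟩
  · rw [h3]
    exact ⟨fun h => h.1 h1, fun h => ⟨fun _ => h, fun h' => absurd h' h2⟩⟩
  · rw [h3, neg_neg]
    exact ⟨fun h => h.2 h1, fun h => ⟨fun h' => absurd h' h2, fun _ => h⟩⟩

theorem IsEdgeSign.exists_isSignAssignment (hε : IsEdgeSign P F ε) :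
    ∃ sgn, D.IsSignAssignment F sgn :=
  ⟨fun v x => ε v x * D.stdSign v x, hε.isSignAssignment_iff.2 fun v x y hx hy hxy => by
    rw [faceSign_mul, faceSign_stdSign hx hy hxy, mul_neg_one]⟩

/-- All choices of signs are related by signs of the generators of the cube complex. -/
theorem IsEdgeSign.exists_gauge (hε : IsEdgeSign P F ε) {sgn : D.Vertex → D.Crossing → ℤˣ}
    (hs : D.IsSignAssignment F sgn) : ∃ g : D.EState → ℤˣ, ∀ (v : D.Vertex) (x : D.Crossing),
      x ∉ v → ∀ s t, (sgn v x : ℤ) * D.edge F v (insert x v) x s t =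
        (g ⟨v, s⟩ * g ⟨insert x v, t⟩ : ℤˣ) *
          (D.stdSign v x * D.edge khovanov v (insert x v) x s t) := by
  rw [hε.isSignAssignment_iff] at hs
  obtain ⟨η, hη⟩ := exists_potential (τ := fun v x => sgn v x * ε v x * D.stdSign v x)
    (fun v x y hx hy hxy => by
      rw [faceSign_mul, faceSign_mul, hs v x y hx hy hxy, faceSign_stdSign hx hy hxy, neg_mul,
        Int.units_mul_self, neg_mul_neg, one_mul]) Finset.univ
  refine ⟨fun z => η z.1 * P.stateSign depth z.2, fun v x hx s t => ?_⟩
  simp only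
  rw [hε v x hx, hη v x hx (Finset.subset_univ _), ← mul_assoc, ← mul_assoc, ← Units.val_mul,
    ← Units.val_mul]
  have key : ∀ a b c d e f : ℤˣ, a * (b * e * f) = d * e * (d * (a * b * c) * f) * c := by
    intro a b c d e f
    calc a * (b * e * f) = (c * c) * ((d * d) * (a * (b * e * f))) := by
          rw [Int.units_mul_self, Int.units_mul_self, one_mul, one_mul]
      _ = d * e * (d * (a * b * c) * f) * c := by ac_rfl
  rw [key _ _ (D.stdSign v x) (η v)]

end Signs

end Diagram

theorem nonempty_homology_equiv {A B C A' B' C' : Type} [AddCommGroup A] [AddCommGroup B]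
    [AddCommGroup C] [AddCommGroup A'] [AddCommGroup B'] [AddCommGroup C'] {f : A →ₗ[ℤ] B}
    {g : B →ₗ[ℤ] C} {f' : A' →ₗ[ℤ] B'} {g' : B' →ₗ[ℤ] C'} (a : A ≃ₗ[ℤ] A') (b : B ≃ₗ[ℤ] B')
    (c : C ≃ₗ[ℤ] C') (hf : ∀ z, b (f z) = f' (a z)) (hg : ∀ z, c (g z) = g' (b z)) :
    Nonempty ((LinearMap.ker g ⧸ (LinearMap.range f).comap (LinearMap.ker g).subtype) ≃ₗ[ℤ]
      (LinearMap.ker g' ⧸ (LinearMap.range f').comap (LinearMap.ker g').subtype)) := by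
  have hker : (LinearMap.ker g).map (b : B →ₗ[ℤ] B') = LinearMap.ker g' := by
    ext z
    obtain ⟨z, rfl⟩ := b.surjective z
    simp [← hg]
  refine ⟨Submodule.Quotient.equiv _ _ (b.ofSubmodules _ _ hker) ?_⟩
  ext ⟨z, hz⟩
  obtain ⟨z, rfl⟩ := b.surjective z
  simp only [Submodule.mem_map, Submodule.mem_comap, LinearMap.mem_range, Subtype.exists,
    Submodule.subtype_apply]
  constructor
  · rintro ⟨z', hz', ⟨y, rfl⟩, e⟩
    have e : b (f y) = b z := congrArg Subtype.val e
    exact ⟨a y, by rw [← hf, e]⟩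
  · rintro ⟨y, e⟩
    obtain ⟨y, rfl⟩ := a.surjective y
    rw [← hf] at e
    have e := b.injective e
    subst e
    exact ⟨f y, by simpa [← hg] using hz, ⟨y, rfl⟩, Subtype.ext rfl⟩

namespace Diagram

variable {n : ℕ} {D : Diagram n} {v w : D.Vertex} {x y : D.Crossing}

/-! ### Degrees -/

theorem sum_deg_of_edge_ne_zero (hx : x ∉ v) {s : D.Circle v → Lab}
    {t : D.Circle (insert x v) → Lab} (h : D.edge khovanov v (insert x v) x s t ≠ 0) :
    ∑ c, (t c).deg + 1 = ∑ c, (s c).deg := by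
  rcases joining_or hx with hj | hj
  · obtain ⟨m, e⟩ := hj.exists_edge
    rw [e, extend_eq] at h
    have hc : Compat SameCircle s t := of_not_not fun hc => h (if_neg hc)
    rw [if_pos hc] at h
    have key := hj.matching.sum_eq (fun c => (s c).deg) (fun c => (t c).deg)
      fun c c' hcc => congrArg _ (hc c c' hcc)
    simp only [List.map_cons, List.map_nil, List.sum_cons, List.sum_nil] at key h
    have h2 : ∀ a b c : Lab, kmul a b c ≠ 0 → c.deg + 1 = a.deg + b.deg := by
      intro a b c
      cases a <;> cases b <;> cases c <;> simp [signedMul, Lab.deg]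
    have := h2 _ _ _ h
    linarith
  · obtain ⟨m, e⟩ := hj.exists_edge'
    rw [e, extend_eq] at h
    have hc : Compat SameCircle s t := of_not_not fun hc => h (if_neg hc)
    rw [if_pos hc] at h
    have key := hj.matching'.sum_eq (fun c => (s c).deg) (fun c => (t c).deg)
      fun c c' hcc => congrArg _ (hc c c' hcc)
    simp only [List.map_cons, List.map_nil, List.sum_cons, List.sum_nil] at key h
    have h2 : ∀ a b c : Lab, kcomul a b c ≠ 0 → b.deg + c.deg + 1 = a.deg := by
      intro a b c
      cases a <;> cases b <;> cases c <;> simp [signedComul, Lab.deg]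
    have := h2 _ _ _ h
    linarith

open scoped Classical in
/-- The contribution of the crossing `x` to the coefficients of the differential. -/
noncomputable def term (F : GenValues) (sgn : D.Vertex → D.Crossing → ℤˣ) (x : D.Crossing)
    (z z' : D.EState) : ℤ :=
  if x ∉ z.1 ∧ z'.1 = insert x z.1 then (sgn z.1 x : ℤ) * D.edge F z.1 z'.1 x z.2 z'.2 else 0

theorem d_eq (F : GenValues) (sgn : D.Vertex → D.Crossing → ℤˣ) (r r' q : ℤ) :
    D.d F sgn r r' q = linOf fun z z' => ∑ x, term F sgn x z.1 z'.1 := rfl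

theorem degrees_of_term_ne_zero {sgn : D.Vertex → D.Crossing → ℤˣ} {z z' : D.EState}
    (h : term khovanov sgn x z z' ≠ 0) :
    D.hdeg z' = D.hdeg z + 1 ∧ D.qdeg z' = D.qdeg z := by
  obtain ⟨v, s⟩ := z
  obtain ⟨w, t⟩ := z'
  have hc : x ∉ v ∧ w = insert x v := of_not_not fun hc => h (if_neg hc)
  obtain ⟨hx, rfl⟩ := hc
  rw [term, if_pos ⟨hx, rfl⟩] at h
  have := sum_deg_of_edge_ne_zero hx (right_ne_zero_of_mul h)
  simp only [hdeg, qdeg, Finset.card_insert_of_notMem hx]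
  push_cast
  constructor <;> linarith

/-! ### The differential -/

noncomputable instance : Fintype D.EState :=
  have : Finite D.EState := inferInstanceAs (Finite (Σ v : D.Vertex, (D.Circle v → Lab)))
  Fintype.ofFinite _

theorem sum_term_term (sgn : D.Vertex → D.Crossing → ℤˣ) (x y : D.Crossing) (z w : D.EState)
    (hx : x ∉ z.1) (hy : y ∉ z.1) (hxy : x ≠ y) (hw : w.1 = z.1 ∪ {x, y}) :
    ∑ z', term khovanov sgn x z z' * term khovanov sgn y z' w =
      (sgn z.1 x * sgn (insert x z.1) y : ℤˣ) * D.facePath khovanov z.1 w.1 x y z.2 w.2 := by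
  obtain ⟨v, s⟩ := z
  obtain ⟨w, t⟩ := w
  simp only at hx hy hw ⊢
  subst hw
  rw [facePath, Finset.mul_sum]
  symm
  have h1 : y ∉ insert x v := by simp [hy, hxy.symm]
  refine Fintype.sum_of_injective (fun r => (⟨insert x v, r⟩ : D.EState))
    (fun _ _ h => eq_of_heq (Sigma.mk.inj h).2) _ _
    (fun z' hz' => ?_) fun r => ?_
  · rw [term, if_neg, zero_mul]
    rintro ⟨-, e⟩
    obtain ⟨v', r⟩ := z'
    simp only at e
    subst e
    exact hz' ⟨r, rfl⟩
  · rw [term, term, if_pos ⟨hx, rfl⟩, if_pos ⟨h1, union_pair v x y⟩]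
    push_cast
    ring

theorem sum_term_term_of_not (sgn : D.Vertex → D.Crossing → ℤˣ) (x y : D.Crossing)
    (z w : D.EState) (h : ¬ (x ∉ z.1 ∧ y ∉ z.1 ∧ x ≠ y ∧ w.1 = z.1 ∪ {x, y})) :
    ∑ z', term khovanov sgn x z z' * term khovanov sgn y z' w = 0 := by
  refine Finset.sum_eq_zero fun z' _ => ?_
  by_cases h1 : x ∉ z.1 ∧ z'.1 = insert x z.1
  · by_cases h2 : y ∉ z'.1 ∧ w.1 = insert y z'.1
    · rw [h1.2] at h2
      refine absurd ⟨h1.1, fun hy => h2.1 (Finset.mem_insert_of_mem hy), ?_, ?_⟩ h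
      · rintro rfl
        exact h2.1 (Finset.mem_insert_self _ _)
      · rw [h2.2, union_pair]
    · rw [term, term, if_neg h2, mul_zero]
  · rw [term, if_neg h1, zero_mul]

theorem sum_term_term_swap (x y : D.Crossing) (z w : D.EState) :
    ∑ z', term khovanov D.stdSign x z z' * term khovanov D.stdSign y z' w =
      - ∑ z', term khovanov D.stdSign y z z' * term khovanov D.stdSign x z' w := by
  by_cases h : x ∉ z.1 ∧ y ∉ z.1 ∧ x ≠ y ∧ w.1 = z.1 ∪ {x, y}
  · obtain ⟨hx, hy, hxy, hw⟩ := h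
    rw [sum_term_term _ x y z w hx hy hxy hw,
      sum_term_term _ y x z w hy hx hxy.symm (by rw [hw, Finset.pair_comm])]
    obtain ⟨v, s⟩ := z
    obtain ⟨w, t⟩ := w
    simp only at hx hy hw ⊢
    subst hw
    have h1 : D.stdSign v x * D.stdSign (insert x v) y =
        -(D.stdSign v y * D.stdSign (insert y v) x) :=
      int_units_eq_of_mul_eq_one (by
        rw [mul_neg, ← mul_assoc, ← neg_eq_iff_eq_neg.2 (faceSign_stdSign hx hy hxy).symm.symm]
        simp [faceSign])
    rw [khovanov_faceCommutes hx hy hxy s t, h1]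
    push_cast
    ring
  · rw [sum_term_term_of_not _ x y z w h, sum_term_term_of_not _ y x z w, neg_zero]
    refine fun h' => h ⟨h'.2.1, h'.1, h'.2.2.1.symm, ?_⟩
    rw [h'.2.2.2, Finset.pair_comm]

variable (D) in
theorem khovanov_d_comp_d (r q : ℤ) :
    D.d khovanov D.stdSign (r + 1) (r + 2) q ∘ₗ D.d khovanov D.stdSign r (r + 1) q = 0 := by
  have h0 : ∀ z w : D.EState, ∑ x, ∑ y,
      ∑ z', term khovanov D.stdSign x z z' * term khovanov D.stdSign y z' w = 0 := by
    intro z w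
    refine self_eq_neg.1 ?_
    conv_rhs => rw [Finset.sum_comm]
    rw [← Finset.sum_neg_distrib]
    refine Finset.sum_congr rfl fun x _ => ?_
    rw [← Finset.sum_neg_distrib]
    exact Finset.sum_congr rfl fun y _ => sum_term_term_swap x y z w
  rw [d_eq, d_eq, linOf_comp]
  refine LinearMap.ext fun f => funext fun w => ?_
  rw [linOf_apply]
  refine Finset.sum_eq_zero fun z _ => mul_eq_zero_of_right _ ?_
  rw [← h0 z.1 w.1]
  simp only [Finset.sum_mul_sum]
  rw [Finset.sum_comm]
  refine Finset.sum_congr rfl fun x _ => ?_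
  rw [Finset.sum_comm]
  refine Finset.sum_congr rfl fun y _ => ?_
  refine Fintype.sum_of_injective (fun z' : D.Basis (r + 1) q => z'.1) Subtype.val_injective _ _
    (fun z' hz' => ?_) fun _ => rfl
  refine mul_eq_zero_of_left (of_not_not fun h => hz' ?_) _
  have := degrees_of_term_ne_zero h
  exact ⟨⟨z', by rw [this.1, z.2.1], by rw [this.2, z.2.2]⟩, rfl⟩

/-- The change of signs of the generators in a bidegree. -/
noncomputable def gaugeEquiv (g : D.EState → ℤˣ) (r q : ℤ) : D.Chain r q ≃ₗ[ℤ] D.Chain r q where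
  toFun f z := g z.1 * f z
  invFun f z := g z.1 * f z
  map_add' f f' := funext fun z => mul_add _ _ _
  map_smul' c f := funext fun z => mul_left_comm _ _ _
  left_inv f := funext fun z => by
    simp only
    rw [← mul_assoc, ← Units.val_mul, Int.units_mul_self, Units.val_one, one_mul]
  right_inv f := funext fun z => by
    simp only
    rw [← mul_assoc, ← Units.val_mul, Int.units_mul_self, Units.val_one, one_mul]

theorem gaugeEquiv_apply (g : D.EState → ℤˣ) {r q : ℤ} (f : D.Chain r q) (z : D.Basis r q) :
    gaugeEquiv g r q f z = g z.1 * f z := rfl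

variable {P : Params} {F : GenValues} {ε : D.Vertex → D.Crossing → ℤˣ}

/-- The cube complex of a theory is isomorphic to Khovanov's. -/
theorem IsEdgeSign.exists_gaugeEquiv (hε : IsEdgeSign P F ε)
    {sgn : D.Vertex → D.Crossing → ℤˣ} (hs : D.IsSignAssignment F sgn) :
    ∃ g : D.EState → ℤˣ, ∀ r r' q f, gaugeEquiv g r' q (D.d F sgn r r' q f) =
      D.d khovanov D.stdSign r r' q (gaugeEquiv g r q f) := by
  obtain ⟨g, hg⟩ := hε.exists_gauge hs
  have key : ∀ x z z', term F sgn x z z' =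
      (g z * g z' : ℤˣ) * term khovanov D.stdSign x z z' := by
    rintro x ⟨v, s⟩ ⟨w, t⟩
    by_cases h : x ∉ v ∧ w = insert x v
    · obtain ⟨hx, rfl⟩ := h
      rw [term, term, if_pos ⟨hx, rfl⟩, if_pos ⟨hx, rfl⟩]
      exact hg v x hx s t
    · rw [term, term, if_neg h, if_neg h, mul_zero]
  refine ⟨g, fun r r' q f => funext fun w => ?_⟩
  rw [gaugeEquiv_apply, d_eq, d_eq, linOf_apply, linOf_apply, Finset.mul_sum]
  refine Finset.sum_congr rfl fun z _ => ?_
  rw [gaugeEquiv_apply]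
  simp only [key]
  rw [← Finset.mul_sum, Units.val_mul]
  have h1 : (g w.1 : ℤ) * g w.1 = 1 := by
    rw [← Units.val_mul, Int.units_mul_self, Units.val_one]
  linear_combination (f z * g z.1 * ∑ x, term khovanov D.stdSign x z.1 w.1) * h1

theorem IsEdgeSign.d_comp_d (hε : IsEdgeSign P F ε) {sgn : D.Vertex → D.Crossing → ℤˣ}
    (hs : D.IsSignAssignment F sgn) (r q : ℤ) :
    D.d F sgn (r + 1) (r + 2) q ∘ₗ D.d F sgn r (r + 1) q = 0 := by
  obtain ⟨g, hg⟩ := hε.exists_gaugeEquiv hs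
  refine LinearMap.ext fun f => (gaugeEquiv g (r + 2) q).injective ?_
  rw [LinearMap.comp_apply, hg, hg, ← LinearMap.comp_apply, khovanov_d_comp_d]
  simp

theorem IsEdgeSign.nonempty_homology_equiv_kh (hε : IsEdgeSign P F ε)
    {sgn : D.Vertex → D.Crossing → ℤˣ} (hs : D.IsSignAssignment F sgn) (r q : ℤ) :
    Nonempty (D.Homology F sgn r q ≃ₗ[ℤ] D.Kh r q) := by
  obtain ⟨g, hg⟩ := hε.exists_gaugeEquiv hs
  exact nonempty_homology_equiv (gaugeEquiv g _ _) (gaugeEquiv g _ _) (gaugeEquiv g _ _)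
    (hg _ _ _) (hg _ _ _)

end Diagram

end NestedKh

theorem theorem2 :
    -- the possible operations, in terms of ten signs
    (∀ (μ δ : Bool → Lab → Lab → Lab → ℤ),
      (∃ F : GenValues, IsKhovanovLike F ∧ F.mul = μ ∧ F.comul = δ) ↔
        ∃ e₁ e₂ e₃ e₄ e₅ e₆ e₇ e₈ e₉ e₁₀ : ℤˣ,
          (e₁ = e₂ ∧ e₃ = e₄ ∧ e₅ = e₆ ∧ e₈ = e₁₀ ∧ e₇ * e₈ = e₅ * e₉) ∧
          μ false = signedMul e₁ e₂ e₂ ∧ μ true = signedMul e₅ e₆ e₇ ∧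
          δ false = signedComul e₃ e₃ e₄ ∧ δ true = signedComul e₈ e₉ e₁₀) ∧
    -- there are 32 cases
    Set.ncard {p : (Bool → Lab → Lab → Lab → ℤ) × (Bool → Lab → Lab → Lab → ℤ) |
      ∃ F : GenValues, IsKhovanovLike F ∧ F.mul = p.1 ∧ F.comul = p.2} = 32 ∧
    -- each of them gives complexes isomorphic to those of Khovanov
    ∀ (E : Z2Extension), E.IsStrict → ∀ T : EQFT E,
      T.val.Graded → T.val.ModTwoEq khovanov →
      (∀ (n : ℕ) (D : Diagram n),
        (∀ (v : D.Vertex) (x y : D.Crossing), x ∉ v → y ∉ v → x ≠ y →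
          D.FaceCommutes T.val v x y ∨ D.FaceAnticommutes T.val v x y) ∧
        (∃ sgn, D.IsSignAssignment T.val sgn) ∧
        ∀ sgn, D.IsSignAssignment T.val sgn →
          (∀ r q, D.d T.val sgn (r + 1) (r + 2) q ∘ₗ D.d T.val sgn r (r + 1) q = 0) ∧
          (∃ Φ : ∀ r q, D.Chain r q ≃ₗ[ℤ] D.Chain r q, ∀ r q,
            (Φ (r + 1) q).toLinearMap ∘ₗ D.d T.val sgn r (r + 1) q =
              D.d khovanov D.stdSign r (r + 1) q ∘ₗ (Φ r q).toLinearMap) ∧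
          ∀ r q, Nonempty (D.Homology T.val sgn r q ≃ₗ[ℤ] D.Kh r q)) ∧
      -- in particular the homology is invariant whenever Khovanov homology is
      ∀ (n n' : ℕ) (D : Diagram n) (D' : Diagram n'),
        (∀ r q, Nonempty (D.Kh r q ≃ₗ[ℤ] D'.Kh r q)) →
        ∀ sgn sgn', D.IsSignAssignment T.val sgn → D'.IsSignAssignment T.val sgn' →
          ∀ r q, Nonempty (D.Homology T.val sgn r q ≃ₗ[ℤ] D'.Homology T.val sgn' r q) := by
  refine ⟨fun μ δ => (exists_isKhovanovLike_iff μ δ).trans (exists_params_iff μ δ),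
    ncard_operations, fun E _ T hG _ => ?_⟩
  obtain ⟨P, hP⟩ := T.exists_params hG
  constructor
  · intro n D
    obtain ⟨ε, hε⟩ := D.exists_isEdgeSign hP
    refine ⟨fun v x y hx hy hxy => ?_, hε.exists_isSignAssignment, fun sgn hs =>
      ⟨hε.d_comp_d hs, ?_, hε.nonempty_homology_equiv_kh hs⟩⟩
    · rcases hε.face hx hy hxy with h | h
      · exact .inl h.1
      · exact .inr h.1
    · obtain ⟨g, hg⟩ := hε.exists_gaugeEquiv hs
      exact ⟨Diagram.gaugeEquiv g, fun r q => LinearMap.ext fun f => hg r (r + 1) q f⟩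
  · intro n n' D D' h sgn sgn' hs hs' r q
    obtain ⟨ε, hε⟩ := D.exists_isEdgeSign hP
    obtain ⟨ε', hε'⟩ := D'.exists_isEdgeSign hP
    obtain ⟨e⟩ := hε.nonempty_homology_equiv_kh hs r q
    obtain ⟨e'⟩ := hε'.nonempty_homology_equiv_kh hs' r q
    obtain ⟨f⟩ := h r q
    exact ⟨e.trans (f.trans e'.symm)⟩
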